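/- A reward-mixing Markov decision process (RMMDP) with $M$ contexts consists of finite state and action spaces $\mathcal S,\mathcal A$, an initial state distribution $\nu$, transition probabilities $T(\cdot\mid s,a)$, mixing weights $w_1,\dots,w_M$ and reward distributions $\mu_m(s,a,\cdot)$, $m\in[M]$, on a finite set $\mathcal Z\subset[-1,1]$. In each episode of length $H$ a latent context $m$ is drawn with probability $w_m$ and kept, never observed, for the whole episode: $s_1\sim\nu$, the action $a_t$ is chosen from the history $(s_1,a_1,r_1,\dots,s_{t-1},a_{t-1},r_{t-1},s_t)$ by a history-dependent policy, $r_t\sim\mu_m(s_t,a_t,\cdot)$ and $s_{t+1}\sim T(\cdot\mid s_t,a_t)$. Let $V^\pi=\mathbb E_\pi\big[\sum_{t=1}^H r_t\big]$. A policy $\pi$ is $\epsilon$-optimal if $V^\pi\ge V^{\pi'}-\epsilon$ for every history-dependent policy $\pi'$. A learning algorithm plays a number of episodes, each with a history-dependent policy chosen as a function of the trajectories $(s_t,a_t,r_t)_{t=1}^H$ of the earlier episodes, and then outputs a policy as a function of all observed trajectories. Write $S=|\mathcal S|$, $A=|\mathcal A|\ge1$, $Z=|\mathcal Z|$. **Corollary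 (Improved sample complexity for balanced 2-RMMDPs).** There are a universal constant $C>0$ and universal exponents $p,q\in\mathbb N$ such that the following holds for all finite $\mathcal S,\mathcal A$, all finite $\mathcal Z\subset[-1,1]$, all $H\in\mathbb N$, $\epsilon>0$, $\eta\in(0,1)$ and all $K\in\mathbb N$ with $$K\;\ge\;C\cdot\frac{(SA)^2}{\epsilon^2}\cdot(HZ)^p\cdot\big(1+\log(K/\eta)\big)^q .$$ There is a learning algorithm (which may depend on $\mathcal S,\mathcal A,\mathcal Z,H,\epsilon,\eta,K$, but not on $\nu,T,\mu_1,\mu_2$) that uses at most $K$ episodes and, for every RMMDP on these data with $M=2$ contexts and $w_1=w_2=1/2$, outputs an $\epsilon$-optimal policy with probability at least $1-\eta$. -/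

import Mathlib

/-- A reward-mixing Markov decision process with `M` latent contexts, state space `S`, action space
`A` and finite set `R` of possible rewards. The initial distribution and the transition
probabilities are common to all contexts; the reward distribution `reward m s a` of a state-action
pair `(s, a)` depends on the latent context `m`, which is drawn from `weight` at the beginning of
every episode, is kept during the whole episode, and is never observed. -/
structure RMMDP (M : ℕ) (S A : Type*) [Fintype S] (R : Finset ℝ) where
  init : S → ℝ
  init_mem : init ∈ stdSimplex ℝ S
  trans : S → A → S → ℝ
  trans_mem : ∀ s a, trans s a ∈ stdSimplex ℝ S
  weight : Fin M → ℝ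
  weight_mem : weight ∈ stdSimplex ℝ (Fin M)
  reward : Fin M → S → A → R → ℝ
  reward_mem : ∀ m s a, reward m s a ∈ stdSimplex ℝ R

namespace RMMDP

/-- Observed steps `(s, a, r)`: state, action, reward. -/
abbrev Step (S A : Type*) (R : Finset ℝ) := S × A × R

/-- History-dependent policies: the past `(state, action, reward)` triples of the episode, oldest
first, and the current state determine the action. -/
abbrev Policy (S A : Type*) (R : Finset ℝ) := List (Step S A R) → S → A

/-- Everything that is observed in one episode of length `H`. -/
abbrev Trajectory (S A : Type*) (R : Finset ℝ) (H : ℕ) := Fin H → Step S A R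

section Model

variable {M : ℕ} {S A : Type*} [Fintype S] [Fintype A] {R : Finset ℝ} {H : ℕ}

/-- Probability of the state at time `t`, given the steps before time `t`. -/
def stateProb (𝓜 : RMMDP M S A R) (τ : Trajectory S A R H) : Fin H → ℝ
  | ⟨0, h⟩ => 𝓜.init (τ ⟨0, h⟩).1
  | ⟨t + 1, h⟩ =>
      𝓜.trans (τ ⟨t, Nat.lt_of_succ_lt h⟩).1 (τ ⟨t, Nat.lt_of_succ_lt h⟩).2.1 (τ ⟨t + 1, h⟩).1

open Classical in
/-- Probability of the action at time `t` under the policy `π`, given the steps before time `t`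
and the state at time `t`. -/
noncomputable def actionProb (π : Policy S A R) (τ : Trajectory S A R H) (t : Fin H) : ℝ :=
  if π ((List.ofFn τ).take t) (τ t).1 = (τ t).2.1 then 1 else 0

/-- Probability of the trajectory `τ` under the policy `π` in the latent context `m`. -/
noncomputable def contextProb (𝓜 : RMMDP M S A R) (π : Policy S A R) (m : Fin M)
    (τ : Trajectory S A R H) : ℝ :=
  ∏ t, 𝓜.stateProb τ t * actionProb π τ t * 𝓜.reward m (τ t).1 (τ t).2.1 (τ t).2.2

/-- Probability of the trajectory `τ` in an episode in which the policy `π` is played: a context is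
drawn at the beginning and kept for the whole episode. -/
noncomputable def trajProb (𝓜 : RMMDP M S A R) (π : Policy S A R) (τ : Trajectory S A R H) : ℝ :=
  ∑ m, 𝓜.weight m * 𝓜.contextProb π m τ

/-- Expected cumulative reward of the policy `π` in an episode of length `H`. -/
noncomputable def value (𝓜 : RMMDP M S A R) (H : ℕ) (π : Policy S A R) : ℝ :=
  ∑ τ : Trajectory S A R H, 𝓜.trajProb π τ * ∑ t, ((τ t).2.2 : ℝ)

/-- `π` is `ε`-optimal among all history-dependent policies. -/
def IsEpsOptimal (𝓜 : RMMDP M S A R) (H : ℕ) (ε : ℝ) (π : Policy S A R) : Prop :=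
  ∀ π' : Policy S A R, 𝓜.value H π' - ε ≤ 𝓜.value H π

end Model

/-- A learning algorithm for episodes of length `H`: it plays `episodes` episodes, each with a
policy `explore D` that depends on the trajectories `D` observed in the earlier episodes, and then
returns a policy `output D` that depends on all the observed trajectories. It has no other access
to the model. -/
structure Learner (S A : Type*) (R : Finset ℝ) (H : ℕ) where
  episodes : ℕ
  explore : List (Trajectory S A R H) → Policy S A R
  output : List (Trajectory S A R H) → Policy S A R

section Learning

variable {M : ℕ} {S A : Type*} [Fintype S] [Fintype A] {R : Finset ℝ} {H : ℕ}

/-- Probability that the learner `𝓛`, run in the model `𝓜`, observes the trajectories `D`. -/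
noncomputable def Learner.dataProb (𝓛 : Learner S A R H) (𝓜 : RMMDP M S A R)
    (D : Fin 𝓛.episodes → Trajectory S A R H) : ℝ :=
  ∏ k : Fin 𝓛.episodes, 𝓜.trajProb (𝓛.explore ((List.ofFn D).take k)) (D k)

open Classical in
/-- Probability that the learner `𝓛`, run in the model `𝓜`, returns an `ε`-optimal policy. -/
noncomputable def Learner.successProb (𝓛 : Learner S A R H) (𝓜 : RMMDP M S A R) (ε : ℝ) : ℝ :=
  ∑ D : Fin 𝓛.episodes → Trajectory S A R H,
    if 𝓜.IsEpsOptimal H ε (𝓛.output (List.ofFn D)) then 𝓛.dataProb 𝓜 D else 0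

end Learning

end RMMDP

/-! With equal weights, write the reward laws of the two contexts as p + d and p − d. Single rewards
reveal p. Pairs of rewards at two different times reveal p(x)p(y) + d(x)d(y), hence the products
d(x)d(y). Exchanging the contexts turns d into −d and leaves the balanced mixture unchanged, so d
matters only up to a global sign, and these products suffice to control the law of all rewards of an
episode. Only pairs of state-action pairs have to be explored, which is the source of the factor
(SA)².

Quantitatively, fix the states and actions of an episode, and consider the product of the numbers 1
+ (total variation between the contexts) over its steps. If it exceeds 12, at least three steps have
a clearly nonzero d. The identity d₁² = (d₁d₂)(d₁d₃)/(d₂d₃) then recovers d up to a common sign, and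
the product laws are compared context by context (`exists_sign_forall_abs_sub_le`,
`abs_mixProb_sub_le_of_lt_growth`). If it is at most 12, a recursion that uses d only through
products of two entries propagates the error with this product as growth factor (`mixErr_concat_le`,
`listSum_mixErr_div_growth_le`). Together they give `listSum_abs_mixProb_sub_le`.

Policies may react to rewards, but the pairwise error bound depends on states and actions only, and
the reward probabilities that multiply it are dominated by non-anticipating functions (`IsCausal`).
The worst expected error is therefore bounded by a planning value over reward-blind policies
(`optVal`, `listSum_planWeight_le`). Exploration can thus ignore rewards, and this keeps the
observed rewards unbiased given the states and actions (`sum_trajProb_reward_eq_zero`).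

The learner keeps all balanced models that pass every test on the data, and plays a policy
maximising, in one of them, the expected sum of confidence widths. Two consistent models assign this
bonus the same value up to a factor polynomial in H (`optVal_bonus_le_bonusMean`). Widths decay like
the inverse square root of a count, so the bonuses collected in K episodes total SA√K up to
polynomial and logarithmic factors (`sum_sqrt_count_le`). The bonus only decreases with more data,
so its final maximal value is of order SA/√K (`optVal_bonus_le`). The value of every policy is then
known up to ε/2, and an optimal policy of any consistent model is ε-optimal. The confidence
statements follow from a self-normalised martingale bound (`IsKernel.listSum_tail_le`) and a union
bound. -/

namespace RMMDP

/-! ### Products and sums along histories, and a convexity bound for the exponential -/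

section Lists

variable {X : Type*}

/-- Recursion over a list from its end. -/
noncomputable def snocFold {β : Type*} (b : β) (f : List X → X → β → β) (l : List X) : β :=
  List.reverseRecOn l b f

@[simp] theorem snocFold_nil {β : Type*} (b : β) (f : List X → X → β → β) :
    snocFold b f [] = b := by simp [snocFold]

@[simp] theorem snocFold_concat {β : Type*} (b : β) (f : List X → X → β → β) (h : List X) (x : X) :
    snocFold b f (h ++ [x]) = f h x (snocFold b f h) := by simp [snocFold]

/-- The product of `κ (prefix) (next entry)` along a list. -/
noncomputable def pathProd (κ : List X → X → ℝ) : List X → ℝ := snocFold 1 fun h x v => v * κ h x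

/-- The sum of `f (prefix) (next entry)` along a list. -/
noncomputable def pathSum (f : List X → X → ℝ) : List X → ℝ := snocFold 0 fun h x v => v + f h x

@[simp] theorem pathProd_nil (κ : List X → X → ℝ) : pathProd κ [] = 1 := snocFold_nil _ _

@[simp] theorem pathProd_concat (κ : List X → X → ℝ) (h : List X) (x : X) :
    pathProd κ (h ++ [x]) = pathProd κ h * κ h x := snocFold_concat _ _ _ _

@[simp] theorem pathSum_nil (f : List X → X → ℝ) : pathSum f [] = 0 := snocFold_nil _ _

@[simp] theorem pathSum_concat (f : List X → X → ℝ) (h : List X) (x : X) :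
    pathSum f (h ++ [x]) = pathSum f h + f h x := snocFold_concat _ _ _ _

theorem pathProd_nonneg {κ : List X → X → ℝ} (hκ : ∀ h x, 0 ≤ κ h x) (l : List X) :
    0 ≤ pathProd κ l := by
  induction l using List.reverseRecOn with
  | nil => simp
  | append_singleton h x ih => rw [pathProd_concat]; exact mul_nonneg ih (hκ _ _)

theorem pathSum_const (f : X → ℝ) (l : List X) : pathSum (fun _ x => f x) l = (l.map f).sum := by
  induction l using List.reverseRecOn with
  | nil => simp
  | append_singleton h x ih => simp [ih]

theorem pathProd_ofFn (κ : List X → X → ℝ) {n : ℕ} (τ : Fin n → X) :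
    pathProd κ (List.ofFn τ) = ∏ t : Fin n, κ ((List.ofFn τ).take t) (τ t) := by
  induction n with
  | zero => simp
  | succ n ih =>
    rw [List.ofFn_succ', List.concat_eq_append, pathProd_concat, ih, Fin.prod_univ_castSucc]
    congr 1
    · refine Finset.prod_congr rfl fun t _ => ?_
      rw [List.take_append_of_le_length (by simp)]
      rfl
    · rw [List.take_append_of_le_length (by simp), List.take_of_length_le (by simp)]

/-- Allows a union bound over the finitely many values of a count. The last clause disposes of the
value zero, where the weighted sum vanishes too. -/
theorem pathSum_indicator_eq_nat {φ : List X → X → ℝ} (hφ : ∀ h x, φ h x = 0 ∨ φ h x = 1)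
    (y : List X → X → ℝ) (l : List X) :
    ∃ k : ℕ, pathSum φ l = k ∧ k ≤ l.length ∧
      (k = 0 → pathSum (fun h x => φ h x * y h x) l = 0) := by
  induction l using List.reverseRecOn with
  | nil => exact ⟨0, by simp⟩
  | append_singleton h x ih =>
    obtain ⟨k, h1, h2, h3⟩ := ih
    rcases hφ h x with h0 | h0
    · exact ⟨k, by simp [h1, h0], by simp; omega, fun hk => by simp [h3 hk, h0]⟩
    · exact ⟨k + 1, by simp [h1, h0], by simp; omega, by simp⟩

/-- On [−b, b] the exponential lies below its chord. The part of the chord that is linear in y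
disappears when a centred increment is averaged. -/
theorem exp_mul_le_cosh_add {b y : ℝ} (hb : 0 < b) (hy : |y| ≤ b) (a : ℝ) :
    Real.exp (a * y) ≤ Real.cosh (a * b) + y / b * Real.sinh (a * b) := by
  obtain ⟨h1, h2⟩ := abs_le.1 hy
  have h3 : 0 ≤ (1 + y / b) / 2 := by
    have := (div_le_one hb).2 (by linarith : -y ≤ b)
    rw [neg_div] at this
    linarith
  have h4 : 0 ≤ (1 - y / b) / 2 := by
    have := (div_le_one hb).2 h2
    linarith
  have hc := convexOn_exp.2 (Set.mem_univ (a * b)) (Set.mem_univ (-(a * b))) h3 h4 (by ring)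
  have e : ((1 + y / b) / 2) • (a * b) + ((1 - y / b) / 2) • (-(a * b)) = a * y := by
    simp only [smul_eq_mul]; field_simp; ring
  rw [e] at hc
  refine hc.trans_eq ?_
  rw [Real.cosh_eq, Real.sinh_eq]
  simp only [smul_eq_mul]
  ring

end Lists

/-! ### History-dependent processes and self-normalised concentration -/

section ListSum

variable {X : Type*} [Fintype X]

/-- The sum of `G` over all lists of length `n`. -/
noncomputable def listSum (n : ℕ) (G : List X → ℝ) : ℝ := ∑ τ : Fin n → X, G (List.ofFn τ)

theorem listSum_zero (G : List X → ℝ) : listSum 0 G = G [] := by simp [listSum]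

theorem listSum_succ (n : ℕ) (G : List X → ℝ) :
    listSum (n + 1) G = listSum n (fun h => ∑ x, G (h ++ [x])) := by
  unfold listSum
  rw [← (Fin.snocEquiv (fun _ : Fin (n + 1) => X)).sum_comp, Fintype.sum_prod_type,
    Finset.sum_comm]
  refine Finset.sum_congr rfl fun τ _ => Finset.sum_congr rfl fun x _ => ?_
  congr 1
  rw [List.ofFn_succ']
  simp [Fin.snocEquiv]

theorem listSum_mono {n : ℕ} {G G' : List X → ℝ} (h : ∀ l, l.length = n → G l ≤ G' l) :
    listSum n G ≤ listSum n G' :=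
  Finset.sum_le_sum fun _ _ => h _ (by simp)

theorem listSum_congr {n : ℕ} {G G' : List X → ℝ} (h : ∀ l, l.length = n → G l = G' l) :
    listSum n G = listSum n G' :=
  Finset.sum_congr rfl fun _ _ => h _ (by simp)

theorem listSum_add (n : ℕ) (G G' : List X → ℝ) :
    listSum n (fun l => G l + G' l) = listSum n G + listSum n G' :=
  Finset.sum_add_distrib

theorem listSum_mul_left (n : ℕ) (c : ℝ) (G : List X → ℝ) :
    listSum n (fun l => c * G l) = c * listSum n G :=
  (Finset.mul_sum _ _ _).symm

theorem listSum_finset_sum {ι : Type*} (s : Finset ι) (n : ℕ) (G : ι → List X → ℝ) :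
    listSum n (fun l => ∑ i ∈ s, G i l) = ∑ i ∈ s, listSum n (G i) :=
  Finset.sum_comm

/-- A transition kernel of a process whose next entry may depend on all earlier ones. -/
structure IsKernel (κ : List X → X → ℝ) : Prop where
  nonneg : ∀ h x, 0 ≤ κ h x
  sum_eq : ∀ h, ∑ x, κ h x = 1

theorem IsKernel.listSum_take {κ : List X → X → ℝ} (hκ : IsKernel κ) (G : List X → ℝ) {j n : ℕ}
    (hjn : j ≤ n) :
    listSum n (fun h => pathProd κ h * G (h.take j)) = listSum j (fun h => pathProd κ h * G h) := by
  induction n, hjn using Nat.le_induction with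
  | base => exact listSum_congr fun l hl => by rw [List.take_of_length_le hl.le]
  | succ n hn ih =>
    rw [listSum_succ, ← ih]
    refine listSum_congr fun l hl => ?_
    have : ∀ x, (l ++ [x]).take j = l.take j := fun x =>
      List.take_append_of_le_length (by omega)
    simp_rw [this, pathProd_concat]
    calc _ = ∑ x, κ l x * (pathProd κ l * G (l.take j)) :=
          Finset.sum_congr rfl fun x _ => by ring
      _ = _ := by rw [← Finset.sum_mul, hκ.sum_eq, one_mul]

theorem IsKernel.listSum_eq_one {κ : List X → X → ℝ} (hκ : IsKernel κ) (n : ℕ) :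
    listSum n (pathProd κ) = 1 := by
  have := hκ.listSum_take (fun _ => 1) (Nat.zero_le n)
  simp only [mul_one, pathProd_nil, listSum_zero] at this
  exact this

/-- Exponential supermartingale of a sum of conditionally centred bounded increments. -/
theorem IsKernel.listSum_exp_le {κ : List X → X → ℝ} (hκ : IsKernel κ) {φ y : List X → X → ℝ}
    (hφ : ∀ h x, φ h x = 0 ∨ φ h x = 1) (hy : ∀ h x, |y h x| ≤ 2)
    (hmean : ∀ h, ∑ x, κ h x * (φ h x * y h x) = 0) (a : ℝ) (n : ℕ) :
    listSum n (fun h => pathProd κ h *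
      Real.exp (a * pathSum (fun h x => φ h x * y h x) h - 2 * a ^ 2 * pathSum φ h)) ≤ 1 := by
  induction n with
  | zero => simp [listSum_zero]
  | succ n ih =>
    rw [listSum_succ]
    refine le_trans (listSum_mono fun h _ => ?_) ih
    -- For |y| ≤ 2 the chord has constant term cosh(2a) ≤ exp(2a²), which the compensator cancels.
    -- What remains beyond 1 is linear in the increment and is killed by `hmean`.
    have key : ∀ x, Real.exp (a * (φ h x * y h x) - 2 * a ^ 2 * φ h x) ≤
        1 + Real.exp (-(2 * a ^ 2)) * Real.sinh (a * 2) / 2 * (φ h x * y h x) := by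
      intro x
      rcases hφ h x with h0 | h1
      · simp [h0]
      · rw [h1]
        have h3 := exp_mul_le_cosh_add two_pos (hy h x) a
        have h4 : Real.cosh (a * 2) ≤ Real.exp (2 * a ^ 2) := by
          refine (Real.cosh_le_exp_half_sq _).trans_eq ?_
          congr 1; ring
        have h5 : Real.exp (-(2 * a ^ 2)) * Real.exp (2 * a ^ 2) = 1 := by
          rw [← Real.exp_add]; simp
        have e : a * (1 * y h x) - 2 * a ^ 2 * 1 = -(2 * a ^ 2) + a * y h x := by ring
        rw [e, Real.exp_add]
        calc _ ≤ Real.exp (-(2 * a ^ 2)) *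
              (Real.exp (2 * a ^ 2) + y h x / 2 * Real.sinh (a * 2)) := by
              gcongr; exact h3.trans (by gcongr)
          _ = Real.exp (-(2 * a ^ 2)) * Real.exp (2 * a ^ 2) +
              Real.exp (-(2 * a ^ 2)) * Real.sinh (a * 2) / 2 * (1 * y h x) := by ring
          _ = _ := by rw [h5]
    set c := Real.exp (-(2 * a ^ 2)) * Real.sinh (a * 2) / 2
    set G := pathProd κ h *
      Real.exp (a * pathSum (fun h x => φ h x * y h x) h - 2 * a ^ 2 * pathSum φ h) with hG
    have hG0 : 0 ≤ G := mul_nonneg (pathProd_nonneg hκ.nonneg _) (Real.exp_pos _).le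
    calc _ = ∑ x, G * (κ h x * Real.exp (a * (φ h x * y h x) - 2 * a ^ 2 * φ h x)) := by
          refine Finset.sum_congr rfl fun x _ => ?_
          rw [pathProd_concat, pathSum_concat, pathSum_concat, hG]
          have e : ∀ u v w z : ℝ, a * (u + v) - 2 * a ^ 2 * (w + z) =
            (a * u - 2 * a ^ 2 * w) + (a * v - 2 * a ^ 2 * z) := by intros; ring
          rw [e, Real.exp_add]
          ring
      _ ≤ ∑ x, G * (κ h x * (1 + c * (φ h x * y h x))) := by
          gcongr with x _
          · exact hκ.nonneg h x
          · exact key x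
      _ = G * (∑ x, κ h x) + G * c * ∑ x, κ h x * (φ h x * y h x) := by
          rw [Finset.mul_sum, Finset.mul_sum, ← Finset.sum_add_distrib]
          exact Finset.sum_congr rfl fun x _ => by ring
      _ = G := by rw [hκ.sum_eq, hmean]; ring

open Classical in
/-- Self-normalised tail bound for sums of conditionally centred bounded increments. -/
theorem IsKernel.listSum_tail_le {κ : List X → X → ℝ} (hκ : IsKernel κ) {φ y : List X → X → ℝ}
    (hφ : ∀ h x, φ h x = 0 ∨ φ h x = 1) (hy : ∀ h x, |y h x| ≤ 2)
    (hmean : ∀ h, ∑ x, κ h x * (φ h x * y h x) = 0) {v : ℝ} (hv : 0 ≤ v) (n : ℕ) :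
    listSum n (fun h => pathProd κ h *
      if √(8 * pathSum φ h * v) < pathSum (fun h x => φ h x * y h x) h then 1 else 0) ≤
      n * Real.exp (-v) := by
  set Y := pathSum (fun h x => φ h x * y h x) with hY
  -- The best exponent when the count equals k + 1: then 2a²(k + 1) = v and a√(8(k + 1)v) = 2v, so
  -- on the event the compensated exponential is at least exp v. Count zero never fails, hence n
  -- terms and not n + 1.
  let a : ℕ → ℝ := fun k => √(v / (2 * (k + 1)))
  have ha : ∀ k, a k ^ 2 = v / (2 * (k + 1)) := fun k => Real.sq_sqrt (by positivity)
  have hpt : ∀ h : List X, h.length = n →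
      (if √(8 * pathSum φ h * v) < Y h then (1 : ℝ) else 0) ≤
      ∑ k ∈ Finset.range n, Real.exp (-v) *
        Real.exp (a k * Y h - 2 * a k ^ 2 * pathSum φ h) := by
    intro h hn
    have hnn : ∀ k ∈ Finset.range n, 0 ≤ Real.exp (-v) *
        Real.exp (a k * Y h - 2 * a k ^ 2 * pathSum φ h) := fun k _ => by positivity
    split_ifs with hlt
    · obtain ⟨k, h1, h2, h3⟩ := pathSum_indicator_eq_nat hφ y h
      rcases k with _ | k
      · rw [hY, h3 rfl, h1] at hlt
        simp at hlt
      · refine le_trans ?_ (Finset.single_le_sum hnn (Finset.mem_range.2 (by omega : k < n)))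
        rw [← Real.exp_add]
        refine Real.one_le_exp ?_
        rw [ha, h1]
        rw [h1] at hlt
        have e1 : 2 * (v / (2 * ((k : ℝ) + 1))) * ((k + 1 : ℕ) : ℝ) = v := by
          push_cast; field_simp
        have e2 : a k * √(8 * ((k + 1 : ℕ) : ℝ) * v) = 2 * v := by
          rw [← Real.sqrt_mul (by positivity)]
          have : v / (2 * ((k : ℝ) + 1)) * (8 * ((k + 1 : ℕ) : ℝ) * v) = (2 * v) ^ 2 := by
            push_cast; field_simp; ring
          rw [this, Real.sqrt_sq (by positivity)]
        have e3 : a k * √(8 * ((k + 1 : ℕ) : ℝ) * v) ≤ a k * Y h :=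
          mul_le_mul_of_nonneg_left hlt.le (Real.sqrt_nonneg _)
        rw [e1]
        linarith
    · exact Finset.sum_nonneg hnn
  calc _ ≤ listSum n (fun h => ∑ k ∈ Finset.range n, Real.exp (-v) * (pathProd κ h *
        Real.exp (a k * Y h - 2 * a k ^ 2 * pathSum φ h))) := by
        refine listSum_mono fun h hn => ?_
        refine (mul_le_mul_of_nonneg_left (hpt h hn) (pathProd_nonneg hκ.nonneg h)).trans_eq ?_
        rw [Finset.mul_sum]
        exact Finset.sum_congr rfl fun k _ => by ring
    _ = ∑ k ∈ Finset.range n, Real.exp (-v) * listSum n (fun h => pathProd κ h *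
        Real.exp (a k * Y h - 2 * a k ^ 2 * pathSum φ h)) := by
        rw [listSum_finset_sum]
        exact Finset.sum_congr rfl fun k _ => listSum_mul_left _ _ _
    _ ≤ ∑ k ∈ Finset.range n, Real.exp (-v) * 1 := by
        gcongr with k _
        exact hκ.listSum_exp_le hφ hy hmean (a k) n
    _ = _ := by simp

end ListSum

/-! ### Planning with a reward-blind objective, and the simulation lemma -/

section Planning

variable {S A : Type*} {R : Finset ℝ}

/-- The state-action pairs of a list of steps. -/
def saList (h : List (Step S A R)) : List (S × A) := h.map fun x => (x.1, x.2.1)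

@[simp] theorem saList_nil : saList ([] : List (Step S A R)) = [] := rfl

@[simp] theorem saList_concat (h : List (Step S A R)) (x : Step S A R) :
    saList (h ++ [x]) = saList h ++ [(x.1, x.2.1)] := by simp [saList]

@[simp] theorem saList_length (h : List (Step S A R)) : (saList h).length = h.length := by
  simp [saList]

open Classical in
/-- Probability of the state and the action of the next step. -/
noncomputable def planKernel (P : List (S × A) → S → ℝ) (π : Policy S A R)
    (h : List (Step S A R)) (x : Step S A R) : ℝ :=
  P (saList h) x.1 * if π h x.1 = x.2.1 then 1 else 0

/-- Product of the probabilities of all states and actions of a list of steps. -/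
noncomputable def planWeight (P : List (S × A) → S → ℝ) (π : Policy S A R) :
    List (Step S A R) → ℝ := pathProd (planKernel P π)

@[simp] theorem planWeight_nil (P : List (S × A) → S → ℝ) (π : Policy S A R) :
    planWeight P π [] = 1 := pathProd_nil _

@[simp] theorem planWeight_concat (P : List (S × A) → S → ℝ) (π : Policy S A R)
    (h : List (Step S A R)) (x : Step S A R) :
    planWeight P π (h ++ [x]) = planWeight P π h * planKernel P π h x := pathProd_concat _ _ _

theorem planKernel_nonneg {P : List (S × A) → S → ℝ} (hP : ∀ l s, 0 ≤ P l s) (π : Policy S A R)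
    (h : List (Step S A R)) (x : Step S A R) : 0 ≤ planKernel P π h x :=
  mul_nonneg (hP _ _) (by split_ifs <;> norm_num)

theorem planWeight_nonneg {P : List (S × A) → S → ℝ} (hP : ∀ l s, 0 ≤ P l s) (π : Policy S A R)
    (h : List (Step S A R)) : 0 ≤ planWeight P π h := pathProd_nonneg (planKernel_nonneg hP π) h

/-- A bound `F` on the probability of the rewards of a list of steps that does not anticipate:
the total of `F` over the next reward does not exceed its present value. -/
structure IsCausal (H : ℕ) (F : List (Step S A R) → ℝ) : Prop where
  nonneg : ∀ h, 0 ≤ F h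
  step : ∀ h s a, h.length < H → ∑ r, F (h ++ [(s, a, r)]) ≤ F h

/-- Probability of the rewards of a list of steps, given the states and actions. -/
structure IsRewardLaw (F : List (Step S A R) → ℝ) : Prop where
  nonneg : ∀ h, 0 ≤ F h
  nil : F [] = 1
  step : ∀ h s a, ∑ r, F (h ++ [(s, a, r)]) = F h

theorem IsRewardLaw.isCausal {F : List (Step S A R) → ℝ} (hF : IsRewardLaw F) (H : ℕ) :
    IsCausal H F := ⟨hF.nonneg, fun h s a _ => (hF.step h s a).le⟩

/-- A law of the next state given the past states and actions. -/
structure IsTransition [Fintype S] (P : List (S × A) → S → ℝ) : Prop where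
  nonneg : ∀ l s, 0 ≤ P l s
  sum_eq : ∀ l, ∑ s, P l s = 1

/-- `f` does not decrease when a list is prolonged. -/
def PrefixMono {X : Type*} (f : List X → ℝ) : Prop := ∀ l x, f l ≤ f (l ++ [x])

variable [Fintype S]

/-- Optimal expected value of `f` of the list of all states and actions, when `n` steps follow
the list `l`. -/
noncomputable def optVal (P : List (S × A) → S → ℝ) (f : List (S × A) → ℝ) :
    ℕ → List (S × A) → ℝ
  | 0, l => f l
  | n + 1, l => ∑ s, P l s * ⨆ a : A, optVal P f n (l ++ [(s, a)])

theorem optVal_nonneg {P : List (S × A) → S → ℝ} (hP : ∀ l s, 0 ≤ P l s)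
    {f : List (S × A) → ℝ} (hf : ∀ l, 0 ≤ f l) (n : ℕ) (l : List (S × A)) :
    0 ≤ optVal P f n l := by
  induction n generalizing l with
  | zero => exact hf l
  | succ n ih =>
    exact Finset.sum_nonneg fun s _ => mul_nonneg (hP _ _) (Real.iSup_nonneg fun a => ih _)

theorem optVal_const_mul {P : List (S × A) → S → ℝ} {f : List (S × A) → ℝ} {c : ℝ} (hc : 0 ≤ c)
    (n : ℕ) (l : List (S × A)) :
    optVal P (fun l => c * f l) n l = c * optVal P f n l := by
  induction n generalizing l with
  | zero => rfl
  | succ n ih =>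
    simp only [optVal, ih, Finset.mul_sum]
    refine Finset.sum_congr rfl fun s _ => ?_
    rw [← Real.mul_iSup_of_nonneg hc]
    ring

variable [Fintype A]

theorem sum_planKernel (P : List (S × A) → S → ℝ) (π : Policy S A R) (h : List (Step S A R))
    (G : Step S A R → ℝ) :
    ∑ x, planKernel P π h x * G x = ∑ s, P (saList h) s * ∑ r, G (s, π h s, r) := by
  classical
  rw [Fintype.sum_prod_type]
  refine Finset.sum_congr rfl fun s _ => ?_
  rw [Fintype.sum_prod_type, Finset.sum_eq_single (π h s)]
  · rw [Finset.mul_sum]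
    exact Finset.sum_congr rfl fun r _ => by simp [planKernel]
  · intro a _ ha
    exact Finset.sum_eq_zero fun r _ => by simp [planKernel, ha.symm]
  · simp

theorem listSum_succ_planWeight (P : List (S × A) → S → ℝ) (π : Policy S A R) (n : ℕ)
    (G : List (Step S A R) → ℝ) :
    listSum (n + 1) (fun h => planWeight P π h * G h) =
      listSum n (fun h => planWeight P π h *
        ∑ s, P (saList h) s * ∑ r, G (h ++ [(s, π h s, r)])) := by
  rw [listSum_succ]
  refine listSum_congr fun h _ => ?_
  rw [← sum_planKernel P π h (fun x => G (h ++ [x])), Finset.mul_sum]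
  exact Finset.sum_congr rfl fun x _ => by rw [planWeight_concat]; ring

theorem le_iSup_optVal (P : List (S × A) → S → ℝ) (f : List (S × A) → ℝ) (n : ℕ)
    (l : List (S × A)) (s : S) (a : A) :
    optVal P f n (l ++ [(s, a)]) ≤ ⨆ a : A, optVal P f n (l ++ [(s, a)]) :=
  le_ciSup (f := fun a => optVal P f n (l ++ [(s, a)])) (Set.finite_range _).bddAbove a

theorem optVal_mono [Nonempty A] {P : List (S × A) → S → ℝ} (hP : ∀ l s, 0 ≤ P l s)
    {f g : List (S × A) → ℝ} (hfg : ∀ l, f l ≤ g l) (n : ℕ) (l : List (S × A)) :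
    optVal P f n l ≤ optVal P g n l := by
  induction n generalizing l with
  | zero => exact hfg l
  | succ n ih =>
    refine Finset.sum_le_sum fun s _ => mul_le_mul_of_nonneg_left ?_ (hP _ _)
    exact ciSup_le fun a => (ih _).trans (le_iSup_optVal P g n l s a)

theorem PrefixMono.le_optVal [Nonempty A] {P : List (S × A) → S → ℝ} (hP : IsTransition P)
    {f : List (S × A) → ℝ} (hf : PrefixMono f) (n : ℕ) (l : List (S × A)) :
    f l ≤ optVal P f n l := by
  induction n generalizing l with
  | zero => exact le_rfl
  | succ n ih =>
    calc f l = ∑ s, P l s * f l := by rw [← Finset.sum_mul, hP.sum_eq, one_mul]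
      _ ≤ _ := by
        refine Finset.sum_le_sum fun s _ => mul_le_mul_of_nonneg_left ?_ (hP.nonneg _ _)
        obtain ⟨a⟩ := ‹Nonempty A›
        exact ((hf l (s, a)).trans (ih _)).trans (le_iSup_optVal P f n l s a)

/-- Although the policy may react to rewards, the objective sees only states and actions. Summing
over the newest reward first, causality of `F` absorbs that sum, and the action is then dominated by
the best one. One Bellman step is thus undone at a time. -/
theorem listSum_planWeight_optVal_le {P : List (S × A) → S → ℝ} (hP : ∀ l s, 0 ≤ P l s)
    {f : List (S × A) → ℝ} (hf : ∀ l, 0 ≤ f l) {H : ℕ} {F : List (Step S A R) → ℝ}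
    (hF : IsCausal H F) (π : Policy S A R) (n m : ℕ) (hn : n ≤ H) :
    listSum n (fun h => planWeight P π h * (F h * optVal P f m (saList h))) ≤
      F [] * optVal P f (n + m) [] := by
  induction n generalizing m with
  | zero => simp [listSum_zero]
  | succ n ih =>
    rw [listSum_succ_planWeight]
    refine le_trans (listSum_mono fun h hh => ?_)
      ((ih (m + 1) (by omega)).trans_eq (by rw [add_right_comm, add_assoc]))
    refine mul_le_mul_of_nonneg_left ?_ (planWeight_nonneg hP π h)
    rw [optVal, Finset.mul_sum]
    refine Finset.sum_le_sum fun s _ => ?_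
    rw [mul_left_comm]
    refine mul_le_mul_of_nonneg_left ?_ (hP _ _)
    simp only [saList_concat]
    rw [← Finset.sum_mul]
    exact mul_le_mul (hF.step h s _ (by omega)) (le_iSup_optVal P f m _ s _)
      (optVal_nonneg hP hf _ _) (hF.nonneg h)

/-- Prefix monotonicity lets a quantity met at an intermediate time be charged to the planning value
at the full horizon. -/
theorem listSum_planWeight_le [Nonempty A] {P : List (S × A) → S → ℝ} (hP : IsTransition P)
    {f : List (S × A) → ℝ} (hf : ∀ l, 0 ≤ f l) (hm : PrefixMono f) {H : ℕ}
    {F : List (Step S A R) → ℝ} (hF : IsCausal H F) (π : Policy S A R) {n : ℕ} (hn : n ≤ H) :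
    listSum n (fun h => planWeight P π h * (F h * f (saList h))) ≤ F [] * optVal P f H [] := by
  refine le_trans (listSum_mono fun h _ => ?_)
    ((listSum_planWeight_optVal_le hP.nonneg hf hF π n (H - n) hn).trans_eq
      (by rw [Nat.add_sub_cancel' hn]))
  exact mul_le_mul_of_nonneg_left (mul_le_mul_of_nonneg_left (hm.le_optVal hP _ _) (hF.nonneg _))
    (planWeight_nonneg hP.nonneg _ _)

theorem listSum_planWeight_mono {P : List (S × A) → S → ℝ} (hP : IsTransition P)
    {f : List (S × A) → ℝ} (hm : PrefixMono f) {F : List (Step S A R) → ℝ}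
    (hF : IsRewardLaw F) (π : Policy S A R) {n m : ℕ} (hnm : n ≤ m) :
    listSum n (fun h => planWeight P π h * (F h * f (saList h))) ≤
      listSum m (fun h => planWeight P π h * (F h * f (saList h))) := by
  induction m, hnm using Nat.le_induction with
  | base => exact le_rfl
  | succ m _ ih =>
    refine ih.trans ?_
    rw [listSum_succ_planWeight]
    refine listSum_mono fun h _ => mul_le_mul_of_nonneg_left ?_ (planWeight_nonneg hP.nonneg _ _)
    calc F h * f (saList h) = ∑ s, P (saList h) s * (F h * f (saList h)) := by
          rw [← Finset.sum_mul, hP.sum_eq, one_mul]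
      _ ≤ _ := by
        refine Finset.sum_le_sum fun s _ => mul_le_mul_of_nonneg_left ?_ (hP.nonneg _ _)
        simp only [saList_concat]
        rw [← Finset.sum_mul, hF.step]
        exact mul_le_mul_of_nonneg_left (hm _ _) (hF.nonneg h)

/-- An optimal policy for `optVal` with horizon `H`. -/
noncomputable def greedy [Nonempty A] (P : List (S × A) → S → ℝ) (f : List (S × A) → ℝ) (H : ℕ)
    (l : List (S × A)) (s : S) : A :=
  (exists_eq_ciSup_of_finite (f := fun a => optVal P f (H - 1 - l.length) (l ++ [(s, a)]))).choose

theorem optVal_greedy [Nonempty A] (P : List (S × A) → S → ℝ) (f : List (S × A) → ℝ) (H : ℕ)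
    (l : List (S × A)) (s : S) :
    optVal P f (H - 1 - l.length) (l ++ [(s, greedy P f H l s)]) =
      ⨆ a : A, optVal P f (H - 1 - l.length) (l ++ [(s, a)]) :=
  (exists_eq_ciSup_of_finite
    (f := fun a => optVal P f (H - 1 - l.length) (l ++ [(s, a)]))).choose_spec

theorem listSum_planWeight_greedy [Nonempty A] (P : List (S × A) → S → ℝ)
    (f : List (S × A) → ℝ) {F : List (Step S A R) → ℝ} (hF : IsRewardLaw F) (H : ℕ) :
    listSum H (fun h => planWeight P (fun h => greedy P f H (saList h)) h *
      (F h * f (saList h))) = optVal P f H [] := by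
  suffices h : ∀ n ≤ H, listSum n (fun h => planWeight P (fun h => greedy P f H (saList h)) h *
      (F h * optVal P f (H - n) (saList h))) = optVal P f H [] by
    simpa [optVal] using h H le_rfl
  intro n
  induction n with
  | zero => simp [listSum_zero, hF.nil]
  | succ n ih =>
    intro hn
    rw [← ih (by omega), listSum_succ_planWeight]
    refine listSum_congr fun h hh => ?_
    congr 1
    -- After an action chosen at a list of length n there are H − 1 − n steps left, which is the
    -- depth at which `greedy` maximises.
    rw [show H - n = (H - 1 - (saList h).length) + 1 by simp; omega, optVal, Finset.mul_sum]
    refine Finset.sum_congr rfl fun s _ => ?_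
    rw [mul_left_comm]
    congr 1
    simp only [saList_concat]
    rw [← Finset.sum_mul, hF.step, ← optVal_greedy]
    congr 2
    simp; omega

/-- Simulation lemma: replacing the transition law `P` by `P'` costs at most the sum of the
one-step errors along the way. -/
theorem listSum_abs_planWeight_sub_le {P P' : List (S × A) → S → ℝ} (hP : IsTransition P)
    (hP' : IsTransition P') {H : ℕ} {F : List (Step S A R) → ℝ} (hF : IsCausal H F)
    (π : Policy S A R) (n : ℕ) (hn : n ≤ H) :
    listSum n (fun h => |planWeight P π h - planWeight P' π h| * F h) ≤
      ∑ j ∈ Finset.range n, listSum j (fun h => planWeight P π h *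
        (F h * ∑ s, |P (saList h) s - P' (saList h) s|)) := by
  induction n with
  | zero => simp [listSum_zero]
  | succ n ih =>
    rw [Finset.sum_range_succ, listSum_succ]
    refine le_trans ?_ (add_le_add_left (ih (by omega)) _)
    rw [← listSum_add]
    refine listSum_mono fun h hh => ?_
    set W := planWeight P π h with hW
    set W' := planWeight P' π h with hW'
    have hW0 : 0 ≤ W := planWeight_nonneg hP.nonneg _ _
    have hsum : ∀ (Q : List (S × A) → S → ℝ), (∀ l s, 0 ≤ Q l s) →
        ∑ x, planKernel Q π h x * F (h ++ [x]) ≤ (∑ s, Q (saList h) s) * F h := by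
      intro Q hQ
      rw [sum_planKernel, Finset.sum_mul]
      exact Finset.sum_le_sum fun s _ =>
        mul_le_mul_of_nonneg_left (hF.step h s _ (by omega)) (hQ _ _)
    -- The new one-step error is weighted by the history law of P, and the old error is transported
    -- by the kernel of P'. Hence all one-step errors are measured under P.
    calc _ ≤ ∑ x, (W * (planKernel (fun l s => |P l s - P' l s|) π h x * F (h ++ [x])) +
          |W - W'| * (planKernel P' π h x * F (h ++ [x]))) := by
          refine Finset.sum_le_sum fun x _ => ?_
          rw [planWeight_concat, planWeight_concat, ← hW, ← hW']
          have e : |W * planKernel P π h x - W' * planKernel P' π h x| ≤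
              W * planKernel (fun l s => |P l s - P' l s|) π h x +
                |W - W'| * planKernel P' π h x := by
            have e1 : |planKernel P π h x - planKernel P' π h x| =
                planKernel (fun l s => |P l s - P' l s|) π h x := by
              unfold planKernel
              split_ifs <;> simp
            calc _ = |W * (planKernel P π h x - planKernel P' π h x) +
                  (W - W') * planKernel P' π h x| := by congr 1; ring
              _ ≤ _ := abs_add_le _ _
              _ = _ := by
                rw [abs_mul, abs_mul, abs_of_nonneg hW0, e1,
                  abs_of_nonneg (planKernel_nonneg hP'.nonneg π h x)]
          refine (mul_le_mul_of_nonneg_right e (hF.nonneg _)).trans_eq ?_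
          ring
      _ = W * ∑ x, planKernel (fun l s => |P l s - P' l s|) π h x * F (h ++ [x]) +
          |W - W'| * ∑ x, planKernel P' π h x * F (h ++ [x]) := by
          rw [Finset.sum_add_distrib, Finset.mul_sum, Finset.mul_sum]
      _ ≤ W * ((∑ s, |P (saList h) s - P' (saList h) s|) * F h) + |W - W'| * (1 * F h) := by
          refine add_le_add (mul_le_mul_of_nonneg_left (hsum _ fun _ _ => abs_nonneg _) hW0)
            (mul_le_mul_of_nonneg_left ?_ (abs_nonneg _))
          rw [← hP'.sum_eq (saList h)]
          exact hsum P' hP'.nonneg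
      _ = _ := by ring

end Planning

/-! ### Recovering vectors up to a sign from their pairwise products -/

section ScalarLemmas

/-- The number (u₁² − w₁²)u₂u₃ is a combination of the three errors of pairwise products, so |u₁ −
w₁||u₁ + w₁|c² ≤ 3e. The two factors add up to at least 2|u₁| ≥ 2c, so one of them is at least c and
the other one is small. -/
theorem exists_sign_abs_sub_le {c e u₁ u₂ u₃ w₁ w₂ w₃ : ℝ} (hc : 0 < c)
    (h1 : c ≤ |u₁|) (h2 : c ≤ |u₂|) (h3 : c ≤ |u₃|)
    (b1 : |u₁| ≤ 1) (b2 : |u₂| ≤ 1) (c1 : |w₁| ≤ 1) (c3 : |w₃| ≤ 1)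
    (h12 : |u₁ * u₂ - w₁ * w₂| ≤ e) (h13 : |u₁ * u₃ - w₁ * w₃| ≤ e)
    (h23 : |u₂ * u₃ - w₂ * w₃| ≤ e) :
    ∃ s : ℝ, (s = 1 ∨ s = -1) ∧ |u₁ - s * w₁| ≤ 3 * e / c ^ 3 := by
  have he : 0 ≤ e := (abs_nonneg _).trans h12
  have key : |u₁ - w₁| * |u₁ + w₁| * c ^ 2 ≤ 3 * e := by
    have e1 : (u₁ - w₁) * (u₁ + w₁) * (u₂ * u₃) =
        u₁ * u₂ * (u₁ * u₃ - w₁ * w₃) + (u₁ * u₂ - w₁ * w₂) * (w₁ * w₃) +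
          w₁ * w₁ * -(u₂ * u₃ - w₂ * w₃) := by ring
    have e2 : |u₁ * u₂| ≤ 1 := by rw [abs_mul]; exact mul_le_one₀ b1 (abs_nonneg _) b2
    have e3 : |w₁ * w₃| ≤ 1 := by rw [abs_mul]; exact mul_le_one₀ c1 (abs_nonneg _) c3
    have e4 : |w₁ * w₁| ≤ 1 := by rw [abs_mul]; exact mul_le_one₀ c1 (abs_nonneg _) c1
    calc |u₁ - w₁| * |u₁ + w₁| * c ^ 2 ≤ |u₁ - w₁| * |u₁ + w₁| * (|u₂| * |u₃|) := by
          rw [sq]; gcongr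
      _ = |(u₁ - w₁) * (u₁ + w₁) * (u₂ * u₃)| := by simp only [abs_mul]
      _ ≤ |u₁ * u₂ * (u₁ * u₃ - w₁ * w₃)| + |(u₁ * u₂ - w₁ * w₂) * (w₁ * w₃)| +
          |w₁ * w₁ * -(u₂ * u₃ - w₂ * w₃)| := by rw [e1]; exact abs_add_three _ _ _
      _ ≤ 1 * e + e * 1 + 1 * e := by
          rw [abs_mul (u₁ * u₂), abs_mul (u₁ * u₂ - w₁ * w₂), abs_mul (w₁ * w₁), abs_neg]
          gcongr
      _ = 3 * e := by ring
  have hsum : 2 * c ≤ |u₁ - w₁| + |u₁ + w₁| := by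
    have : |2 * u₁| ≤ |u₁ - w₁| + |u₁ + w₁| := by
      have := abs_add_le (u₁ - w₁) (u₁ + w₁)
      rwa [show u₁ - w₁ + (u₁ + w₁) = 2 * u₁ by ring] at this
    rw [abs_mul, abs_two] at this
    linarith
  rcases le_total c |u₁ + w₁| with h | h
  · refine ⟨1, Or.inl rfl, ?_⟩
    rw [one_mul, le_div_iff₀ (by positivity)]
    refine le_trans ?_ key
    calc |u₁ - w₁| * c ^ 3 = |u₁ - w₁| * c * c ^ 2 := by ring
      _ ≤ _ := by gcongr
  · refine ⟨-1, Or.inr rfl, ?_⟩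
    rw [neg_one_mul, sub_neg_eq_add, le_div_iff₀ (by positivity)]
    refine le_trans ?_ key
    calc |u₁ + w₁| * c ^ 3 = c * |u₁ + w₁| * c ^ 2 := by ring
      _ ≤ _ := by gcongr; linarith

/-- Transfers the sign from one entry to another: u(d − sd') = (ud − wd') + (w − su)d', divided by
the large entry u. -/
theorem abs_sub_sign_mul_le {c e e' u w d d' s : ℝ} (hc : 0 < c) (hs : s = 1 ∨ s = -1)
    (hu : c ≤ |u|) (hd' : |d'| ≤ 1) (h : |u * d - w * d'| ≤ e) (h' : |u - s * w| ≤ e') :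
    |d - s * d'| ≤ (e + e') / c := by
  rw [le_div_iff₀ hc]
  have e1 : |w - s * u| = |u - s * w| := by
    rcases hs with rfl | rfl
    · rw [one_mul, one_mul, abs_sub_comm]
    · congr 1; ring
  calc |d - s * d'| * c ≤ |d - s * d'| * |u| := by gcongr
    _ = |(u * d - w * d') + (w - s * u) * d'| := by rw [← abs_mul]; congr 1; ring
    _ ≤ |u * d - w * d'| + |(w - s * u) * d'| := abs_add_le _ _
    _ ≤ e + e' * 1 := by
        rw [abs_mul, e1]
        have := (abs_nonneg _).trans h'
        gcongr
    _ = e + e' := by ring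

/-- If the products of the entries of two families of vectors nearly agree, and three vectors of
the first family have a large entry, then the families nearly agree up to a common sign. -/
theorem exists_sign_forall_abs_sub_le {ι ρ : Type*} {d d' : ι → ρ → ℝ} {c e : ℝ} (hc : 0 < c)
    (hc1 : c ≤ 1) (hd : ∀ i r, |d i r| ≤ 1) (hd' : ∀ i r, |d' i r| ≤ 1)
    (h : ∀ i j, i ≠ j → ∀ r r', |d i r * d j r' - d' i r * d' j r'| ≤ e)
    {i₁ i₂ i₃ : ι} {r₁ r₂ r₃ : ρ} (h12 : i₁ ≠ i₂) (h13 : i₁ ≠ i₃) (h23 : i₂ ≠ i₃)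
    (h1 : c ≤ |d i₁ r₁|) (h2 : c ≤ |d i₂ r₂|) (h3 : c ≤ |d i₃ r₃|) :
    ∃ s : ℝ, (s = 1 ∨ s = -1) ∧ ∀ i r, |d i r - s * d' i r| ≤ 5 * e / c ^ 5 := by
  have he : 0 ≤ e := (abs_nonneg _).trans (h i₁ i₂ h12 r₁ r₂)
  obtain ⟨s, hs, hs1⟩ := exists_sign_abs_sub_le hc h1 h2 h3 (hd _ _) (hd _ _) (hd' _ _) (hd' _ _)
    (h _ _ h12 _ _) (h _ _ h13 _ _) (h _ _ h23 _ _)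
  have hle : ∀ k : ℕ, e ≤ e / c ^ k := fun k => by
    rw [le_div_iff₀ (by positivity)]
    exact mul_le_of_le_one_right he (pow_le_one₀ hc.le hc1)
  -- The entry of i₁ fixes the sign with error 3e/c³; dividing by it reaches every other vector,
  -- with error at most 4e/c⁴.
  have hne : ∀ i, i₁ ≠ i → ∀ r, |d i r - s * d' i r| ≤ 4 * e / c ^ 4 := by
    intro i hi r
    refine (abs_sub_sign_mul_le hc hs h1 (hd' _ _) (h _ _ hi _ _) hs1).trans ?_
    rw [show 4 * e / c ^ 4 = (e / c ^ 3 + 3 * e / c ^ 3) / c by field_simp; ring]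
    gcongr
    exact hle 3
  refine ⟨s, hs, fun i r => ?_⟩
  -- Products inside one vector are not controlled, so the remaining entries of i₁ are reached
  -- through i₂, at the cost of one more division by c.
  rcases eq_or_ne i₁ i with rfl | hi
  · refine (abs_sub_sign_mul_le hc hs h2 (hd' _ _) (h _ _ h12.symm _ _)
      (hne i₂ h12 r₂)).trans ?_
    rw [show 5 * e / c ^ 5 = (e / c ^ 4 + 4 * e / c ^ 4) / c by field_simp; ring]
    gcongr
    exact hle 4
  · refine (hne i hi r).trans ?_
    rw [div_le_div_iff₀ (by positivity) (by positivity)]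
    calc 4 * e * c ^ 5 = 4 * e * c ^ 4 * c := by ring
      _ ≤ 4 * e * c ^ 4 * 1 := by gcongr
      _ ≤ 5 * e * c ^ 4 := by nlinarith [mul_nonneg he (pow_nonneg hc.le 4)]

/-- If the product of the `1 + a i` is large, at least three of the `a i` are not small. -/
theorem two_lt_card_of_lt_prod {n : ℕ} (a : Fin n → ℝ) (h0 : ∀ i, 0 ≤ a i) (h1 : ∀ i, a i ≤ 1)
    (h : 12 < ∏ i, (1 + a i)) :
    2 < (Finset.univ.filter fun i => 1 / (n : ℝ) ≤ a i).card := by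
  by_contra hcard
  refine h.not_ge ?_
  have hpow : (1 + 1 / (n : ℝ)) ^ n ≤ 3 := by
    calc (1 + 1 / (n : ℝ)) ^ n ≤ Real.exp (1 / n) ^ n := by
          gcongr
          rw [add_comm]
          exact Real.add_one_le_exp _
      _ = Real.exp (n * (1 / n)) := by rw [← Real.exp_nat_mul]
      _ ≤ Real.exp 1 := by
          refine Real.exp_le_exp.2 ?_
          rw [mul_one_div]
          exact div_self_le_one _
      _ ≤ 3 := by linarith [Real.exp_one_lt_d9]
  -- At most two factors reach 2, and all the others together give at most (1 + 1/n)ⁿ ≤ e < 3. This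
  -- is where 12 = 2² · 3 comes from.
  set s := Finset.univ.filter fun i => 1 / (n : ℝ) ≤ a i
  rw [← Finset.prod_mul_prod_compl s]
  have hs : ∏ i ∈ s, (1 + a i) ≤ 2 ^ 2 := by
    calc ∏ i ∈ s, (1 + a i) ≤ ∏ i ∈ s, (2 : ℝ) :=
          Finset.prod_le_prod (fun i _ => by linarith [h0 i]) fun i _ => by linarith [h1 i]
      _ = 2 ^ s.card := by simp
      _ ≤ 2 ^ 2 := pow_le_pow_right₀ one_le_two (by omega)
  have hs' : ∏ i ∈ sᶜ, (1 + a i) ≤ 3 := by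
    calc ∏ i ∈ sᶜ, (1 + a i) ≤ ∏ i ∈ sᶜ, (1 + 1 / (n : ℝ)) :=
          Finset.prod_le_prod (fun i _ => by linarith [h0 i]) fun i hi => by
            have : ¬ 1 / (n : ℝ) ≤ a i := by simpa [s] using hi
            linarith
      _ = (1 + 1 / (n : ℝ)) ^ sᶜ.card := by simp
      _ ≤ (1 + 1 / (n : ℝ)) ^ n := by
          refine pow_le_pow_right₀ (by simp) ?_
          simpa using sᶜ.card_le_univ
      _ ≤ 3 := hpow
  calc _ ≤ (2 : ℝ) ^ 2 * 3 := mul_le_mul hs hs'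
        (Finset.prod_nonneg fun i _ => by linarith [h0 i]) (by norm_num)
    _ = 12 := by norm_num

end ScalarLemmas

/-! ### Mean and half-difference of the contexts, and a recursion for the mixture error -/

section RewardComparison

variable {S A : Type*} {R : Finset ℝ}

/-- A law of the reward of a step given its state and action. -/
structure IsRewardKernel (u : Step S A R → ℝ) : Prop where
  nonneg : ∀ x, 0 ≤ u x
  sum_eq : ∀ s a, ∑ r, u (s, a, r) = 1

theorem IsRewardKernel.le_one {u : Step S A R → ℝ} (hu : IsRewardKernel u) (x : Step S A R) :
    u x ≤ 1 := by
  obtain ⟨s, a, r⟩ := x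
  rw [← hu.sum_eq s a]
  exact Finset.single_le_sum (f := fun r => u (s, a, r)) (fun r _ => hu.nonneg _)
    (Finset.mem_univ r)

/-- Probability of independent rewards. -/
def listProd (u : Step S A R → ℝ) (h : List (Step S A R)) : ℝ := (h.map u).prod

@[simp] theorem listProd_nil (u : Step S A R → ℝ) : listProd u [] = 1 := rfl

@[simp] theorem listProd_concat (u : Step S A R → ℝ) (h : List (Step S A R)) (x : Step S A R) :
    listProd u (h ++ [x]) = listProd u h * u x := by simp [listProd]

theorem IsRewardKernel.isRewardLaw {u : Step S A R → ℝ} (hu : IsRewardKernel u) :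
    IsRewardLaw (listProd u) where
  nonneg h := List.prod_nonneg fun a ha => by
    obtain ⟨x, _, rfl⟩ := List.mem_map.1 ha
    exact hu.nonneg x
  nil := rfl
  step h s a := by simp only [listProd_concat]; rw [← Finset.mul_sum, hu.sum_eq, mul_one]

/-- The sum over all positions of the product of `F` of the part before that position and of
`κ` of all the steps after it. -/
noncomputable def accum (κ : Step S A R → ℝ) (F : List (Step S A R) → ℝ) :
    List (Step S A R) → ℝ := snocFold 0 fun h y G => κ y * G + F h

@[simp] theorem accum_nil (κ : Step S A R → ℝ) (F : List (Step S A R) → ℝ) :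
    accum κ F [] = 0 := snocFold_nil _ _

@[simp] theorem accum_concat (κ : Step S A R → ℝ) (F : List (Step S A R) → ℝ)
    (h : List (Step S A R)) (y : Step S A R) :
    accum κ F (h ++ [y]) = κ y * accum κ F h + F h := snocFold_concat _ _ _ _

theorem accum_nonneg {κ : Step S A R → ℝ} (hκ : ∀ x, 0 ≤ κ x) {F : List (Step S A R) → ℝ}
    (hF : ∀ h, 0 ≤ F h) (h : List (Step S A R)) : 0 ≤ accum κ F h := by
  induction h using List.reverseRecOn with
  | nil => simp
  | append_singleton h x ih =>
    rw [accum_concat]; exact add_nonneg (mul_nonneg (hκ _) ih) (hF h)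

theorem IsCausal.add {H : ℕ} {F F' : List (Step S A R) → ℝ} (hF : IsCausal H F)
    (hF' : IsCausal H F') : IsCausal H (fun h => F h + F' h) where
  nonneg h := add_nonneg (hF.nonneg h) (hF'.nonneg h)
  step h s a hh := by
    rw [Finset.sum_add_distrib]
    exact add_le_add (hF.step h s a hh) (hF'.step h s a hh)

/-- The position just added carries no weight for its own reward, so summing over that reward
produces `R.card` copies of `F`. The extra term is a reserve for the H − length positions still to
come. -/
theorem IsCausal.accum {H : ℕ} {F : List (Step S A R) → ℝ} (hF : IsCausal H F)
    {κ : Step S A R → ℝ} (hκ : IsRewardKernel κ) :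
    IsCausal H (fun h => accum κ F h + R.card * (H - h.length : ℕ) * F h) where
  nonneg h := add_nonneg (accum_nonneg hκ.nonneg hF.nonneg h)
    (mul_nonneg (by positivity) (hF.nonneg h))
  step h s a hh := by
    simp only [accum_concat, List.length_append, List.length_singleton]
    rw [show H - h.length = (H - (h.length + 1)) + 1 by omega]
    set k := H - (h.length + 1)
    rw [Finset.sum_add_distrib, Finset.sum_add_distrib, ← Finset.sum_mul, hκ.sum_eq,
      ← Finset.mul_sum]
    have := mul_le_mul_of_nonneg_left (hF.step h s a hh)
      (show (0 : ℝ) ≤ R.card * (k : ℝ) by positivity)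
    simp only [Finset.sum_const, Finset.card_univ, Fintype.card_coe, nsmul_eq_mul]
    push_cast
    linarith

/-- Replace the factors one at a time: u' is used before the replaced position and u after it, which
is the weighting in `accum`. -/
theorem abs_listProd_sub_le {u u' : Step S A R → ℝ} (hu : ∀ x, 0 ≤ u x) (hu' : ∀ x, 0 ≤ u' x)
    {e : ℝ} {h : List (Step S A R)} (he : ∀ y ∈ h, |u y - u' y| ≤ e) :
    |listProd u h - listProd u' h| ≤ e * accum u (listProd u') h := by
  induction h using List.reverseRecOn with
  | nil => simp
  | append_singleton h x ih =>
    have ih' := ih fun y hy => he y (by simp [hy])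
    have h0 : 0 ≤ listProd u' h := List.prod_nonneg fun a ha => by
      obtain ⟨x, _, rfl⟩ := List.mem_map.1 ha
      exact hu' x
    rw [listProd_concat, listProd_concat, accum_concat]
    calc _ = |u x * (listProd u h - listProd u' h) + (u x - u' x) * listProd u' h| := by
          congr 1; ring
      _ ≤ |u x * (listProd u h - listProd u' h)| + |(u x - u' x) * listProd u' h| :=
          abs_add_le _ _
      _ ≤ u x * (e * accum u (listProd u') h) + e * listProd u' h := by
          rw [abs_mul, abs_mul, abs_of_nonneg (hu x), abs_of_nonneg h0]
          exact add_le_add (mul_le_mul_of_nonneg_left ih' (hu x))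
            (mul_le_mul_of_nonneg_right (he x (by simp)) h0)
      _ = _ := by ring

/-- Mean of two reward laws. -/
noncomputable def avg (u v : Step S A R → ℝ) (x : Step S A R) : ℝ := (u x + v x) / 2

/-- Half the difference of two reward laws. -/
noncomputable def dif (u v : Step S A R → ℝ) (x : Step S A R) : ℝ := (u x - v x) / 2

/-- Probability of the rewards of two steps under the balanced mixture. -/
noncomputable def pairProb (u v : Step S A R → ℝ) (x y : Step S A R) : ℝ :=
  (u x * u y + v x * v y) / 2

/-- Probability of a list of rewards under the balanced mixture. -/
noncomputable def mixProb (u v : Step S A R → ℝ) (h : List (Step S A R)) : ℝ :=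
  (listProd u h + listProd v h) / 2

/-- Half the difference of the probabilities of a list of rewards in the two contexts. -/
noncomputable def mixDif (u v : Step S A R → ℝ) (h : List (Step S A R)) : ℝ :=
  (listProd u h - listProd v h) / 2

theorem IsRewardKernel.avg {u v : Step S A R → ℝ} (hu : IsRewardKernel u)
    (hv : IsRewardKernel v) : IsRewardKernel (avg u v) where
  nonneg x := by have := hu.nonneg x; have := hv.nonneg x; unfold RMMDP.avg; linarith
  sum_eq s a := by
    unfold RMMDP.avg
    rw [← Finset.sum_div, Finset.sum_add_distrib, hu.sum_eq, hv.sum_eq]; norm_num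

theorem IsRewardKernel.abs_dif_le {u v : Step S A R → ℝ} (hu : IsRewardKernel u)
    (hv : IsRewardKernel v) (x : Step S A R) : |dif u v x| ≤ 1 := by
  have h1 := hu.nonneg x
  have h2 := hv.nonneg x
  have h3 := hu.le_one x
  have h4 := hv.le_one x
  unfold dif
  rw [abs_le]
  constructor <;> linarith

theorem IsRewardKernel.mixProb {u v : Step S A R → ℝ} (hu : IsRewardKernel u)
    (hv : IsRewardKernel v) : IsRewardLaw (mixProb u v) where
  nonneg h := by
    have := hu.isRewardLaw.nonneg h
    have := hv.isRewardLaw.nonneg h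
    unfold RMMDP.mixProb
    linarith
  nil := by simp [RMMDP.mixProb]
  step h s a := by
    unfold RMMDP.mixProb
    rw [← Finset.sum_div, Finset.sum_add_distrib, hu.isRewardLaw.step, hv.isRewardLaw.step]

theorem IsRewardKernel.abs_mixDif_le {u v : Step S A R → ℝ} (hu : IsRewardKernel u)
    (hv : IsRewardKernel v) (h : List (Step S A R)) : |mixDif u v h| ≤ RMMDP.mixProb u v h := by
  have := hu.isRewardLaw.nonneg h
  have := hv.isRewardLaw.nonneg h
  unfold mixDif RMMDP.mixProb
  rw [abs_le]
  constructor <;> linarith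

theorem mixProb_concat (u v : Step S A R → ℝ) (h : List (Step S A R)) (x : Step S A R) :
    mixProb u v (h ++ [x]) = avg u v x * mixProb u v h + dif u v x * mixDif u v h := by
  simp only [mixProb, listProd_concat, avg, dif, mixDif]; ring

theorem mixDif_concat (u v : Step S A R → ℝ) (h : List (Step S A R)) (x : Step S A R) :
    mixDif u v (h ++ [x]) = avg u v x * mixDif u v h + dif u v x * mixProb u v h := by
  simp only [mixProb, listProd_concat, avg, dif, mixDif]; ring

theorem pairProb_eq (u v : Step S A R → ℝ) (x y : Step S A R) :
    pairProb u v x y = avg u v x * avg u v y + dif u v x * dif u v y := by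
  simp only [pairProb, avg, dif]; ring

/-- The laws of single rewards and of pairs of rewards along the list `l` differ by at most `b`. -/
structure RewardClose (u v u' v' : Step S A R → ℝ) (l : List (S × A)) (b : ℝ) : Prop where
  avg : ∀ (i : ℕ) (x : S × A), l[i]? = some x → ∀ r,
    |avg u v (x.1, x.2, r) - RMMDP.avg u' v' (x.1, x.2, r)| ≤ b
  pair : ∀ (i j : ℕ) (x y : S × A), i ≠ j → l[i]? = some x → l[j]? = some y → ∀ r r',
    |pairProb u v (x.1, x.2, r) (y.1, y.2, r') - pairProb u' v' (x.1, x.2, r) (y.1, y.2, r')| ≤ b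

variable {u v u' v' : Step S A R → ℝ}

theorem RewardClose.abs_avg_sub_le {h : List (Step S A R)} {b : ℝ}
    (hc : RewardClose u v u' v' (saList h) b) {y : Step S A R} (hy : y ∈ h) :
    |RMMDP.avg u v y - RMMDP.avg u' v' y| ≤ b := by
  obtain ⟨i, hi, rfl⟩ := List.getElem_of_mem hy
  exact hc.avg i (h[i].1, h[i].2.1) (by simp [saList, hi]) h[i].2.2

/-- Subtracting the product of the means from the pair law isolates d(x)d(y). The pair law
contributes b and the product of means 2b. -/
theorem RewardClose.abs_dif_mul_sub_le (hu : IsRewardKernel u) (hv : IsRewardKernel v)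
    (hu' : IsRewardKernel u') (hv' : IsRewardKernel v') {l : List (S × A)} {b : ℝ}
    (hc : RewardClose u v u' v' l b) {i j : ℕ} {x y : S × A} (hij : i ≠ j)
    (hi : l[i]? = some x) (hj : l[j]? = some y) (r r' : R) :
    |dif u v (x.1, x.2, r) * dif u v (y.1, y.2, r') -
      dif u' v' (x.1, x.2, r) * dif u' v' (y.1, y.2, r')| ≤ 3 * b := by
  have h1 := hc.pair i j x y hij hi hj r r'
  have h2 := hc.avg i x hi r
  have h3 := hc.avg j y hj r'
  rw [pairProb_eq, pairProb_eq] at h1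
  set X : Step S A R := (x.1, x.2, r)
  set Y : Step S A R := (y.1, y.2, r')
  have hy0 := (hu.avg hv).nonneg Y
  have hy1 := (hu.avg hv).le_one Y
  have hx0 := (hu'.avg hv').nonneg X
  have hx1 := (hu'.avg hv').le_one X
  have hb : 0 ≤ b := (abs_nonneg _).trans h1
  have h4 : |(RMMDP.avg u v X - RMMDP.avg u' v' X) * RMMDP.avg u v Y| ≤ b := by
    rw [abs_mul, abs_of_nonneg hy0]
    exact (mul_le_of_le_one_right (abs_nonneg _) hy1).trans h2
  have h5 : |RMMDP.avg u' v' X * (RMMDP.avg u v Y - RMMDP.avg u' v' Y)| ≤ b := by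
    rw [abs_mul, abs_of_nonneg hx0]
    exact (mul_le_of_le_one_left (abs_nonneg _) hx1).trans h3
  rw [abs_le] at *
  constructor <;> nlinarith

/-- The part of the error of the mixture that is carried by earlier differences of the
contexts. -/
noncomputable def carry (u v u' v' : Step S A R → ℝ) : List (Step S A R) → ℝ :=
  snocFold 0 fun h y G => avg u v y * G + |dif u v y| * |mixProb u v h - mixProb u' v' h|

@[simp] theorem carry_nil : carry u v u' v' [] = 0 := snocFold_nil _ _

@[simp] theorem carry_concat (h : List (Step S A R)) (y : Step S A R) :
    carry u v u' v' (h ++ [y]) = avg u v y * carry u v u' v' h +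
      |dif u v y| * |mixProb u v h - mixProb u' v' h| := snocFold_concat _ _ _ _

theorem carry_nonneg (hu : IsRewardKernel u) (hv : IsRewardKernel v) (h : List (Step S A R)) :
    0 ≤ carry u v u' v' h := by
  induction h using List.reverseRecOn with
  | nil => simp
  | append_singleton h x ih =>
    have := (hu.avg hv).nonneg x
    rw [carry_concat]
    positivity

/-- Unfolding `mixDif` gives a sum over positions y of d(y), the mixture before y and the means
after y. After multiplication by d(x), only the identifiable products d(x)d(y) occur; d alone, whose
sign is ambiguous, never has to be compared. The earlier mixture errors that enter are collected in
`carry`. -/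
theorem abs_dif_mul_mixDif_sub_le (hu : IsRewardKernel u) (hv : IsRewardKernel v)
    (hu' : IsRewardKernel u') (hv' : IsRewardKernel v') {e e' : ℝ} (x : Step S A R)
    {h : List (Step S A R)} (h1 : ∀ y ∈ h, |avg u v y - avg u' v' y| ≤ e)
    (h2 : ∀ y ∈ h, |dif u v x * dif u v y - dif u' v' x * dif u' v' y| ≤ e') :
    |dif u v x * mixDif u v h - dif u' v' x * mixDif u' v' h| ≤
      |dif u v x| * carry u v u' v' h + (e + e') * accum (avg u v) (mixProb u' v') h := by
  induction h using List.reverseRecOn with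
  | nil => simp [mixDif]
  | append_singleton h y ih =>
    have ih' := ih (fun y hy => h1 y (by simp [hy])) (fun y hy => h2 y (by simp [hy]))
    have h1y := h1 y (by simp)
    have h2y := h2 y (by simp)
    have hp := (hu.avg hv).nonneg y
    have hE := (hu'.mixProb hv').nonneg h
    have he : 0 ≤ e := (abs_nonneg _).trans h1y
    rw [mixDif_concat, mixDif_concat, carry_concat, accum_concat]
    set D := mixProb u v h - mixProb u' v' h with hD
    calc _ = |avg u v y * (dif u v x * mixDif u v h - dif u' v' x * mixDif u' v' h) +
            (avg u v y - avg u' v' y) * (dif u' v' x * mixDif u' v' h) +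
            (dif u v x * dif u v y - dif u' v' x * dif u' v' y) * mixProb u' v' h +
            dif u v x * dif u v y * D| := by rw [hD]; congr 1; ring
      _ ≤ |avg u v y * (dif u v x * mixDif u v h - dif u' v' x * mixDif u' v' h)| +
            |(avg u v y - avg u' v' y) * (dif u' v' x * mixDif u' v' h)| +
            |(dif u v x * dif u v y - dif u' v' x * dif u' v' y) * mixProb u' v' h| +
            |dif u v x * dif u v y * D| :=
          (abs_add_le _ _).trans (add_le_add_left (abs_add_three _ _ _) _)
      _ ≤ avg u v y * (|dif u v x| * carry u v u' v' h +
              (e + e') * accum (avg u v) (mixProb u' v') h) +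
            e * (1 * mixProb u' v' h) + e' * mixProb u' v' h +
            |dif u v x| * |dif u v y| * |D| := by
          simp only [abs_mul]
          rw [abs_of_nonneg hp, abs_of_nonneg hE]
          gcongr
          · exact hu'.abs_dif_le hv' x
          · exact hu'.abs_mixDif_le hv' h
      _ = _ := by ring

/-- The error of the mixture together with its carried part. -/
noncomputable def mixErr (u v u' v' : Step S A R → ℝ) (h : List (Step S A R)) : ℝ :=
  |mixProb u v h - mixProb u' v' h| + carry u v u' v' h

theorem mixErr_nonneg (hu : IsRewardKernel u) (hv : IsRewardKernel v) (h : List (Step S A R)) :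
    0 ≤ mixErr u v u' v' h := add_nonneg (abs_nonneg _) (carry_nonneg hu hv h)

/-- The mixture error feeds the carried error with factor |d| and conversely, while each reproduces
itself with factor p. Their sum therefore satisfies a closed recursion with factor p + |d|, plus
fresh error. -/
theorem mixErr_concat_le (hu : IsRewardKernel u) (hv : IsRewardKernel v)
    (hu' : IsRewardKernel u') (hv' : IsRewardKernel v') {b : ℝ} {x : Step S A R}
    {h : List (Step S A R)} (hc : RewardClose u v u' v' (saList (h ++ [x])) b) :
    mixErr u v u' v' (h ++ [x]) ≤ (avg u v x + |dif u v x|) * mixErr u v u' v' h +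
      4 * b * (mixProb u' v' h + accum (avg u v) (mixProb u' v') h) := by
  have hp := (hu.avg hv).nonneg x
  have hE := (hu'.mixProb hv').nonneg h
  have hQ := accum_nonneg (hu.avg hv).nonneg (hu'.mixProb hv').nonneg h
  have hx := hc.abs_avg_sub_le (y := x) (by simp)
  have hb : 0 ≤ b := (abs_nonneg _).trans hx
  have hY := abs_dif_mul_mixDif_sub_le hu hv hu' hv' (e := b) (e' := 3 * b) x (h := h)
    (fun y hy => hc.abs_avg_sub_le (by simp [hy])) (by
      intro y hy
      obtain ⟨i, hi, rfl⟩ := List.getElem_of_mem hy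
      exact hc.abs_dif_mul_sub_le hu hv hu' hv' (i := h.length) (j := i)
        (x := (x.1, x.2.1)) (y := (h[i].1, h[i].2.1)) (by omega) (by simp [saList])
        (by simp [saList, List.getElem?_append_left, hi]) x.2.2 h[i].2.2)
  unfold mixErr
  rw [mixProb_concat, mixProb_concat, carry_concat]
  set D := mixProb u v h - mixProb u' v' h with hD
  have : |avg u v x * mixProb u v h + dif u v x * mixDif u v h -
      (avg u' v' x * mixProb u' v' h + dif u' v' x * mixDif u' v' h)| ≤
      avg u v x * |D| + b * mixProb u' v' h + (|dif u v x| * carry u v u' v' h +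
        (b + 3 * b) * accum (avg u v) (mixProb u' v') h) := by
    calc _ = |avg u v x * D + (avg u v x - avg u' v' x) * mixProb u' v' h +
          (dif u v x * mixDif u v h - dif u' v' x * mixDif u' v' h)| := by
          rw [hD]; congr 1; ring
      _ ≤ |avg u v x * D| + |(avg u v x - avg u' v' x) * mixProb u' v' h| +
          |dif u v x * mixDif u v h - dif u' v' x * mixDif u' v' h| := abs_add_three _ _ _
      _ ≤ _ := by
          rw [abs_mul, abs_mul, abs_of_nonneg hp, abs_of_nonneg hE]
          gcongr
  nlinarith [mul_nonneg hb hE]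

end RewardComparison

/-! ### Distance of two balanced mixtures with close pairwise laws -/

section MixtureError

variable {S A : Type*} {R : Finset ℝ} {u v u' v' : Step S A R → ℝ}

/-- Total variation distance of the two reward laws at the state and action of a step. -/
noncomputable def sep (u v : Step S A R → ℝ) (x : Step S A R) : ℝ :=
  ∑ r, |dif u v (x.1, x.2.1, r)|

theorem sep_nonneg (u v : Step S A R → ℝ) (x : Step S A R) : 0 ≤ sep u v x :=
  Finset.sum_nonneg fun _ _ => abs_nonneg _

theorem sep_le_one (hu : IsRewardKernel u) (hv : IsRewardKernel v) (x : Step S A R) :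
    sep u v x ≤ 1 := by
  rw [← (hu.avg hv).sum_eq x.1 x.2.1]
  refine Finset.sum_le_sum fun r _ => ?_
  have := hu.nonneg (x.1, x.2.1, r)
  have := hv.nonneg (x.1, x.2.1, r)
  unfold dif avg
  rw [abs_le]
  constructor <;> linarith

/-- Growth factor of the error of the mixture along a list of steps. -/
noncomputable def growth (u v : Step S A R → ℝ) (h : List (Step S A R)) : ℝ :=
  listProd (fun x => 1 + sep u v x) h

@[simp] theorem growth_concat (h : List (Step S A R)) (x : Step S A R) :
    growth u v (h ++ [x]) = growth u v h * (1 + sep u v x) := listProd_concat _ _ _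

theorem one_le_growth (u v : Step S A R → ℝ) (h : List (Step S A R)) : 1 ≤ growth u v h := by
  induction h using List.reverseRecOn with
  | nil => simp [growth]
  | append_singleton h x ih =>
    rw [growth_concat]
    have := sep_nonneg u v x
    nlinarith

/-- A non-anticipating bound for the error created at one step. -/
noncomputable def errBound (H : ℕ) (u v u' v' : Step S A R → ℝ) (h : List (Step S A R)) : ℝ :=
  mixProb u' v' h +
    (accum (avg u v) (mixProb u' v') h + R.card * (H - h.length : ℕ) * mixProb u' v' h)

/-- A non-anticipating bound for the error accumulated along a list. -/
noncomputable def errBoundSum (H : ℕ) (u v u' v' : Step S A R → ℝ) (h : List (Step S A R)) : ℝ :=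
  accum (avg u v) (errBound H u v u' v') h +
    R.card * (H - h.length : ℕ) * errBound H u v u' v' h

theorem isCausal_errBound (H : ℕ) (hu : IsRewardKernel u) (hv : IsRewardKernel v)
    (hu' : IsRewardKernel u') (hv' : IsRewardKernel v') :
    IsCausal H (errBound H u v u' v') :=
  ((hu'.mixProb hv').isCausal H).add (((hu'.mixProb hv').isCausal H).accum (hu.avg hv))

theorem isCausal_errBoundSum (H : ℕ) (hu : IsRewardKernel u) (hv : IsRewardKernel v)
    (hu' : IsRewardKernel u') (hv' : IsRewardKernel v') :
    IsCausal H (errBoundSum H u v u' v') :=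
  (isCausal_errBound H hu hv hu' hv').accum (hu.avg hv)

theorem errBoundSum_nil (H : ℕ) (u v u' v' : Step S A R → ℝ) :
    errBoundSum H u v u' v' [] = R.card * H * (1 + R.card * H) := by
  simp [errBoundSum, errBound, mixProb]

/-- Summed over the reward, p + |d| gives 1 + total variation, which is the new factor of `growth`.
Normalised by `growth`, the error thus changes only by the fresh error of the step. -/
theorem sum_mixErr_div_growth_le (hu : IsRewardKernel u) (hv : IsRewardKernel v)
    (hu' : IsRewardKernel u') (hv' : IsRewardKernel v') {b : List (S × A) → ℝ}
    (hb : ∀ l, 0 ≤ b l) (H : ℕ) {h : List (Step S A R)} {s : S} {a : A}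
    (hc : RewardClose u v u' v' (saList h ++ [(s, a)]) (b (saList h ++ [(s, a)]))) :
    ∑ r, mixErr u v u' v' (h ++ [(s, a, r)]) / growth u v (h ++ [(s, a, r)]) ≤
      mixErr u v u' v' h / growth u v h + ∑ r, 4 * (errBoundSum H u v u' v' (h ++ [(s, a, r)]) *
        b (saList (h ++ [(s, a, r)]))) := by
  have hG := one_le_growth u v h
  have hp := (hu.avg hv)
  have hE := (hu'.mixProb hv').nonneg
  have hsep : ∀ r, sep u v (s, a, r) = ∑ r, |dif u v (s, a, r)| := fun r => rfl
  set q := ∑ r, |dif u v (s, a, r)| with hq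
  have hq0 : 0 ≤ q := Finset.sum_nonneg fun _ _ => abs_nonneg _
  have hΦ := mixErr_nonneg (u' := u') (v' := v') hu hv h
  have step : ∀ r, mixErr u v u' v' (h ++ [(s, a, r)]) / growth u v (h ++ [(s, a, r)]) ≤
      (avg u v (s, a, r) + |dif u v (s, a, r)|) *
        (mixErr u v u' v' h / (growth u v h * (1 + q))) +
      4 * (errBoundSum H u v u' v' (h ++ [(s, a, r)]) * b (saList (h ++ [(s, a, r)]))) := by
    intro r
    have h1 := mixErr_concat_le (x := (s, a, r)) (h := h) hu hv hu' hv' (by simpa using hc)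
    rw [growth_concat, hsep, div_le_iff₀ (by positivity)]
    refine h1.trans ?_
    have hB := hb (saList h ++ [(s, a)])
    -- The fresh error is a function of h, whereas planning needs a causal function of the prolonged
    -- list. The newest summand of `accum` at the prolonged list is `errBound` at h, so
    -- `errBoundSum` serves.
    have h2 : mixProb u' v' h + accum (avg u v) (mixProb u' v') h ≤
        errBoundSum H u v u' v' (h ++ [(s, a, r)]) := by
      have e1 : errBound H u v u' v' h ≤ errBoundSum H u v u' v' (h ++ [(s, a, r)]) := by
        have n1 := mul_nonneg (hp.nonneg (s, a, r))
          (accum_nonneg hp.nonneg (isCausal_errBound H hu hv hu' hv').nonneg h)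
        have n2 : 0 ≤ (R.card : ℝ) * ((H - (h ++ [(s, a, r)]).length : ℕ) : ℝ) *
            errBound H u v u' v' (h ++ [(s, a, r)]) :=
          mul_nonneg (by positivity) ((isCausal_errBound H hu hv hu' hv').nonneg _)
        rw [errBoundSum, accum_concat]
        linarith
      refine le_trans ?_ e1
      unfold errBound
      have : 0 ≤ (R.card : ℝ) * ((H - h.length : ℕ) : ℝ) * mixProb u' v' h :=
        mul_nonneg (by positivity) (hE h)
      linarith
    have h3 : 0 ≤ errBoundSum H u v u' v' (h ++ [(s, a, r)]) :=
      (isCausal_errBoundSum H hu hv hu' hv').nonneg _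
    have h4 : 1 ≤ growth u v h * (1 + q) := by nlinarith
    simp only [saList_concat]
    set B := b (saList h ++ [(s, a)])
    set K := growth u v h * (1 + q)
    have h5 : ((avg u v (s, a, r) + |dif u v (s, a, r)|) * (mixErr u v u' v' h / K) +
        4 * (errBoundSum H u v u' v' (h ++ [(s, a, r)]) * B)) * K =
        (avg u v (s, a, r) + |dif u v (s, a, r)|) * mixErr u v u' v' h +
        4 * (errBoundSum H u v u' v' (h ++ [(s, a, r)]) * B) * K := by
      field_simp
    rw [h5]
    refine add_le_add le_rfl ?_
    calc 4 * B * (mixProb u' v' h + accum (avg u v) (mixProb u' v') h) ≤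
          4 * B * errBoundSum H u v u' v' (h ++ [(s, a, r)]) := by gcongr
      _ = 4 * (errBoundSum H u v u' v' (h ++ [(s, a, r)]) * B) * 1 := by ring
      _ ≤ _ := by gcongr
  refine (Finset.sum_le_sum fun r _ => step r).trans_eq ?_
  rw [Finset.sum_add_distrib, ← Finset.sum_mul, Finset.sum_add_distrib, hp.sum_eq, ← hq]
  congr 1
  field_simp

/-- Three well-separated steps determine d up to one sign along the whole list. Sign +1 matches u
with u' and v with v'; sign −1 matches u with v' and v with u', which is as good because the mixture
is balanced. The bound contains the terms of both matchings. -/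
theorem abs_mixProb_sub_le_of_lt_growth (hu : IsRewardKernel u) (hv : IsRewardKernel v)
    (hu' : IsRewardKernel u') (hv' : IsRewardKernel v') {b : ℝ} {h : List (Step S A R)}
    (hc : RewardClose u v u' v' (saList h) b) (hG : 12 < growth u v h) :
    |mixProb u v h - mixProb u' v' h| ≤ 16 * (h.length * R.card) ^ 5 * b *
      (accum u (listProd u') h + accum v (listProd v') h + accum u (listProd v') h +
        accum v (listProd u') h) := by
  have hcard := two_lt_card_of_lt_prod (fun i : Fin h.length => sep u v h[i])
    (fun i => sep_nonneg _ _ _) (fun i => sep_le_one hu hv _)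
    (by
      have := Fin.prod_univ_fun_getElem h (fun x => 1 + sep u v x)
      unfold growth listProd at hG
      rw [← this] at hG
      exact hG)
  obtain ⟨i₁, i₂, i₃, m1, m2, m3, h12, h13, h23⟩ := Finset.two_lt_card_iff.1 hcard
  simp only [Finset.mem_filter, Finset.mem_univ, true_and] at m1 m2 m3
  have hn : 0 < h.length := i₁.pos
  have hR : 0 < R.card := by
    rw [Finset.card_pos]
    by_contra hR
    rw [Finset.not_nonempty_iff_eq_empty] at hR
    subst hR
    have : (0 : ℝ) < 1 / h.length := by positivity
    simp only [sep, Finset.univ_eq_empty, Finset.sum_empty] at m1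
    linarith
  have hnR : (1 : ℝ) ≤ h.length * R.card := by exact_mod_cast Nat.mul_pos hn hR
  -- A total variation of at least 1/n, spread over `R.card` rewards, has an entry of at least this
  -- size.
  set c : ℝ := 1 / (h.length * R.card) with hcdef
  have hc0 : 0 < c := by positivity
  have hc1 : c ≤ 1 := by rw [hcdef, div_le_one (by positivity)]; exact hnR
  let d : Fin h.length → R → ℝ := fun i r => dif u v (h[i].1, h[i].2.1, r)
  let d' : Fin h.length → R → ℝ := fun i r => dif u' v' (h[i].1, h[i].2.1, r)
  have large : ∀ i : Fin h.length, 1 / (h.length : ℝ) ≤ sep u v h[i] → ∃ r, c ≤ |d i r| := by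
    intro i hi
    have : ∑ r : R, c ≤ ∑ r : R, |d i r| := by
      refine le_trans (le_of_eq ?_) hi
      simp only [Finset.sum_const, Finset.card_univ, Fintype.card_coe, nsmul_eq_mul, hcdef]
      field_simp
    obtain ⟨z, hz⟩ := Finset.card_pos.1 hR
    obtain ⟨r, _, hr⟩ := Finset.exists_le_of_sum_le ⟨(⟨z, hz⟩ : R), Finset.mem_univ _⟩ this
    exact ⟨r, hr⟩
  obtain ⟨r₁, hr1⟩ := large _ m1
  obtain ⟨r₂, hr2⟩ := large _ m2
  obtain ⟨r₃, hr3⟩ := large _ m3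
  have get : ∀ i : Fin h.length, (saList h)[(i : ℕ)]? = some (h[i].1, h[i].2.1) := fun i => by
    simp [saList]
  obtain ⟨s, hs, hd⟩ := exists_sign_forall_abs_sub_le (d := d) (d' := d') (e := 3 * b) hc0 hc1
    (fun i r => hu.abs_dif_le hv _) (fun i r => hu'.abs_dif_le hv' _)
    (fun i j hij r r' => hc.abs_dif_mul_sub_le hu hv hu' hv' (Fin.val_ne_of_ne hij) (get i)
      (get j) r r') h12 h13 h23 hr1 hr2 hr3
  have hb : 0 ≤ b := (abs_nonneg _).trans (hc.avg i₁ _ (get i₁) r₁)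
  -- The sign lemma with product error 3b gives 15(n · `R.card`)⁵b for the half-differences, and the
  -- means add at most one more such unit.
  set e := 16 * (h.length * R.card : ℝ) ^ 5 * b with he
  have hd' : ∀ y ∈ h, |dif u v y - s * dif u' v' y| + |avg u v y - avg u' v' y| ≤ e := by
    intro y hy
    have h1 := hc.abs_avg_sub_le hy
    obtain ⟨i, hi, rfl⟩ := List.getElem_of_mem hy
    have h2 := hd ⟨i, hi⟩ h[i].2.2
    have h3 : 5 * (3 * b) / c ^ 5 = 15 * (h.length * R.card : ℝ) ^ 5 * b := by
      rw [hcdef]; field_simp; ring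
    rw [h3] at h2
    have h4 : b ≤ (h.length * R.card : ℝ) ^ 5 * b :=
      le_mul_of_one_le_left hb (one_le_pow₀ hnR)
    change |dif u v h[i] - s * dif u' v' h[i]| ≤ _ at h2
    linarith
  have hQ : ∀ {f g : Step S A R → ℝ}, IsRewardKernel f → IsRewardKernel g →
      0 ≤ accum f (listProd g) h := fun hf hg => accum_nonneg hf.nonneg hg.isRewardLaw.nonneg h
  have q1 := hQ hu hu'
  have q2 := hQ hv hv'
  have q3 := hQ hu hv'
  have q4 := hQ hv hu'
  have he0 : 0 ≤ e := by positivity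
  rcases hs with rfl | rfl
  · have a1 := abs_listProd_sub_le hu.nonneg hu'.nonneg (h := h) (e := e) fun y hy => by
      refine le_trans ?_ (hd' y hy)
      rw [show u y - u' y = (dif u v y - 1 * dif u' v' y) + (avg u v y - avg u' v' y) by
        simp only [dif, avg]; ring]
      exact abs_add_le _ _
    have a2 := abs_listProd_sub_le hv.nonneg hv'.nonneg (h := h) (e := e) fun y hy => by
      refine le_trans ?_ (hd' y hy)
      rw [show v y - v' y = (avg u v y - avg u' v' y) - (dif u v y - 1 * dif u' v' y) by
        simp only [dif, avg]; ring, add_comm]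
      exact abs_sub _ _
    have a3 : |mixProb u v h - mixProb u' v' h| ≤
        (|listProd u h - listProd u' h| + |listProd v h - listProd v' h|) / 2 := by
      rw [show mixProb u v h - mixProb u' v' h = ((listProd u h - listProd u' h) +
        (listProd v h - listProd v' h)) / 2 by simp only [mixProb]; ring, abs_div, abs_two]
      gcongr
      exact abs_add_le _ _
    nlinarith [mul_nonneg he0 q1, mul_nonneg he0 q2, mul_nonneg he0 q3, mul_nonneg he0 q4]
  · have a1 := abs_listProd_sub_le hu.nonneg hv'.nonneg (h := h) (e := e) fun y hy => by
      refine le_trans ?_ (hd' y hy)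
      rw [show u y - v' y = (dif u v y - -1 * dif u' v' y) + (avg u v y - avg u' v' y) by
        simp only [dif, avg]; ring]
      exact abs_add_le _ _
    have a2 := abs_listProd_sub_le hv.nonneg hu'.nonneg (h := h) (e := e) fun y hy => by
      refine le_trans ?_ (hd' y hy)
      rw [show v y - u' y = (avg u v y - avg u' v' y) - (dif u v y - -1 * dif u' v' y) by
        simp only [dif, avg]; ring, add_comm]
      exact abs_sub _ _
    have a3 : |mixProb u v h - mixProb u' v' h| ≤
        (|listProd u h - listProd v' h| + |listProd v h - listProd u' h|) / 2 := by
      rw [show mixProb u v h - mixProb u' v' h = ((listProd u h - listProd v' h) +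
        (listProd v h - listProd u' h)) / 2 by simp only [mixProb]; ring, abs_div, abs_two]
      gcongr
      exact abs_add_le _ _
    nlinarith [mul_nonneg he0 q1, mul_nonneg he0 q2, mul_nonneg he0 q3, mul_nonneg he0 q4]

variable [Fintype S] [Fintype A]

/-- Summation of the one-step drifts: each step adds at most four times `errBoundSum` at the empty
list times the planning value of b. -/
theorem listSum_mixErr_div_growth_le [Nonempty A] {P : List (S × A) → S → ℝ} (hP : IsTransition P)
    (hu : IsRewardKernel u) (hv : IsRewardKernel v) (hu' : IsRewardKernel u')
    (hv' : IsRewardKernel v') {b : List (S × A) → ℝ} (hb : ∀ l, 0 ≤ b l) (hm : PrefixMono b)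
    {H : ℕ} (hc : ∀ l, l.length ≤ H → RewardClose u v u' v' l (b l)) (π : Policy S A R) (n : ℕ)
    (hn : n ≤ H) :
    listSum n (fun h => planWeight P π h * (mixErr u v u' v' h / growth u v h)) ≤
      n * (4 * (R.card * H * (1 + R.card * H) * optVal P b H [])) := by
  induction n with
  | zero => simp [listSum_zero, mixErr, mixProb]
  | succ n ih =>
    rw [listSum_succ_planWeight]
    calc _ ≤ listSum n (fun h => planWeight P π h * (mixErr u v u' v' h / growth u v h) +
          planWeight P π h * ∑ s, P (saList h) s * ∑ r,
            4 * (errBoundSum H u v u' v' (h ++ [(s, π h s, r)]) *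
              b (saList (h ++ [(s, π h s, r)])))) := by
          refine listSum_mono fun h hh => ?_
          rw [← mul_add]
          refine mul_le_mul_of_nonneg_left ?_ (planWeight_nonneg hP.nonneg _ _)
          calc _ ≤ ∑ s, P (saList h) s * (mixErr u v u' v' h / growth u v h + ∑ r,
                4 * (errBoundSum H u v u' v' (h ++ [(s, π h s, r)]) *
                  b (saList (h ++ [(s, π h s, r)])))) :=
                Finset.sum_le_sum fun s _ => mul_le_mul_of_nonneg_left
                  (sum_mixErr_div_growth_le hu hv hu' hv' hb H
                    (hc _ (by simp; omega))) (hP.nonneg _ _)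
            _ = _ := by
                simp only [mul_add]
                rw [Finset.sum_add_distrib, ← Finset.sum_mul, hP.sum_eq, one_mul]
      _ = listSum n (fun h => planWeight P π h * (mixErr u v u' v' h / growth u v h)) +
          listSum (n + 1) (fun h => planWeight P π h *
            (4 * (errBoundSum H u v u' v' h * b (saList h)))) := by
          rw [listSum_add, listSum_succ_planWeight]
      _ ≤ n * (4 * (R.card * H * (1 + R.card * H) * optVal P b H [])) +
          4 * (R.card * H * (1 + R.card * H) * optVal P b H []) := by
          refine add_le_add (ih (by omega)) ?_
          have := listSum_planWeight_le hP hb hm (isCausal_errBoundSum H hu hv hu' hv') π hn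
          rw [errBoundSum_nil] at this
          refine le_trans (le_of_eq ?_) (mul_le_mul_of_nonneg_left this (by norm_num : (0 : ℝ) ≤ 4))
          rw [← listSum_mul_left]
          exact listSum_congr fun h _ => by ring
      _ = _ := by push_cast; ring

theorem listSum_accum_le [Nonempty A] {P : List (S × A) → S → ℝ} (hP : IsTransition P)
    (hu : IsRewardKernel u) (hu' : IsRewardKernel u') {b : List (S × A) → ℝ}
    (hb : ∀ l, 0 ≤ b l) (hm : PrefixMono b) (H : ℕ) (π : Policy S A R) :
    listSum H (fun h => planWeight P π h * (accum u (listProd u') h * b (saList h))) ≤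
      R.card * H * optVal P b H [] := by
  have hF := (hu'.isRewardLaw.isCausal H).accum hu
  have := listSum_planWeight_le hP hb hm hF π le_rfl
  simp only [accum_nil, List.length_nil, Nat.sub_zero, zero_add, listProd_nil, mul_one] at this
  refine le_trans (listSum_mono fun h hh => ?_) this
  refine mul_le_mul_of_nonneg_left (mul_le_mul_of_nonneg_right ?_ (hb _))
    (planWeight_nonneg hP.nonneg _ _)
  rw [hh]
  simp

/-- Two balanced mixtures whose single and pairwise reward laws are close along every list of
states and actions have close laws of all the rewards of an episode. -/
theorem listSum_abs_mixProb_sub_le [Nonempty A] {P : List (S × A) → S → ℝ} (hP : IsTransition P)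
    (hu : IsRewardKernel u) (hv : IsRewardKernel v) (hu' : IsRewardKernel u')
    (hv' : IsRewardKernel v') {b : List (S × A) → ℝ} (hb : ∀ l, 0 ≤ b l) (hm : PrefixMono b)
    {H : ℕ} (hc : ∀ l, l.length ≤ H → RewardClose u v u' v' l (b l)) (π : Policy S A R)
    (hHR : 1 ≤ (H : ℝ) * R.card) :
    listSum H (fun h => planWeight P π h * |mixProb u v h - mixProb u' v' h|) ≤
      200 * (H * R.card : ℝ) ^ 6 * optVal P b H [] * H := by
  set V := optVal P b H [] with hV
  have hV0 : 0 ≤ V := optVal_nonneg hP.nonneg hb _ _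
  have hH0 : (0 : ℝ) ≤ H := Nat.cast_nonneg H
  have hH : (1 : ℝ) ≤ H := by
    rcases Nat.eq_zero_or_pos H with h | h
    · simp [h] at hHR; linarith
    · exact_mod_cast h
  set N := (H * R.card : ℝ) with hN
  -- Whether `growth` exceeds 12 depends on the history, so the two regimes are combined pointwise
  -- before averaging.
  have hpt : ∀ h : List (Step S A R), h.length = H →
      |mixProb u v h - mixProb u' v' h| ≤ 12 * (mixErr u v u' v' h / growth u v h) +
        16 * N ^ 5 * (accum u (listProd u') h * b (saList h) +
          accum v (listProd v') h * b (saList h) + accum u (listProd v') h * b (saList h) +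
          accum v (listProd u') h * b (saList h)) := by
    intro h hh
    have hQ : ∀ {f g : Step S A R → ℝ}, IsRewardKernel f → IsRewardKernel g →
        0 ≤ accum f (listProd g) h * b (saList h) := fun hf hg =>
      mul_nonneg (accum_nonneg hf.nonneg hg.isRewardLaw.nonneg h) (hb _)
    have q1 := hQ hu hu'
    have q2 := hQ hv hv'
    have q3 := hQ hu hv'
    have q4 := hQ hv hu'
    have hG1 := one_le_growth u v h
    have hM := mixErr_nonneg (u' := u') (v' := v') hu hv h
    rcases lt_or_ge 12 (growth u v h) with hG | hG
    · have h1 := abs_mixProb_sub_le_of_lt_growth hu hv hu' hv' (hc (saList h) (by simp [hh])) hG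
      rw [hh, ← hN] at h1
      have : 0 ≤ mixErr u v u' v' h / growth u v h := by positivity
      refine h1.trans ?_
      linarith
    · have h1 : |mixProb u v h - mixProb u' v' h| ≤ mixErr u v u' v' h := by
        have := carry_nonneg (u' := u') (v' := v') hu hv h
        unfold mixErr
        linarith
      have h2 : mixErr u v u' v' h ≤ 12 * (mixErr u v u' v' h / growth u v h) := by
        rw [← mul_div_assoc, le_div_iff₀ (by positivity), mul_comm]
        gcongr
      have : 0 ≤ 16 * N ^ 5 * (accum u (listProd u') h * b (saList h) +
          accum v (listProd v') h * b (saList h) + accum u (listProd v') h * b (saList h) +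
          accum v (listProd u') h * b (saList h)) := by positivity
      linarith
  have s0 := listSum_mixErr_div_growth_le hP hu hv hu' hv' hb hm hc π H le_rfl
  have s1 := listSum_accum_le hP hu hu' hb hm H π
  have s2 := listSum_accum_le hP hv hv' hb hm H π
  have s3 := listSum_accum_le hP hu hv' hb hm H π
  have s4 := listSum_accum_le hP hv hu' hb hm H π
  rw [mul_comm (R.card : ℝ) H, ← hN, ← hV] at s0 s1 s2 s3 s4
  calc _ ≤ listSum H (fun h => 12 * (planWeight P π h * (mixErr u v u' v' h / growth u v h)) +
        16 * N ^ 5 * (planWeight P π h * (accum u (listProd u') h * b (saList h)) +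
          planWeight P π h * (accum v (listProd v') h * b (saList h)) +
          planWeight P π h * (accum u (listProd v') h * b (saList h)) +
          planWeight P π h * (accum v (listProd u') h * b (saList h)))) := by
        refine listSum_mono fun h hh => ?_
        refine (mul_le_mul_of_nonneg_left (hpt h hh)
          (planWeight_nonneg hP.nonneg π h)).trans_eq ?_
        ring
    _ ≤ 12 * (H * (4 * (N * (1 + N) * V))) + 16 * N ^ 5 * (N * V + N * V + N * V + N * V) := by
        simp only [listSum_add, listSum_mul_left]
        gcongr
    _ ≤ 200 * N ^ 6 * V * H := by
        have hN2 : N * (1 + N) ≤ 2 * N ^ 6 := by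
          have : N * 1 ≤ N * N := by gcongr
          have : N ^ 2 ≤ N ^ 6 := pow_le_pow_right₀ hHR (by norm_num)
          nlinarith
        have h1 : N * (1 + N) * V ≤ 2 * N ^ 6 * V := by gcongr
        have h2 : N ^ 6 * V ≤ N ^ 6 * V * H := le_mul_of_one_le_right (by positivity) hH
        have h3 : H * (N * (1 + N) * V) ≤ H * (2 * N ^ 6 * V) := by gcongr
        have h4 : 0 ≤ N ^ 6 * V * H := by positivity
        have e1 : 12 * (H * (4 * (N * (1 + N) * V))) = 48 * (H * (N * (1 + N) * V)) := by ring
        have e2 : 16 * N ^ 5 * (N * V + N * V + N * V + N * V) = 64 * (N ^ 6 * V) := by ring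
        have e3 : H * (2 * N ^ 6 * V) = 2 * (N ^ 6 * V * H) := by ring
        linarith

end MixtureError

/-! ### Marginals and change of the transition law -/

section PlanningLaw

variable {S A : Type*} {R : Finset ℝ} [Fintype S] [Fintype A]

theorem listSum_planWeight_take {P : List (S × A) → S → ℝ} (hP : IsTransition P)
    {F : List (Step S A R) → ℝ} (hF : IsRewardLaw F) (π : Policy S A R)
    (G : List (Step S A R) → ℝ) {j n : ℕ} (hjn : j ≤ n) :
    listSum n (fun h => planWeight P π h * (F h * G (h.take j))) =
      listSum j (fun h => planWeight P π h * (F h * G h)) := by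
  induction n, hjn using Nat.le_induction with
  | base => exact listSum_congr fun l hl => by rw [List.take_of_length_le hl.le]
  | succ n hn ih =>
    rw [listSum_succ_planWeight, ← ih]
    refine listSum_congr fun l hl => ?_
    have : ∀ x, (l ++ [x]).take j = l.take j := fun x =>
      List.take_append_of_le_length (by omega)
    simp_rw [this, ← Finset.sum_mul, hF.step]
    rw [← Finset.sum_mul, hP.sum_eq, one_mul]

theorem listSum_planWeight_eq_one {P : List (S × A) → S → ℝ} (hP : IsTransition P)
    {F : List (Step S A R) → ℝ} (hF : IsRewardLaw F) (π : Policy S A R) (n : ℕ) :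
    listSum n (fun h => planWeight P π h * F h) = 1 := by
  have := listSum_planWeight_take hP hF π (fun _ => 1) (Nat.zero_le n)
  simpa [listSum_zero, hF.nil] using this

/-- Change of the transition law in the expectation of a function that controls the difference of
the two laws. -/
theorem listSum_planWeight_change {P P' : List (S × A) → S → ℝ} (hP : IsTransition P)
    (hP' : IsTransition P') {F : List (Step S A R) → ℝ} (hF : IsRewardLaw F)
    {f : List (S × A) → ℝ} (hf : ∀ l, 0 ≤ f l) (hm : PrefixMono f) {B κ : ℝ} (hB : ∀ l, f l ≤ B)
    {H : ℕ} (hκ : 0 ≤ κ) (hPP : ∀ l, l.length < H → ∑ s, |P l s - P' l s| ≤ κ * f l)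
    (π : Policy S A R) :
    listSum H (fun h => planWeight P' π h * (F h * f (saList h))) ≤
      (1 + κ * H * B) * listSum H (fun h => planWeight P π h * (F h * f (saList h))) := by
  set V := listSum H (fun h => planWeight P π h * (F h * f (saList h))) with hV
  have hB0 : 0 ≤ B := (hf []).trans (hB [])
  have h1 := listSum_abs_planWeight_sub_le hP hP' (hF.isCausal H) π H le_rfl
  -- The one-step errors are dominated by f itself, and f increases along prefixes, so each costs at
  -- most κ times the expectation V being compared. This makes the comparison multiplicative.
  have h2 : ∀ j ∈ Finset.range H, listSum j (fun h => planWeight P π h *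
      (F h * ∑ s, |P (saList h) s - P' (saList h) s|)) ≤ κ * V := by
    intro j hj
    have hj' : j < H := Finset.mem_range.1 hj
    refine le_trans ?_ (mul_le_mul_of_nonneg_left
      (listSum_planWeight_mono hP hm hF π hj'.le) hκ)
    rw [← listSum_mul_left]
    refine listSum_mono fun h hh => ?_
    have := mul_le_mul_of_nonneg_left (mul_le_mul_of_nonneg_left
      (hPP (saList h) (by simp [hh, hj'])) (hF.nonneg h)) (planWeight_nonneg hP.nonneg π h)
    refine this.trans_eq ?_
    ring
  have h3 := h1.trans (Finset.sum_le_sum h2)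
  simp only [Finset.sum_const, Finset.card_range, nsmul_eq_mul] at h3
  calc _ ≤ listSum H (fun h => planWeight P π h * (F h * f (saList h)) +
        B * (|planWeight P π h - planWeight P' π h| * F h)) := by
        refine listSum_mono fun h _ => ?_
        have e1 : planWeight P' π h ≤ planWeight P π h +
            |planWeight P π h - planWeight P' π h| := by
          have := neg_abs_le (planWeight P π h - planWeight P' π h)
          linarith
        have hFf : 0 ≤ F h * f (saList h) := mul_nonneg (hF.nonneg h) (hf _)
        have e2 : |planWeight P π h - planWeight P' π h| * (F h * f (saList h)) ≤
            |planWeight P π h - planWeight P' π h| * (F h * B) :=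
          mul_le_mul_of_nonneg_left (mul_le_mul_of_nonneg_left (hB _) (hF.nonneg h))
            (abs_nonneg _)
        have := mul_le_mul_of_nonneg_right e1 hFf
        linarith
    _ ≤ V + B * (H * (κ * V)) := by
        rw [listSum_add, listSum_mul_left, ← hV]
        gcongr
    _ = _ := by ring

end PlanningLaw

/-! ### Trajectory laws and values of balanced models -/

section Model

variable {S A : Type*} {R : Finset ℝ}

/-- Total reward of a list of steps. -/
def totalReward (h : List (Step S A R)) : ℝ := (h.map fun x => (x.2.2 : ℝ)).sum

theorem abs_totalReward_le (hR : ∀ z ∈ R, |z| ≤ 1) (h : List (Step S A R)) :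
    |totalReward h| ≤ h.length := by
  induction h with
  | nil => simp [totalReward]
  | cons x h ih =>
    have := hR x.2.2 x.2.2.2
    simp only [totalReward, List.map_cons, List.sum_cons, List.length_cons] at ih ⊢
    push_cast
    exact (abs_add_le _ _).trans (by linarith)

variable [Fintype S]

/-- Law of the next state, given all earlier states and actions. -/
def nextProb {M : ℕ} (𝓜 : RMMDP M S A R) (l : List (S × A)) (s : S) : ℝ :=
  match l.getLast? with
  | none => 𝓜.init s
  | some x => 𝓜.trans x.1 x.2 s

@[simp] theorem nextProb_nil {M : ℕ} (𝓜 : RMMDP M S A R) (s : S) :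
    𝓜.nextProb [] s = 𝓜.init s := rfl

@[simp] theorem nextProb_concat {M : ℕ} (𝓜 : RMMDP M S A R) (l : List (S × A)) (x : S × A)
    (s : S) : 𝓜.nextProb (l ++ [x]) s = 𝓜.trans x.1 x.2 s := by simp [nextProb]

theorem isTransition_nextProb {M : ℕ} (𝓜 : RMMDP M S A R) : IsTransition 𝓜.nextProb where
  nonneg l s := by
    rcases List.eq_nil_or_concat l with rfl | ⟨l, x, rfl⟩
    · exact 𝓜.init_mem.1 s
    · simpa using (𝓜.trans_mem x.1 x.2).1 s
  sum_eq l := by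
    rcases List.eq_nil_or_concat l with rfl | ⟨l, x, rfl⟩
    · exact 𝓜.init_mem.2
    · simpa using (𝓜.trans_mem x.1 x.2).2

/-- The reward law of a context, as a function of a step. -/
def rewProb {M : ℕ} (𝓜 : RMMDP M S A R) (m : Fin M) (x : Step S A R) : ℝ :=
  𝓜.reward m x.1 x.2.1 x.2.2

theorem isRewardKernel_rewProb {M : ℕ} (𝓜 : RMMDP M S A R) (m : Fin M) :
    IsRewardKernel (𝓜.rewProb m) where
  nonneg x := (𝓜.reward_mem m x.1 x.2.1).1 x.2.2
  sum_eq s a := (𝓜.reward_mem m s a).2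

theorem stateProb_eq_nextProb {M H : ℕ} (𝓜 : RMMDP M S A R) (τ : Trajectory S A R H)
    (t : Fin H) : 𝓜.stateProb τ t = 𝓜.nextProb (saList ((List.ofFn τ).take t)) (τ t).1 := by
  obtain ⟨t, ht⟩ := t
  cases t with
  | zero => rfl
  | succ t =>
    have : (List.ofFn τ).take (t + 1) = (List.ofFn τ).take t ++ [τ ⟨t, Nat.lt_of_succ_lt ht⟩] := by
      rw [List.take_add_one, List.getElem?_ofFn, dif_pos (Nat.lt_of_succ_lt ht)]
      rfl
    rw [this, saList_concat, nextProb_concat]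
    rfl

theorem contextProb_eq {M H : ℕ} (𝓜 : RMMDP M S A R) (π : Policy S A R) (m : Fin M)
    (τ : Trajectory S A R H) :
    𝓜.contextProb π m τ =
      planWeight 𝓜.nextProb π (List.ofFn τ) * listProd (𝓜.rewProb m) (List.ofFn τ) := by
  rw [planWeight, pathProd_ofFn, listProd, List.map_ofFn, List.prod_ofFn, contextProb,
    ← Finset.prod_mul_distrib]
  refine Finset.prod_congr rfl fun t _ => ?_
  rw [stateProb_eq_nextProb]
  rfl

/-- Probability of the rewards of an episode, given its states and actions, if both contexts
have weight `1 / 2`. -/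
noncomputable def episodeProb (𝓜 : RMMDP 2 S A R) : List (Step S A R) → ℝ :=
  mixProb (𝓜.rewProb 0) (𝓜.rewProb 1)

theorem isRewardLaw_episodeProb (𝓜 : RMMDP 2 S A R) : IsRewardLaw 𝓜.episodeProb :=
  (𝓜.isRewardKernel_rewProb 0).mixProb (𝓜.isRewardKernel_rewProb 1)

variable {𝓜 𝓜' : RMMDP 2 S A R} {H : ℕ}

theorem trajProb_eq (hw : ∀ m, 𝓜.weight m = 1 / 2) (π : Policy S A R) (τ : Trajectory S A R H) :
    𝓜.trajProb π τ =
      planWeight 𝓜.nextProb π (List.ofFn τ) * 𝓜.episodeProb (List.ofFn τ) := by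
  simp only [trajProb, Fin.sum_univ_two, hw, contextProb_eq, episodeProb, mixProb]
  ring

theorem trajProb_nonneg (hw : ∀ m, 𝓜.weight m = 1 / 2) (π : Policy S A R)
    (τ : Trajectory S A R H) : 0 ≤ 𝓜.trajProb π τ := by
  rw [trajProb_eq hw]
  exact mul_nonneg (planWeight_nonneg 𝓜.isTransition_nextProb.nonneg _ _)
    (𝓜.isRewardLaw_episodeProb.nonneg _)

variable [Fintype A]

theorem sum_trajProb_mul (hw : ∀ m, 𝓜.weight m = 1 / 2) (π : Policy S A R)
    (G : List (Step S A R) → ℝ) :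
    ∑ τ : Trajectory S A R H, 𝓜.trajProb π τ * G (List.ofFn τ) =
      listSum H (fun h => planWeight 𝓜.nextProb π h * (𝓜.episodeProb h * G h)) :=
  Finset.sum_congr rfl fun τ _ => by rw [trajProb_eq hw, mul_assoc]

theorem sum_trajProb (hw : ∀ m, 𝓜.weight m = 1 / 2) (π : Policy S A R) :
    ∑ τ : Trajectory S A R H, 𝓜.trajProb π τ = 1 := by
  have := sum_trajProb_mul (H := H) hw π (fun _ => 1)
  simp only [mul_one] at this
  rw [this]
  exact listSum_planWeight_eq_one 𝓜.isTransition_nextProb 𝓜.isRewardLaw_episodeProb π H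

theorem value_eq (hw : ∀ m, 𝓜.weight m = 1 / 2) (π : Policy S A R) :
    𝓜.value H π =
      listSum H (fun h => planWeight 𝓜.nextProb π h * (𝓜.episodeProb h * totalReward h)) := by
  rw [← sum_trajProb_mul hw]
  refine Finset.sum_congr rfl fun τ _ => ?_
  rw [totalReward, List.map_ofFn, List.sum_ofFn]
  rfl

theorem abs_value_le (hw : ∀ m, 𝓜.weight m = 1 / 2) (hR : ∀ z ∈ R, |z| ≤ 1) (π : Policy S A R) :
    |𝓜.value H π| ≤ H := by
  calc |𝓜.value H π| ≤ ∑ τ : Trajectory S A R H, |𝓜.trajProb π τ * ∑ t, ((τ t).2.2 : ℝ)| :=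
        Finset.abs_sum_le_sum_abs _ _
    _ ≤ ∑ τ : Trajectory S A R H, 𝓜.trajProb π τ * H := by
        refine Finset.sum_le_sum fun τ _ => ?_
        rw [abs_mul, abs_of_nonneg (trajProb_nonneg hw π τ)]
        refine mul_le_mul_of_nonneg_left ?_ (trajProb_nonneg hw π τ)
        calc _ ≤ ∑ t, |((τ t).2.2 : ℝ)| := Finset.abs_sum_le_sum_abs _ _
          _ ≤ ∑ t : Fin H, (1 : ℝ) := Finset.sum_le_sum fun t _ => hR _ (τ t).2.2.2
          _ = H := by simp
    _ = H := by rw [← Finset.sum_mul, sum_trajProb hw, one_mul]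

/-- There is an optimal history-dependent policy. -/
theorem exists_optimal_policy [Nonempty A] (𝓜 : RMMDP 2 S A R) (H : ℕ) :
    ∃ π : Policy S A R, ∀ π' : Policy S A R, 𝓜.value H π' ≤ 𝓜.value H π := by
  -- Policies are defined on lists of all lengths and need not form a finite type. The value depends
  -- only on which actions along length-H trajectories agree with the policy, and there are finitely
  -- many such patterns.
  let c : Policy S A R → (Trajectory S A R H → Fin H → Prop) := fun π τ t =>
    π ((List.ofFn τ).take t) (τ t).1 = (τ t).2.1
  have hc : ∀ π π', c π = c π' → 𝓜.value H π = 𝓜.value H π' := by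
    intro π π' h
    have h' : ∀ (τ : Trajectory S A R H) t, actionProb π τ t = actionProb π' τ t := by
      intro τ t
      have : (π ((List.ofFn τ).take t) (τ t).1 = (τ t).2.1) =
        (π' ((List.ofFn τ).take t) (τ t).1 = (τ t).2.1) := congrFun (congrFun h τ) t
      unfold actionProb
      split_ifs with h1 h2 h2
      · rfl
      · exact absurd (this.mp h1) h2
      · exact absurd (this.mpr h2) h1
      · rfl
    simp only [value, trajProb, contextProb, h']
  have hne : (Set.range c).Nonempty :=
    ⟨_, ⟨fun _ _ => Classical.arbitrary A, rfl⟩⟩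
  have hfin : (Set.range c).Finite := Set.toFinite _
  obtain ⟨_, ⟨π, rfl⟩, hπ⟩ := Set.exists_max_image (Set.range c)
    (fun q => 𝓜.value H (Function.invFun c q)) hfin hne
  have hinv : ∀ π, 𝓜.value H (Function.invFun c (c π)) = 𝓜.value H π := fun π =>
    hc _ _ (Function.invFun_eq ⟨π, rfl⟩)
  refine ⟨π, fun π' => ?_⟩
  have := hπ (c π') ⟨π', rfl⟩
  simpa only [hinv] using this

/-- The transition laws of two models and the laws of their single rewards and pairs of rewards
differ by at most `b` along every list of states and actions. -/
structure ModelClose (𝓜 𝓜' : RMMDP 2 S A R) (H : ℕ) (b : List (S × A) → ℝ) : Prop where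
  trans : ∀ l : List (S × A), l.length < H → ∑ s, |𝓜.nextProb l s - 𝓜'.nextProb l s| ≤ b l
  reward : ∀ l : List (S × A), l.length ≤ H → RewardClose (𝓜.rewProb 0) (𝓜.rewProb 1)
    (𝓜'.rewProb 0) (𝓜'.rewProb 1) l (b l)

/-- Total reward is at most H in absolute value, so values differ by at most H times the distance of
the trajectory laws. That distance splits into a reward part, from the mixture comparison, and a
transition part, from the simulation lemma. -/
theorem abs_value_sub_le [Nonempty A] (hw : ∀ m, 𝓜.weight m = 1 / 2)
    (hw' : ∀ m, 𝓜'.weight m = 1 / 2) (hR : ∀ z ∈ R, |z| ≤ 1) {b : List (S × A) → ℝ}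
    (hb : ∀ l, 0 ≤ b l) (hm : PrefixMono b) (hc : ModelClose 𝓜 𝓜' H b)
    (hHR : 1 ≤ (H : ℝ) * R.card) (π : Policy S A R) :
    |𝓜.value H π - 𝓜'.value H π| ≤
      201 * (H : ℝ) ^ 2 * (H * R.card : ℝ) ^ 6 * optVal 𝓜.nextProb b H [] := by
  have hP := 𝓜.isTransition_nextProb
  have hP' := 𝓜'.isTransition_nextProb
  have hF' := 𝓜'.isRewardLaw_episodeProb
  set V := optVal 𝓜.nextProb b H [] with hV
  have hV0 : 0 ≤ V := optVal_nonneg hP.nonneg hb _ _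
  have h1 := listSum_abs_mixProb_sub_le hP (𝓜.isRewardKernel_rewProb 0)
    (𝓜.isRewardKernel_rewProb 1) (𝓜'.isRewardKernel_rewProb 0) (𝓜'.isRewardKernel_rewProb 1)
    hb hm hc.reward π hHR
  have h2 := listSum_abs_planWeight_sub_le hP hP' (hF'.isCausal H) π H le_rfl
  have h3 : ∀ j ∈ Finset.range H, listSum j (fun h => planWeight 𝓜.nextProb π h *
      (𝓜'.episodeProb h * ∑ s, |𝓜.nextProb (saList h) s - 𝓜'.nextProb (saList h) s|)) ≤ V := by
    intro j hj
    have hj' : j < H := Finset.mem_range.1 hj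
    have := listSum_planWeight_le hP hb hm (hF'.isCausal H) π hj'.le
    rw [hF'.nil, one_mul] at this
    refine le_trans (listSum_mono fun h hh => ?_) this
    exact mul_le_mul_of_nonneg_left (mul_le_mul_of_nonneg_left
      (hc.trans (saList h) (by simp [hh, hj'])) (hF'.nonneg h)) (planWeight_nonneg hP.nonneg π h)
  have h4 := h2.trans (Finset.sum_le_sum h3)
  simp only [Finset.sum_const, Finset.card_range, nsmul_eq_mul] at h4
  rw [value_eq hw, value_eq hw']
  calc _ ≤ listSum H (fun h => H * (planWeight 𝓜.nextProb π h *
          |𝓜.episodeProb h - 𝓜'.episodeProb h| +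
          |planWeight 𝓜.nextProb π h - planWeight 𝓜'.nextProb π h| * 𝓜'.episodeProb h)) := by
        unfold listSum
        rw [← Finset.sum_sub_distrib]
        refine (Finset.abs_sum_le_sum_abs _ _).trans (Finset.sum_le_sum fun τ _ => ?_)
        have hr := abs_totalReward_le hR (List.ofFn τ)
        rw [List.length_ofFn] at hr
        have hW := planWeight_nonneg hP.nonneg π (List.ofFn τ)
        have hE := hF'.nonneg (List.ofFn τ)
        beta_reduce
        rw [← mul_assoc, ← mul_assoc, ← sub_mul, abs_mul, mul_comm]
        refine mul_le_mul hr ?_ (abs_nonneg _) (Nat.cast_nonneg H)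
        set W := planWeight 𝓜.nextProb π (List.ofFn τ)
        set W' := planWeight 𝓜'.nextProb π (List.ofFn τ)
        set E := 𝓜.episodeProb (List.ofFn τ)
        set E' := 𝓜'.episodeProb (List.ofFn τ)
        calc _ = |W * (E - E') + (W - W') * E'| := by congr 1; ring
          _ ≤ |W * (E - E')| + |(W - W') * E'| := abs_add_le _ _
          _ = _ := by rw [abs_mul, abs_mul, abs_of_nonneg hW, abs_of_nonneg hE]
    _ ≤ H * (200 * (H * R.card : ℝ) ^ 6 * V * H + H * V) := by
        rw [listSum_mul_left, listSum_add]
        refine mul_le_mul_of_nonneg_left (add_le_add h1 h4) (Nat.cast_nonneg H)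
    _ ≤ _ := by
        have : (H : ℝ) ^ 2 * 1 * V ≤ (H : ℝ) ^ 2 * (H * R.card : ℝ) ^ 6 * V := by
          gcongr
          exact one_le_pow₀ hHR
        linarith

end Model

/-! ### Marginals of product laws -/

section ProductSums

variable {n : ℕ} {ρ : Type*} [Fintype ρ] {g : Fin n → ρ → ℝ}

theorem sum_prod_mul_prod (g f : Fin n → ρ → ℝ) :
    ∑ z : Fin n → ρ, (∏ t, g t (z t)) * ∏ t, f t (z t) = ∏ t, ∑ r, g t r * f t r := by
  classical
  rw [Finset.prod_univ_sum, Fintype.piFinset_univ]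
  exact Finset.sum_congr rfl fun z _ => Finset.prod_mul_distrib.symm

theorem sum_prod_eq_one (hg : ∀ t, ∑ r, g t r = 1) :
    ∑ z : Fin n → ρ, ∏ t, g t (z t) = 1 := by
  have := sum_prod_mul_prod g (fun _ _ => 1)
  simpa [hg] using this

theorem sum_prod_mul_one (hg : ∀ t, ∑ r, g t r = 1) (i : Fin n) (f : ρ → ℝ) :
    ∑ z : Fin n → ρ, (∏ t, g t (z t)) * f (z i) = ∑ r, g i r * f r := by
  classical
  have h := sum_prod_mul_prod g (fun t r => if t = i then f r else 1)
  have e1 : ∀ z : Fin n → ρ, ∏ t, (if t = i then f (z t) else 1) = f (z i) := fun z => by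
    rw [Finset.prod_ite_eq' Finset.univ i (fun t => f (z t))]; simp
  simp only [e1] at h
  rw [h, Finset.prod_eq_single i]
  · simp
  · intro t _ ht
    simp [ht, hg]
  · simp

theorem sum_prod_mul_two (hg : ∀ t, ∑ r, g t r = 1) {i j : Fin n} (hij : i ≠ j) (f f' : ρ → ℝ) :
    ∑ z : Fin n → ρ, (∏ t, g t (z t)) * (f (z i) * f' (z j)) =
      (∑ r, g i r * f r) * ∑ r, g j r * f' r := by
  classical
  have h := sum_prod_mul_prod g
    (fun t r => (if t = i then f r else 1) * (if t = j then f' r else 1))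
  have e1 : ∀ z : Fin n → ρ, ∏ t, ((if t = i then f (z t) else 1) *
      (if t = j then f' (z t) else 1)) = f (z i) * f' (z j) := fun z => by
    rw [Finset.prod_mul_distrib, Finset.prod_ite_eq' Finset.univ i (fun t => f (z t)),
      Finset.prod_ite_eq' Finset.univ j (fun t => f' (z t))]
    simp
  simp only [e1] at h
  rw [h, ← Finset.mul_prod_erase Finset.univ _ (Finset.mem_univ i),
    ← Finset.mul_prod_erase (Finset.univ.erase i) _
      (Finset.mem_erase.2 ⟨hij.symm, Finset.mem_univ j⟩), Finset.prod_eq_one]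
  · simp [hij, hij.symm]
  · intro t ht
    simp only [Finset.mem_erase, Finset.mem_univ, and_true] at ht
    simp [ht.1, ht.2, hg]

end ProductSums

/-! ### Unbiasedness of observed rewards and transitions -/

section Observations

variable {S A : Type*} {R : Finset ℝ} {H : ℕ}

/-- The states and actions of a trajectory. -/
def saTraj (τ : Trajectory S A R H) : List (S × A) := saList (List.ofFn τ)

theorem saTraj_eq (τ : Trajectory S A R H) :
    saTraj τ = List.ofFn fun t => ((τ t).1, (τ t).2.1) := by
  rw [saTraj, saList, List.map_ofFn]; rfl

open Classical in
/-- Probability of the states and actions under a policy that ignores the rewards. -/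
noncomputable def saWeight (P : List (S × A) → S → ℝ) (ψ : List (S × A) → S → A) :
    List (S × A) → ℝ := pathProd fun l x => P l x.1 * if ψ l x.1 = x.2 then 1 else 0

theorem planWeight_eq_saWeight (P : List (S × A) → S → ℝ) (ψ : List (S × A) → S → A)
    (h : List (Step S A R)) :
    planWeight P (fun h => ψ (saList h)) h = saWeight P ψ (saList h) := by
  induction h using List.reverseRecOn with
  | nil => simp [saWeight]
  | append_singleton h x ih =>
    rw [planWeight_concat, ih, saList_concat, saWeight, pathProd_concat]
    rfl

/-- A trajectory consists of its states and actions and of its rewards. -/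
def trajEquiv : Trajectory S A R H ≃ (Fin H → S × A) × (Fin H → R) where
  toFun τ := (fun t => ((τ t).1, (τ t).2.1), fun t => (τ t).2.2)
  invFun p t := ((p.1 t).1, (p.1 t).2, p.2 t)
  left_inv _ := rfl
  right_inv _ := rfl

/-- Events about a single state-action pair: the sure event, or a given pair at a given time. -/
abbrev Site (S A : Type*) (H : ℕ) := Option (Fin H × S × A)

open Classical in
/-- Indicator of the event of a site. -/
noncomputable def siteInd : Site S A H → List (S × A) → ℝ
  | none, _ => 1
  | some (t, x), l => if l[(t : ℕ)]? = some x then 1 else 0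

/-- The time of the transition out of a site. -/
def siteNext : Site S A H → ℕ
  | none => 0
  | some (t, _) => t + 1

theorem siteInd_take (o : Site S A H) (l : List (S × A)) {n : ℕ} (hn : siteNext o ≤ n) :
    siteInd o (l.take n) = siteInd o l := by
  rcases o with _ | ⟨t, x⟩
  · rfl
  · have : (t : ℕ) < n := hn
    have h : (l.take n)[(t : ℕ)]? = l[(t : ℕ)]? := by rw [List.getElem?_take, if_pos this]
    rw [siteInd, siteInd, h]

variable [Fintype S] {𝓜 : RMMDP 2 S A R}

/-- The law of the next state after a site. -/
def siteLaw (𝓜 : RMMDP 2 S A R) : Site S A H → S → ℝ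
  | none => 𝓜.init
  | some (_, x) => 𝓜.trans x.1 x.2

theorem nextProb_eq_siteLaw {o : Site S A H} {l : List (S × A)} (hl : l.length = siteNext o)
    (ho : siteInd o l ≠ 0) (s : S) : 𝓜.nextProb l s = siteLaw 𝓜 o s := by
  rcases o with _ | ⟨t, x⟩
  · rw [List.eq_nil_of_length_eq_zero hl]
    rfl
  · have h1 : l[(t : ℕ)]? = some x := by
      by_contra h
      exact ho (by simp [siteInd, h])
    have h2 : l.getLast? = some x := by
      rw [List.getLast?_eq_getElem?, hl, ← h1]
      rfl
    simp only [nextProb, h2, siteLaw]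

variable [Fintype A]

/-- A function of the rewards, centred given the states and actions wherever `G` does not vanish,
is centred under every policy that ignores the rewards. -/
theorem sum_trajProb_reward_eq_zero (hw : ∀ m, 𝓜.weight m = 1 / 2) (ψ : List (S × A) → S → A)
    (G : List (S × A) → ℝ) (f : (Fin H → R) → ℝ) (c : ℝ)
    (hf : ∀ l : Fin H → S × A, G (List.ofFn l) ≠ 0 →
      (∑ z : Fin H → R, (∏ t, 𝓜.rewProb 0 ((l t).1, (l t).2, z t)) * f z) / 2 +
      (∑ z : Fin H → R, (∏ t, 𝓜.rewProb 1 ((l t).1, (l t).2, z t)) * f z) / 2 = c) :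
    ∑ τ : Trajectory S A R H, 𝓜.trajProb (fun h => ψ (saList h)) τ *
      (G (saTraj τ) * (f (fun t => (τ t).2.2) - c)) = 0 := by
  -- Because ψ ignores rewards, the weight of states and actions factors out, and given them the
  -- rewards follow the mixture of two product laws. A reward-dependent choice of actions could bias
  -- this conditional law.
  rw [← trajEquiv.symm.sum_comp, Fintype.sum_prod_type]
  refine Finset.sum_eq_zero fun l _ => ?_
  have e : ∀ z : Fin H → R, 𝓜.trajProb (fun h => ψ (saList h)) (trajEquiv.symm (l, z)) *
      (G (saTraj (trajEquiv.symm (l, z))) *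
        (f (fun t => (trajEquiv.symm (l, z) t).2.2) - c)) =
      saWeight 𝓜.nextProb ψ (List.ofFn l) * G (List.ofFn l) *
        (((∏ t, 𝓜.rewProb 0 ((l t).1, (l t).2, z t)) * f z) / 2 +
          ((∏ t, 𝓜.rewProb 1 ((l t).1, (l t).2, z t)) * f z) / 2 -
          c * ((∏ t, 𝓜.rewProb 0 ((l t).1, (l t).2, z t)) / 2 +
            (∏ t, 𝓜.rewProb 1 ((l t).1, (l t).2, z t)) / 2)) := by
    intro z
    have e1 : saTraj (trajEquiv.symm (l, z)) = List.ofFn l := saTraj_eq _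
    rw [trajProb_eq hw, planWeight_eq_saWeight]
    change saWeight _ _ (saTraj (trajEquiv.symm (l, z))) * _ * _ = _
    rw [e1, episodeProb, mixProb, listProd, listProd, List.map_ofFn, List.map_ofFn,
      List.prod_ofFn, List.prod_ofFn]
    have e2 : ∀ m t, (𝓜.rewProb m ∘ (trajEquiv.symm (l, z))) t =
        𝓜.rewProb m ((l t).1, (l t).2, z t) := fun m t => rfl
    have e3 : (fun t => (trajEquiv.symm (l, z) t).2.2) = z := rfl
    simp only [e2, e3]
    ring
  simp only [e]
  rw [← Finset.mul_sum]
  by_cases hG : G (List.ofFn l) = 0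
  · simp [hG]
  · rw [Finset.sum_sub_distrib, Finset.sum_add_distrib, ← Finset.mul_sum,
      Finset.sum_add_distrib, ← Finset.sum_div, ← Finset.sum_div, ← Finset.sum_div,
      ← Finset.sum_div, hf l hG,
      sum_prod_eq_one (fun t => (𝓜.isRewardKernel_rewProb 0).sum_eq _ _),
      sum_prod_eq_one (fun t => (𝓜.isRewardKernel_rewProb 1).sum_eq _ _)]
    ring

/-- Transitions are common to both contexts, so the next state carries no information about the
context; here any policy is allowed. -/
theorem sum_trajProb_state_eq_zero (hw : ∀ m, 𝓜.weight m = 1 / 2) (π : Policy S A R)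
    (o : Site S A H) (ho : siteNext o < H) (σ : S → ℝ) :
    ∑ τ : Trajectory S A R H, 𝓜.trajProb π τ *
      (siteInd o (saTraj τ) * (σ (τ ⟨siteNext o, ho⟩).1 - ∑ s, σ s * siteLaw 𝓜 o s)) = 0 := by
  set c := ∑ s, σ s * siteLaw 𝓜 o s with hc
  set t := siteNext o with ht
  -- Only the first t + 1 steps matter. `G` is used on lists of length t + 1, where the default
  -- value 0 is never reached.
  let G : List (Step S A R) → ℝ := fun k => siteInd o (saList (k.take t)) *
    ((match k[t]? with
      | some x => σ x.1
      | none => 0) - c)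
  have e1 : ∀ τ : Trajectory S A R H, siteInd o (saTraj τ) * (σ (τ ⟨t, ho⟩).1 - c) =
      G ((List.ofFn τ).take (t + 1)) := by
    intro τ
    simp only [G]
    rw [List.take_take, min_eq_left (Nat.le_succ t), List.getElem?_take,
      if_pos (Nat.lt_succ_self t), List.getElem?_ofFn, dif_pos ho]
    have : saList ((List.ofFn τ).take t) = (saTraj τ).take t := by simp [saList, saTraj]
    rw [this, siteInd_take o _ le_rfl]
  refine (Finset.sum_congr rfl fun τ _ => congrArg (𝓜.trajProb π τ * ·) (e1 τ)).trans ?_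
  rw [sum_trajProb_mul hw π (fun h => G (h.take (t + 1))),
    listSum_planWeight_take 𝓜.isTransition_nextProb 𝓜.isRewardLaw_episodeProb π G ho,
    listSum_succ_planWeight]
  refine (listSum_congr fun h hh => ?_).trans (by simp [listSum] : listSum t (fun _ => (0 : ℝ)) = 0)
  have e2 : ∀ x, G (h ++ [x]) = siteInd o (saList h) * (σ x.1 - c) := by
    intro x
    simp only [G]
    rw [List.take_append_of_le_length hh.ge, List.take_of_length_le hh.le,
      List.getElem?_append_right hh.le, hh, Nat.sub_self]
    rfl
  simp only [e2]
  simp_rw [← Finset.sum_mul, 𝓜.isRewardLaw_episodeProb.step]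
  by_cases hz : siteInd o (saList h) = 0
  · simp [hz]
  · have e3 : ∑ s, 𝓜.nextProb (saList h) s *
        (𝓜.episodeProb h * (siteInd o (saList h) * (σ s - c))) =
        𝓜.episodeProb h * siteInd o (saList h) *
          (∑ s, σ s * 𝓜.nextProb (saList h) s - c * ∑ s, 𝓜.nextProb (saList h) s) := by
      rw [Finset.mul_sum, ← Finset.sum_sub_distrib, Finset.mul_sum]
      exact Finset.sum_congr rfl fun s _ => by ring
    rw [e3, 𝓜.isTransition_nextProb.sum_eq]
    simp only [nextProb_eq_siteLaw (𝓜 := 𝓜) (by simp [hh, ht] : (saList h).length = siteNext o) hz,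
      ← hc]
    ring

end Observations

/-! ### Tests of a model and their expected values -/

section Tests

variable {S A : Type*} {R : Finset ℝ} {H : ℕ}

open Classical in
theorem siteInd_some (t : Fin H) (x : S × A) (l : List (S × A)) :
    siteInd (some (t, x)) l = if l[(t : ℕ)]? = some x then 1 else 0 := rfl

theorem siteInd_some_eq_one {l : List (S × A)} {i : Fin H} {x : S × A}
    (h : l[(i : ℕ)]? = some x) : siteInd (some (i, x)) l = 1 := if_pos h

/-- Events that are counted: single sites and pairs of state-action pairs at given times. -/
abbrev Index (S A : Type*) (H : ℕ) := Site S A H ⊕ (Fin H × S × A) × (Fin H × S × A)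

/-- Indicator of a counted event. -/
noncomputable def eventInd : Index S A H → List (S × A) → ℝ
  | .inl o, l => siteInd o l
  | .inr (p, q), l => siteInd (some p) l * siteInd (some q) l

theorem siteInd_eq_zero_or_one (o : Site S A H) (l : List (S × A)) :
    siteInd o l = 0 ∨ siteInd o l = 1 := by
  rcases o with _ | ⟨t, x⟩
  · exact Or.inr rfl
  · rw [siteInd_some]
    split_ifs <;> simp

theorem eventInd_eq_zero_or_one (i : Index S A H) (l : List (S × A)) :
    eventInd i l = 0 ∨ eventInd i l = 1 := by
  rcases i with o | ⟨p, q⟩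
  · exact siteInd_eq_zero_or_one o l
  · rcases siteInd_eq_zero_or_one (some p) l with h | h <;>
      rcases siteInd_eq_zero_or_one (some q) l with h' | h' <;> simp [eventInd, h, h']

theorem eventInd_nonneg (i : Index S A H) (l : List (S × A)) : 0 ≤ eventInd i l := by
  rcases eventInd_eq_zero_or_one i l with h | h <;> simp [h]

theorem siteInd_nonneg (o : Site S A H) (l : List (S × A)) : 0 ≤ siteInd o l := by
  rcases siteInd_eq_zero_or_one o l with h | h <;> simp [h]

theorem prefixMono_siteInd (o : Site S A H) : PrefixMono (siteInd o) := by
  intro l x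
  rcases o with _ | ⟨t, y⟩
  · exact le_rfl
  · rw [siteInd_some, siteInd_some]
    split_ifs with h1 h2
    · exact le_rfl
    · refine absurd ?_ h2
      rw [List.getElem?_append_left (List.getElem?_eq_some_iff.1 h1).1, h1]
    · exact zero_le_one
    · exact le_rfl

theorem prefixMono_eventInd (i : Index S A H) : PrefixMono (eventInd i) := by
  intro l x
  rcases i with o | ⟨p, q⟩
  · exact prefixMono_siteInd o l x
  · exact mul_le_mul (prefixMono_siteInd _ l x) (prefixMono_siteInd _ l x) (siteInd_nonneg _ _)
      (siteInd_nonneg _ _)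

/-- Exponent in the tail bound for the tests of an event. -/
noncomputable def exponent [Fintype S] (L : ℝ) : Index S A H → ℝ
  | .inl _ => Fintype.card S * L
  | .inr _ => L

theorem le_exponent [Fintype S] [Nonempty S] {L : ℝ} (hL : 0 ≤ L) (i : Index S A H) :
    L ≤ exponent L i := by
  rcases i with o | pq
  · exact le_mul_of_one_le_left hL (by exact_mod_cast Fintype.card_pos)
  · exact le_rfl

/-- Sign of a Boolean. -/
def boolSign (c : Bool) : ℝ := if c then 1 else -1

theorem boolSign_not (c : Bool) : boolSign (!c) = -boolSign c := by cases c <;> simp [boolSign]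

theorem abs_boolSign (c : Bool) : |boolSign c| = 1 := by cases c <;> simp [boolSign]

/-- Tests of a model: signed sums of transition probabilities, single rewards with a sign, pairs
of rewards with a sign. -/
abbrev Test (S A : Type*) (R : Finset ℝ) (H : ℕ) :=
  (Site S A H × (S → Bool)) ⊕ ((Fin H × S × A) × R × Bool) ⊕
    ((Fin H × S × A) × (Fin H × S × A) × R × R × Bool)

/-- The event on which a test is made. -/
def testIndex : Test S A R H → Index S A H
  | .inl (o, _) => .inl o
  | .inr (.inl (p, _, _)) => .inl (some p)
  | .inr (.inr (p, q, _, _, _)) => .inr (p, q)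

open Classical in
/-- The observed value of a test. -/
noncomputable def testObs : Test S A R H → Trajectory S A R H → ℝ
  | .inl (o, σ), τ => if h : siteNext o < H then boolSign (σ (τ ⟨siteNext o, h⟩).1) else 0
  | .inr (.inl (p, r, c)), τ => boolSign c * if (τ p.1).2.2 = r then 1 else 0
  | .inr (.inr (p, q, r, r', c)), τ =>
    if p.1 = q.1 then 0 else
      boolSign c * ((if (τ p.1).2.2 = r then 1 else 0) * if (τ q.1).2.2 = r' then 1 else 0)

/-- The test with the opposite sign. -/
def testFlip : Test S A R H → Test S A R H
  | .inl (o, σ) => .inl (o, fun s => !σ s)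
  | .inr (.inl (p, r, c)) => .inr (.inl (p, r, !c))
  | .inr (.inr (p, q, r, r', c)) => .inr (.inr (p, q, r, r', !c))

theorem testIndex_flip (j : Test S A R H) : testIndex (testFlip j) = testIndex j := by
  rcases j with ⟨o, σ⟩ | ⟨p, r, c⟩ | ⟨p, q, r, r', c⟩ <;> rfl

theorem testObs_flip (j : Test S A R H) (τ : Trajectory S A R H) :
    testObs (testFlip j) τ = -testObs j τ := by
  rcases j with ⟨o, σ⟩ | ⟨p, r, c⟩ | ⟨p, q, r, r', c⟩
  · simp only [testFlip, testObs, boolSign_not]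
    split_ifs <;> simp
  · simp only [testFlip, testObs, boolSign_not]
    ring
  · simp only [testFlip, testObs, boolSign_not]
    split_ifs <;> simp

theorem abs_testObs_le (j : Test S A R H) (τ : Trajectory S A R H) : |testObs j τ| ≤ 1 := by
  rcases j with ⟨o, σ⟩ | ⟨p, r, c⟩ | ⟨p, q, r, r', c⟩
  · simp only [testObs]
    split_ifs
    · rw [abs_boolSign]
    · simp
  · simp only [testObs, abs_mul, abs_boolSign]
    split_ifs <;> simp
  · simp only [testObs]
    split_ifs <;> simp [abs_boolSign]

variable [Fintype S]

/-- The expected value of a test in a model. -/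
noncomputable def testMean (𝓜 : RMMDP 2 S A R) : Test S A R H → ℝ
  | .inl (o, σ) => if siteNext o < H then ∑ s, boolSign (σ s) * siteLaw 𝓜 o s else 0
  | .inr (.inl (p, r, c)) => boolSign c * avg (𝓜.rewProb 0) (𝓜.rewProb 1) (p.2.1, p.2.2, r)
  | .inr (.inr (p, q, r, r', c)) =>
    if p.1 = q.1 then 0 else boolSign c *
      pairProb (𝓜.rewProb 0) (𝓜.rewProb 1) (p.2.1, p.2.2, r) (q.2.1, q.2.2, r')

theorem testMean_flip (𝓜 : RMMDP 2 S A R) (j : Test S A R H) :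
    testMean 𝓜 (testFlip j) = -testMean 𝓜 j := by
  rcases j with ⟨o, σ⟩ | ⟨p, r, c⟩ | ⟨p, q, r, r', c⟩
  · simp only [testFlip, testMean, boolSign_not]
    split_ifs <;> simp
  · simp only [testFlip, testMean, boolSign_not]
    ring
  · simp only [testFlip, testMean, boolSign_not]
    split_ifs <;> simp

theorem siteLaw_mem (𝓜 : RMMDP 2 S A R) (o : Site S A H) : siteLaw 𝓜 o ∈ stdSimplex ℝ S := by
  rcases o with _ | ⟨t, x⟩
  · exact 𝓜.init_mem
  · exact 𝓜.trans_mem _ _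

theorem abs_testMean_le (𝓜 : RMMDP 2 S A R) (j : Test S A R H) : |testMean 𝓜 j| ≤ 1 := by
  have h0 := 𝓜.isRewardKernel_rewProb 0
  have h1 := 𝓜.isRewardKernel_rewProb 1
  rcases j with ⟨o, σ⟩ | ⟨p, r, c⟩ | ⟨p, q, r, r', c⟩
  · simp only [testMean]
    split_ifs
    · rw [← (siteLaw_mem 𝓜 o).2]
      refine (Finset.abs_sum_le_sum_abs _ _).trans (Finset.sum_le_sum fun s _ => ?_)
      rw [abs_mul, abs_boolSign, one_mul, abs_of_nonneg ((siteLaw_mem 𝓜 o).1 s)]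
    · simp
  · simp only [testMean, abs_mul, abs_boolSign, one_mul]
    rw [abs_of_nonneg ((h0.avg h1).nonneg _)]
    exact (h0.avg h1).le_one _
  · simp only [testMean]
    split_ifs
    · simp
    · simp only [abs_mul, abs_boolSign, one_mul, pairProb]
      have a1 := mul_nonneg (h0.nonneg (p.2.1, p.2.2, r)) (h0.nonneg (q.2.1, q.2.2, r'))
      have a2 := mul_nonneg (h1.nonneg (p.2.1, p.2.2, r)) (h1.nonneg (q.2.1, q.2.2, r'))
      have a3 := mul_le_one₀ (h0.le_one (p.2.1, p.2.2, r)) (h0.nonneg (q.2.1, q.2.2, r'))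
        (h0.le_one (q.2.1, q.2.2, r'))
      have a4 := mul_le_one₀ (h1.le_one (p.2.1, p.2.2, r)) (h1.nonneg (q.2.1, q.2.2, r'))
        (h1.le_one (q.2.1, q.2.2, r'))
      rw [abs_le]
      constructor <;> linarith

/-- Every test is centred under every policy that ignores the rewards. -/
theorem sum_trajProb_test_eq_zero [Fintype A] {𝓜 : RMMDP 2 S A R}
    (hw : ∀ m, 𝓜.weight m = 1 / 2) (ψ : List (S × A) → S → A) (j : Test S A R H) :
    ∑ τ : Trajectory S A R H, 𝓜.trajProb (fun h => ψ (saList h)) τ *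
      (eventInd (testIndex j) (saTraj τ) * (testObs j τ - testMean 𝓜 j)) = 0 := by
  classical
  have h0 := 𝓜.isRewardKernel_rewProb 0
  have h1 := 𝓜.isRewardKernel_rewProb 1
  have site : ∀ (p : Fin H × S × A) (l : Fin H → S × A), siteInd (some p) (List.ofFn l) ≠ 0 →
      l p.1 = p.2 := by
    intro p l h
    by_contra hne
    refine h ?_
    have : (List.ofFn l)[(p.1 : ℕ)]? ≠ some p.2 := by simpa using hne
    exact if_neg this
  rcases j with ⟨o, σ⟩ | ⟨p, r, c⟩ | ⟨p, q, r, r', c⟩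
  · by_cases ho : siteNext o < H
    · simp only [testObs, testMean, dif_pos ho, if_pos ho]
      exact sum_trajProb_state_eq_zero hw _ o ho (fun s => boolSign (σ s))
    · simp [testObs, testMean, ho]
  · refine sum_trajProb_reward_eq_zero hw ψ (siteInd (some p))
      (fun z => boolSign c * if z p.1 = r then 1 else 0) _ fun l hl => ?_
    have hl' := site p l hl
    rw [sum_prod_mul_one (g := fun t r => 𝓜.rewProb 0 ((l t).1, (l t).2, r))
        (fun t => h0.sum_eq _ _) p.1 (fun z => boolSign c * if z = r then 1 else 0),
      sum_prod_mul_one (g := fun t r => 𝓜.rewProb 1 ((l t).1, (l t).2, r))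
        (fun t => h1.sum_eq _ _) p.1 (fun z => boolSign c * if z = r then 1 else 0), hl']
    simp only [mul_ite, mul_one, mul_zero, Finset.sum_ite_eq', Finset.mem_univ, if_true, testMean,
      avg]
    ring
  · by_cases hpq : p.1 = q.1
    · simp [testObs, testMean, hpq]
    · simp only [testObs, testMean, if_neg hpq]
      refine sum_trajProb_reward_eq_zero hw ψ (eventInd (.inr (p, q)))
        (fun z => boolSign c * ((if z p.1 = r then 1 else 0) * if z q.1 = r' then 1 else 0)) _
        fun l hl => ?_
      have hp := site p l (left_ne_zero_of_mul hl)
      have hq := site q l (right_ne_zero_of_mul hl)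
      simp only [← mul_assoc (boolSign c)]
      rw [sum_prod_mul_two (g := fun t r => 𝓜.rewProb 0 ((l t).1, (l t).2, r))
          (fun t => h0.sum_eq _ _) hpq (fun z => boolSign c * if z = r then 1 else 0)
          (fun z => if z = r' then 1 else 0),
        sum_prod_mul_two (g := fun t r => 𝓜.rewProb 1 ((l t).1, (l t).2, r))
          (fun t => h1.sum_eq _ _) hpq (fun z => boolSign c * if z = r then 1 else 0)
          (fun z => if z = r' then 1 else 0), hp, hq]
      simp only [mul_ite, mul_one, mul_zero, Finset.sum_ite_eq', Finset.mem_univ, if_true, pairProb]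
      ring

end Tests

/-! ### Confidence sets, widths and bonuses -/

section Confidence

variable {S A : Type*} {R : Finset ℝ} {H : ℕ}

/-- The number of trajectories in which an event occurs. -/
noncomputable def count (D : List (Trajectory S A R H)) (i : Index S A H) : ℝ :=
  (D.map fun τ => eventInd i (saTraj τ)).sum

@[simp] theorem count_nil (i : Index S A H) : count ([] : List (Trajectory S A R H)) i = 0 := rfl

@[simp] theorem count_append (D D' : List (Trajectory S A R H)) (i : Index S A H) :
    count (D ++ D') i = count D i + count D' i := by simp [count]

theorem count_singleton (τ : Trajectory S A R H) (i : Index S A H) :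
    count [τ] i = eventInd i (saTraj τ) := by simp [count]

theorem count_nonneg (D : List (Trajectory S A R H)) (i : Index S A H) : 0 ≤ count D i := by
  refine List.sum_nonneg fun a ha => ?_
  obtain ⟨τ, _, rfl⟩ := List.mem_map.1 ha
  exact eventInd_nonneg _ _

theorem count_eq_pathSum (D : List (Trajectory S A R H)) (i : Index S A H) :
    count D i = pathSum (fun _ τ => eventInd i (saTraj τ)) D := (pathSum_const _ _).symm

theorem count_eq_nat (D : List (Trajectory S A R H)) (i : Index S A H) :
    ∃ n : ℕ, count D i = n := by
  obtain ⟨k, hk, _⟩ := pathSum_indicator_eq_nat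
    (φ := fun (_ : List (Trajectory S A R H)) τ => eventInd i (saTraj τ))
    (fun _ τ => eventInd_eq_zero_or_one i _) (fun _ _ => 0) D
  exact ⟨k, by rw [count_eq_pathSum, hk]⟩

/-- Total deviation of a test from the value `c` in the data. -/
noncomputable def testDev (D : List (Trajectory S A R H)) (j : Test S A R H) (c : ℝ) : ℝ :=
  (D.map fun τ => eventInd (testIndex j) (saTraj τ) * (testObs j τ - c)).sum

theorem testDev_eq_pathSum (D : List (Trajectory S A R H)) (j : Test S A R H) (c : ℝ) :
    testDev D j c =
      pathSum (fun _ τ => eventInd (testIndex j) (saTraj τ) * (testObs j τ - c)) D :=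
  (pathSum_const _ _).symm

/-- The observations of a test and of its opposite cancel, leaving only the difference of the two
model means, multiplied by the count. -/
theorem testDev_add_flip (D : List (Trajectory S A R H)) (j : Test S A R H) (c c' : ℝ) :
    testDev D j c + testDev D (testFlip j) (-c') = count D (testIndex j) * (c' - c) := by
  induction D using List.reverseRecOn with
  | nil => simp [testDev]
  | append_singleton D τ ih =>
    have e : ∀ j c, testDev (D ++ [τ]) j c = testDev D j c +
        eventInd (testIndex j) (saTraj τ) * (testObs j τ - c) := fun j c => by simp [testDev]
    rw [e, e, count_append, count_singleton, testIndex_flip, testObs_flip]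
    linarith

/-- Width of the confidence interval of an event that has occurred `n` times. -/
noncomputable def width (v n : ℝ) : ℝ := min 1 (4 * √v / √(n + 1))

theorem width_nonneg (v n : ℝ) : 0 ≤ width v n := le_min zero_le_one (by positivity)

theorem width_le_one (v n : ℝ) : width v n ≤ 1 := min_le_left _ _

theorem width_anti {v n m : ℝ} (hn : 0 ≤ n) (hnm : n ≤ m) : width v m ≤ width v n := by
  refine min_le_min le_rfl ?_
  have : 0 < √(n + 1) := Real.sqrt_pos.2 (by linarith)
  gcongr

/-- Up to a constant, 1/√(n + 1) is at most √(n + 1) − √n, so widths telescope along the data. -/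
theorem mul_width_le {v n x : ℝ} (hn : 0 ≤ n) (hx : x = 0 ∨ x = 1) :
    x * width v n ≤ 8 * √v * (√(n + x) - √n) := by
  rcases hx with rfl | rfl
  · simp
  · rw [one_mul]
    refine (min_le_right _ _).trans ?_
    have h1 : 0 < √(n + 1) := Real.sqrt_pos.2 (by linarith)
    rw [div_le_iff₀ h1]
    have h2 : √n ≤ √(n + 1) := Real.sqrt_le_sqrt (by linarith)
    have h3 := Real.mul_self_sqrt hn
    have h4 := Real.mul_self_sqrt (show 0 ≤ n + 1 by linarith)
    have h5 : 1 / 2 ≤ (√(n + 1) - √n) * √(n + 1) := by nlinarith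
    calc 4 * √v = 8 * √v * (1 / 2) := by ring
      _ ≤ 8 * √v * ((√(n + 1) - √n) * √(n + 1)) := by gcongr
      _ = _ := by ring

variable [Fintype S]

/-- A balanced model that passes all tests on the data. -/
structure Consistent (L : ℝ) (𝓜 : RMMDP 2 S A R) (D : List (Trajectory S A R H)) : Prop where
  weight : ∀ m, 𝓜.weight m = 1 / 2
  test : ∀ j : Test S A R H, testDev D j (testMean 𝓜 j) ≤
    √(8 * count D (testIndex j) * exponent L (testIndex j))

/-- One model passes the test and the other its opposite; adding the two one-sided bounds eliminates
the data. -/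
theorem Consistent.testMean_sub_le [Nonempty S] {L : ℝ} (hL : 1 ≤ L) {𝓜 𝓜' : RMMDP 2 S A R}
    {D : List (Trajectory S A R H)} (h : Consistent L 𝓜 D) (h' : Consistent L 𝓜' D)
    (j : Test S A R H) :
    testMean 𝓜' j - testMean 𝓜 j ≤
      2 * width (exponent L (testIndex j)) (count D (testIndex j)) := by
  have h1 := h.test j
  have h2 := h'.test (testFlip j)
  have h3 := testDev_add_flip D j (testMean 𝓜 j) (testMean 𝓜' j)
  rw [testMean_flip, testIndex_flip] at h2
  have hv : 1 ≤ exponent L (testIndex j) := hL.trans (le_exponent (by linarith) _)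
  have ht : testMean 𝓜' j - testMean 𝓜 j ≤ 2 := by
    have := (abs_le.1 (abs_testMean_le 𝓜' j)).2
    have := (abs_le.1 (abs_testMean_le 𝓜 j)).1
    linarith
  obtain ⟨n, hn⟩ := count_eq_nat D (testIndex j)
  rw [hn] at h1 h2 h3 ⊢
  set v := exponent L (testIndex j)
  set x := testMean 𝓜' j - testMean 𝓜 j
  have hsv : 1 ≤ √v := Real.one_le_sqrt.2 hv
  unfold width
  rw [mul_min_of_nonneg _ _ zero_le_two]
  refine le_min (by linarith) ?_
  rcases Nat.eq_zero_or_pos n with rfl | hpos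
  · simp
    linarith
  · have hn1 : (1 : ℝ) ≤ n := by exact_mod_cast hpos
    have h4 : (n : ℝ) * x ≤ 2 * √(8 * n * v) := by linarith
    have hs : 0 < √((n : ℝ) + 1) := Real.sqrt_pos.2 (by linarith)
    rw [mul_div_assoc', le_div_iff₀ hs]
    -- For n ≥ 1 one has 8n(n + 1) ≤ 16n², which explains the 4 in `width`.
    have h5 : √(8 * n * v) * √((n : ℝ) + 1) ≤ 4 * √v * n := by
      rw [← Real.sqrt_mul (by positivity)]
      refine Real.sqrt_le_iff.2 ⟨by positivity, ?_⟩
      rw [mul_pow, mul_pow, Real.sq_sqrt (by linarith)]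
      nlinarith [mul_nonneg (mul_nonneg (by linarith : (0 : ℝ) ≤ v) (by linarith : (0 : ℝ) ≤ n))
        (by linarith : (0 : ℝ) ≤ n - 1)]
    have h6 : n * (x * √((n : ℝ) + 1)) ≤ n * (2 * (4 * √v)) := by
      calc n * (x * √((n : ℝ) + 1)) = n * x * √((n : ℝ) + 1) := by ring
        _ ≤ 2 * √(8 * n * v) * √((n : ℝ) + 1) := by gcongr
        _ ≤ _ := by linarith
    exact le_of_mul_le_mul_left h6 (by linarith)

variable [Fintype A]

/-- Sum of the widths of the confidence intervals of all events along a list. -/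
noncomputable def bonus (L : ℝ) (D : List (Trajectory S A R H)) (l : List (S × A)) : ℝ :=
  ∑ i : Index S A H, eventInd i l * width (exponent L i) (count D i)

theorem bonus_nonneg (L : ℝ) (D : List (Trajectory S A R H)) (l : List (S × A)) :
    0 ≤ bonus L D l :=
  Finset.sum_nonneg fun i _ => mul_nonneg (eventInd_nonneg i l) (width_nonneg _ _)

theorem prefixMono_bonus (L : ℝ) (D : List (Trajectory S A R H)) : PrefixMono (bonus L D) :=
  fun l x => Finset.sum_le_sum fun i _ =>
    mul_le_mul_of_nonneg_right (prefixMono_eventInd i l x) (width_nonneg _ _)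

theorem width_le_bonus {L : ℝ} {D : List (Trajectory S A R H)} {l : List (S × A)}
    {i : Index S A H} (hi : eventInd i l = 1) :
    width (exponent L i) (count D i) ≤ bonus L D l := by
  have := Finset.single_le_sum (f := fun i => eventInd i l * width (exponent L i) (count D i))
    (fun i _ => mul_nonneg (eventInd_nonneg i l) (width_nonneg _ _)) (Finset.mem_univ i)
  simp only [hi, one_mul] at this
  exact this

theorem bonus_append_le (L : ℝ) (D D' : List (Trajectory S A R H)) (l : List (S × A)) :
    bonus L (D ++ D') l ≤ bonus L D l := by
  refine Finset.sum_le_sum fun i _ => mul_le_mul_of_nonneg_left ?_ (eventInd_nonneg i l)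
  refine width_anti (count_nonneg _ _) ?_
  rw [count_append]
  linarith [count_nonneg D' i]

theorem sum_siteInd_le (l : List (S × A)) :
    ∑ p : Fin H × S × A, siteInd (some p) l ≤ H := by
  classical
  rw [Fintype.sum_prod_type]
  calc _ ≤ ∑ t : Fin H, (1 : ℝ) := by
        refine Finset.sum_le_sum fun t _ => ?_
        rcases h : l[(t : ℕ)]? with _ | y
        · simp [siteInd, h]
        · rw [Finset.sum_eq_single y]
          · rw [siteInd_some]; split_ifs <;> norm_num
          · intro x _ hx
            have : l[(t : ℕ)]? ≠ some x := by rw [h]; simpa using hx.symm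
            exact if_neg this
          · simp
    _ = H := by simp

theorem sum_pairInd_le (l : List (S × A)) :
    ∑ pq : (Fin H × S × A) × (Fin H × S × A), eventInd (.inr pq) l ≤ (H : ℝ) ^ 2 := by
  rw [Fintype.sum_prod_type]
  simp only [eventInd]
  rw [← Finset.sum_mul_sum, sq]
  exact mul_le_mul (sum_siteInd_le l) (sum_siteInd_le l)
    (Finset.sum_nonneg fun p _ => siteInd_nonneg _ _) (Nat.cast_nonneg H)

/-- A list triggers the sure event, at most H single sites and at most H² pairs. -/
theorem bonus_le (hH : 1 ≤ H) (L : ℝ) (D : List (Trajectory S A R H)) (l : List (S × A)) :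
    bonus L D l ≤ 3 * (H : ℝ) ^ 2 := by
  have hH' : (1 : ℝ) ≤ H := by exact_mod_cast hH
  calc bonus L D l ≤ ∑ i : Index S A H, eventInd i l :=
        Finset.sum_le_sum fun i _ => mul_le_of_le_one_right (eventInd_nonneg i l)
          (width_le_one _ _)
    _ = 1 + ∑ p : Fin H × S × A, siteInd (some p) l +
        ∑ pq : (Fin H × S × A) × (Fin H × S × A), eventInd (.inr pq) l := by
        rw [Fintype.sum_sum_type, Fintype.sum_option]
        rfl
    _ ≤ 1 + H + (H : ℝ) ^ 2 := add_le_add (add_le_add le_rfl (sum_siteInd_le l)) (sum_pairInd_le l)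
    _ ≤ 3 * (H : ℝ) ^ 2 := by nlinarith

/-- Two models that pass all tests on the same data are close. -/
theorem Consistent.modelClose [Nonempty S] {L : ℝ} (hL : 1 ≤ L) {𝓜 𝓜' : RMMDP 2 S A R}
    {D : List (Trajectory S A R H)} (h : Consistent L 𝓜 D) (h' : Consistent L 𝓜' D) :
    ModelClose 𝓜 𝓜' H (fun l => 2 * bonus L D l) := by
  have key : ∀ (j : Test S A R H) (l : List (S × A)), eventInd (testIndex j) l = 1 →
      testMean 𝓜 j - testMean 𝓜' j ≤ 2 * bonus L D l := fun j l hl =>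
    (h'.testMean_sub_le hL h j).trans (by have := width_le_bonus (L := L) (D := D) hl; linarith)
  refine ⟨fun l hl => ?_, fun l hl => ⟨fun i x hi r => ?_, fun i i' x y hii hi hi' r r' => ?_⟩⟩
  · obtain ⟨o, ho, hol⟩ : ∃ o : Site S A H, siteNext o = l.length ∧ siteInd o l = 1 := by
      rcases List.eq_nil_or_concat l with rfl | ⟨l, x, rfl⟩
      · exact ⟨none, rfl, rfl⟩
      · simp at hl
        exact ⟨some (⟨l.length, by omega⟩, x), by simp [siteNext], siteInd_some_eq_one (by simp)⟩
    have hne : siteInd o l ≠ 0 := by rw [hol]; exact one_ne_zero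
    classical
    -- The sign pattern that turns the signed sum into the ℓ¹ distance. It depends on both models,
    -- which is why all patterns are tested.
    let σ : S → Bool := fun s => decide (siteLaw 𝓜' o s ≤ siteLaw 𝓜 o s)
    refine le_trans (le_of_eq ?_) (key (.inl (o, σ)) l hol)
    have ho' : siteNext o < H := by omega
    simp only [testMean, if_pos ho']
    rw [← Finset.sum_sub_distrib]
    refine Finset.sum_congr rfl fun s _ => ?_
    rw [nextProb_eq_siteLaw ho.symm hne, nextProb_eq_siteLaw ho.symm hne, ← mul_sub]
    by_cases hs : siteLaw 𝓜' o s ≤ siteLaw 𝓜 o s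
    · simp only [σ, hs, boolSign, decide_true, if_true, one_mul]
      exact abs_of_nonneg (by linarith)
    · simp only [σ, hs, boolSign, decide_false]
      rw [abs_of_neg (by linarith)]
      simp
  · have hil : i < H := lt_of_lt_of_le (List.getElem?_eq_some_iff.1 hi).1 hl
    have hI := siteInd_some_eq_one (i := ⟨i, hil⟩) hi
    have k1 := key (.inr (.inl ((⟨i, hil⟩, x), r, true))) l hI
    have k2 := key (.inr (.inl ((⟨i, hil⟩, x), r, false))) l hI
    simp only [testMean, boolSign] at k1 k2
    rw [abs_le]
    constructor
    · simp at k2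
      linarith
    · simpa using k1
  · have hil : i < H := lt_of_lt_of_le (List.getElem?_eq_some_iff.1 hi).1 hl
    have hil' : i' < H := lt_of_lt_of_le (List.getElem?_eq_some_iff.1 hi').1 hl
    have hI : eventInd (.inr ((⟨i, hil⟩, x), (⟨i', hil'⟩, y))) l = 1 := by
      rw [eventInd, siteInd_some_eq_one (i := ⟨i, hil⟩) hi,
        siteInd_some_eq_one (i := ⟨i', hil'⟩) hi', one_mul]
    have k1 := key (.inr (.inr ((⟨i, hil⟩, x), (⟨i', hil'⟩, y), r, r', true))) l hI
    have k2 := key (.inr (.inr ((⟨i, hil⟩, x), (⟨i', hil'⟩, y), r, r', false))) l hI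
    simp only [testMean, boolSign, Fin.mk.injEq, hii, if_false] at k1 k2
    rw [abs_le]
    constructor
    · simp at k2
      linarith
    · simpa using k1

end Confidence

/-! ### Linearity and monotonicity of sums along histories -/

section PathSums

variable {X : Type*}

theorem pathSum_mono_of_prefix {f g : List X → X → ℝ} {D : List X}
    (h : ∀ D' x, D' ++ [x] <+: D → f D' x ≤ g D' x) : pathSum f D ≤ pathSum g D := by
  induction D using List.reverseRecOn with
  | nil => simp
  | append_singleton D x ih =>
    rw [pathSum_concat, pathSum_concat]
    exact add_le_add (ih fun D' x' h' => h D' x' (h'.trans (List.prefix_append _ _)))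
      (h D x List.prefix_rfl)

theorem pathSum_const_eq (c : ℝ) (D : List X) : pathSum (fun _ _ => c) D = D.length * c := by
  rw [pathSum_const]
  simp

theorem pathSum_add (f g : List X → X → ℝ) (D : List X) :
    pathSum (fun h x => f h x + g h x) D = pathSum f D + pathSum g D := by
  induction D using List.reverseRecOn with
  | nil => simp
  | append_singleton D x ih => simp only [pathSum_concat, ih]; ring

theorem pathSum_mul_left (c : ℝ) (f : List X → X → ℝ) (D : List X) :
    pathSum (fun h x => c * f h x) D = c * pathSum f D := by
  induction D using List.reverseRecOn with
  | nil => simp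
  | append_singleton D x ih => simp only [pathSum_concat, ih]; ring

end PathSums

/-! ### Total bonus collected over the episodes -/

section Counting

variable {S A : Type*} {R : Finset ℝ} {H : ℕ}

theorem sum_count_le {ι : Type*} [Fintype ι] (f : ι → Index S A H) {c : ℝ}
    (hf : ∀ l : List (S × A), ∑ i, eventInd (f i) l ≤ c) (D : List (Trajectory S A R H)) :
    ∑ i, count D (f i) ≤ D.length * c := by
  induction D using List.reverseRecOn with
  | nil => simp
  | append_singleton D τ ih =>
    simp only [count_append, count_singleton, Finset.sum_add_distrib]
    have := hf (saTraj τ)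
    simp only [List.length_append, List.length_singleton]
    push_cast
    linarith

variable [Fintype S] [Fintype A]

/-- Each bonus is computed before its trajectory is counted, so the widths of every event telescope
to the square root of its final count. -/
theorem pathSum_bonus_le (L : ℝ) (D : List (Trajectory S A R H)) :
    pathSum (fun D τ => bonus L D (saTraj τ)) D ≤
      ∑ i : Index S A H, 8 * √(exponent L i) * √(count D i) := by
  induction D using List.reverseRecOn with
  | nil => simp
  | append_singleton D τ ih =>
    rw [pathSum_concat]
    refine (add_le_add ih le_rfl).trans ?_
    rw [bonus, ← Finset.sum_add_distrib]
    refine Finset.sum_le_sum fun i _ => ?_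
    have := mul_width_le (v := exponent L i) (count_nonneg D i)
      (eventInd_eq_zero_or_one i (saTraj τ))
    rw [count_append, count_singleton]
    linarith

theorem sum_sqrt_le {ι : Type*} [Fintype ι] {f : ι → ℝ} (hf : ∀ i, 0 ≤ f i) {c : ℝ}
    (hc : ∑ i, f i ≤ c) : ∑ i, √(f i) ≤ √(Fintype.card ι * c) := by
  have := Real.sum_sqrt_mul_sqrt_le Finset.univ hf (fun _ => zero_le_one (α := ℝ))
  simp only [Real.sqrt_one, mul_one, Finset.sum_const, Finset.card_univ, nsmul_eq_mul] at this
  refine this.trans ?_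
  rw [← Real.sqrt_mul (Finset.sum_nonneg fun i _ => hf i), mul_comm]
  exact Real.sqrt_le_sqrt (mul_le_mul_of_nonneg_left hc (Nat.cast_nonneg _))

/-- Cauchy–Schwarz: the (HSA)² pairs occur at most KH² times in all, giving H²SA√(LK). The HSA sites
have the larger exponent SL but occur only KH times, so they and the sure event stay within the same
bound. Three such terms give 24. -/
theorem sum_sqrt_count_le [Nonempty S] [Nonempty A] (hH : 1 ≤ H) {L : ℝ} (hL : 0 ≤ L)
    (D : List (Trajectory S A R H)) :
    ∑ i : Index S A H, 8 * √(exponent L i) * √(count D i) ≤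
      24 * (H : ℝ) ^ 2 * (Fintype.card S * Fintype.card A) * √(L * D.length) := by
  have hS : (1 : ℝ) ≤ Fintype.card S := by exact_mod_cast Fintype.card_pos (α := S)
  have hA : (1 : ℝ) ≤ Fintype.card A := by exact_mod_cast Fintype.card_pos (α := A)
  have hH' : (1 : ℝ) ≤ H := by exact_mod_cast hH
  set s : ℝ := (Fintype.card S : ℝ)
  set a : ℝ := (Fintype.card A : ℝ)
  set h : ℝ := (H : ℝ)
  set K : ℝ := (D.length : ℝ) with hK
  have hK0 : 0 ≤ K := Nat.cast_nonneg _
  have c0 : count D (.inl none) = K := by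
    have : ∀ D : List (Trajectory S A R H), count D (.inl none) = D.length := by
      intro D
      simp [count, eventInd, siteInd]
    exact this D
  have c1 : ∑ p : Fin H × S × A, √(count D (.inl (some p))) ≤ √(h * s * a * (K * h)) := by
    refine (sum_sqrt_le (fun p => count_nonneg _ _)
      (sum_count_le (fun p => .inl (some p)) (fun l => sum_siteInd_le l) D)).trans_eq ?_
    simp only [Fintype.card_prod, Fintype.card_fin]
    push_cast
    congr 1
    ring
  have c2 : ∑ pq : (Fin H × S × A) × (Fin H × S × A), √(count D (.inr pq)) ≤
      √((h * s * a) ^ 2 * (K * h ^ 2)) := by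
    refine (sum_sqrt_le (fun p => count_nonneg _ _)
      (sum_count_le (fun p => .inr p) (fun l => sum_pairInd_le l) D)).trans_eq ?_
    simp only [Fintype.card_prod, Fintype.card_fin]
    push_cast
    congr 1
    ring
  have bound : ∀ {x}, 0 ≤ x → x ≤ (h ^ 2 * (s * a)) ^ 2 →
      √(x * (L * K)) ≤ h ^ 2 * (s * a) * √(L * K) := by
    intro x hx hxs
    rw [Real.sqrt_mul hx]
    exact mul_le_mul_of_nonneg_right (Real.sqrt_le_iff.2 ⟨by positivity, hxs⟩)
      (Real.sqrt_nonneg _)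
  have hsa : 1 ≤ s * a := one_le_mul_of_one_le_of_one_le hS hA
  have hh2 : 1 ≤ h ^ 2 := one_le_pow₀ hH'
  have hs_le : s ≤ s * a := le_mul_of_one_le_right (by linarith) hA
  have hq : h ^ 2 ≤ (h ^ 2) ^ 2 := by nlinarith
  have b0 : √(s * L) * √K ≤ h ^ 2 * (s * a) * √(L * K) := by
    rw [← Real.sqrt_mul (by positivity), mul_assoc]
    refine bound (by linarith) ?_
    calc s ≤ 1 * (s * a) ^ 2 := by nlinarith
      _ ≤ (h ^ 2) ^ 2 * (s * a) ^ 2 := by gcongr; linarith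
      _ = _ := by ring
  have b1 : √(s * L) * √(h * s * a * (K * h)) ≤ h ^ 2 * (s * a) * √(L * K) := by
    rw [← Real.sqrt_mul (by positivity),
      show s * L * (h * s * a * (K * h)) = h ^ 2 * (s * (s * a)) * (L * K) by ring]
    refine bound (by positivity) ?_
    calc h ^ 2 * (s * (s * a)) ≤ (h ^ 2) ^ 2 * ((s * a) * (s * a)) := by gcongr
      _ = _ := by ring
  have b2 : √L * √((h * s * a) ^ 2 * (K * h ^ 2)) ≤ h ^ 2 * (s * a) * √(L * K) := by
    rw [← Real.sqrt_mul hL,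
      show L * ((h * s * a) ^ 2 * (K * h ^ 2)) = (h ^ 2 * (s * a)) ^ 2 * (L * K) by ring]
    exact bound (by positivity) le_rfl
  rw [Fintype.sum_sum_type, Fintype.sum_option]
  simp only [exponent, c0, mul_assoc (8 : ℝ), ← Finset.mul_sum]
  have m1 := mul_le_mul_of_nonneg_left c1 (Real.sqrt_nonneg (s * L))
  have m2 := mul_le_mul_of_nonneg_left c2 (Real.sqrt_nonneg L)
  linarith

end Counting

/-! ### The learner and the deterministic part of its analysis -/

section Learner

variable {S A : Type*} {R : Finset ℝ} {H : ℕ} [Fintype S] [Fintype A] [Nonempty A]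

open Classical in
/-- The exploration policy is optimal for the bonus in some model that is consistent with the
data. -/
noncomputable def explorePolicy (L : ℝ) (D : List (Trajectory S A R H)) :
    List (S × A) → S → A :=
  if h : ∃ 𝓜 : RMMDP 2 S A R, Consistent L 𝓜 D then
    greedy h.choose.nextProb (bonus L D) H
  else fun _ _ => Classical.arbitrary A

open Classical in
/-- The returned policy is optimal in some model that is consistent with the data. -/
noncomputable def outputPolicy (L : ℝ) (D : List (Trajectory S A R H)) : Policy S A R :=
  if h : ∃ 𝓜 : RMMDP 2 S A R, Consistent L 𝓜 D then
    (exists_optimal_policy h.choose H).choose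
  else fun _ _ => Classical.arbitrary A

/-- The learner that keeps a confidence set of models. -/
noncomputable def confidenceLearner (S A : Type*) [Fintype S] [Fintype A] [Nonempty A]
    (R : Finset ℝ) (H : ℕ) (L : ℝ) (K : ℕ) : Learner S A R H where
  episodes := K
  explore D := fun h => explorePolicy L D (saList h)
  output D := outputPolicy L D

/-- Expected bonus of the next episode. -/
noncomputable def bonusMean (L : ℝ) (𝓜 : RMMDP 2 S A R) (D : List (Trajectory S A R H)) : ℝ :=
  ∑ τ : Trajectory S A R H, 𝓜.trajProb (fun h => explorePolicy L D (saList h)) τ *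
    bonus L D (saTraj τ)

/-- Compare four values: the optimum in the true model, the same policy in the consistent model
chosen by the learner, the optimum there, and the learner's policy back in the true model. Each of
the two changes of model costs a factor 1 + 2H · 3H² ≤ 7H³. -/
theorem optVal_bonus_le_bonusMean [Nonempty S] (hH : 1 ≤ H) {L : ℝ} (hL : 1 ≤ L)
    {𝓜 : RMMDP 2 S A R} {D : List (Trajectory S A R H)} (hc : Consistent L 𝓜 D) :
    optVal 𝓜.nextProb (bonus L D) H [] ≤ (7 * (H : ℝ) ^ 3) ^ 2 * bonusMean L 𝓜 D := by
  have hex : ∃ 𝓜 : RMMDP 2 S A R, Consistent L 𝓜 D := ⟨𝓜, hc⟩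
  set 𝓝 := hex.choose with h𝓝
  have hc' : Consistent L 𝓝 D := hex.choose_spec
  have hH' : (1 : ℝ) ≤ H := by exact_mod_cast hH
  set b := bonus L D with hb
  have hb0 := bonus_nonneg L D
  have hm := prefixMono_bonus L D
  have hF := 𝓜.isRewardLaw_episodeProb
  have hP := 𝓜.isTransition_nextProb
  have hP' := 𝓝.isTransition_nextProb
  have hfac : 1 + 2 * (H : ℝ) * (3 * (H : ℝ) ^ 2) ≤ 7 * (H : ℝ) ^ 3 := by
    nlinarith [one_le_pow₀ hH' (n := 3)]
  have h1 := listSum_planWeight_change hP' hP hF hb0 hm (bonus_le hH L D) zero_le_two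
    ((hc'.modelClose hL hc).trans) (fun h => greedy 𝓜.nextProb b H (saList h))
  have h2 := listSum_planWeight_change hP hP' hF hb0 hm (bonus_le hH L D) zero_le_two
    ((hc.modelClose hL hc').trans) (fun h => greedy 𝓝.nextProb b H (saList h))
  have h3 := listSum_planWeight_le hP' hb0 hm (hF.isCausal H)
    (fun h => greedy 𝓜.nextProb b H (saList h)) le_rfl
  rw [← hb, listSum_planWeight_greedy _ _ hF] at h1 h2
  rw [hF.nil, one_mul, ← hb] at h3
  have h4 : listSum H (fun h => planWeight 𝓜.nextProb
      (fun h => greedy 𝓝.nextProb b H (saList h)) h * (𝓜.episodeProb h * b (saList h))) =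
      bonusMean L 𝓜 D := by
    rw [← sum_trajProb_mul hc.weight _ (fun h => b (saList h)), bonusMean]
    refine Finset.sum_congr rfl fun τ _ => ?_
    simp only [explorePolicy, dif_pos hex]
    rfl
  rw [h4] at h2
  have hB0 : 0 ≤ bonusMean L 𝓜 D :=
    Finset.sum_nonneg fun τ _ => mul_nonneg (trajProb_nonneg hc.weight _ _) (hb0 _)
  have hO := optVal_nonneg hP'.nonneg hb0 H []
  calc _ ≤ _ := h1
    _ ≤ 7 * (H : ℝ) ^ 3 * optVal 𝓝.nextProb b H [] := by
        refine mul_le_mul hfac h3 (Finset.sum_nonneg fun τ _ => ?_) (by positivity)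
        exact mul_nonneg (planWeight_nonneg hP'.nonneg _ _) (mul_nonneg (hF.nonneg _) (hb0 _))
    _ ≤ 7 * (H : ℝ) ^ 3 * (7 * (H : ℝ) ^ 3 * bonusMean L 𝓜 D) := by
        refine mul_le_mul_of_nonneg_left (h2.trans ?_) (by positivity)
        exact mul_le_mul_of_nonneg_right hfac hB0
    _ = _ := by ring

/-- The final bonus is below every earlier one, so K times its optimal value is bounded by the
expected bonuses of all episodes. The martingale hypothesis replaces these by collected bonuses: 33
= 24 + 3 · 3 and 1617 = 49 · 33. -/
theorem optVal_bonus_le [Nonempty S] (hH : 1 ≤ H) {L : ℝ} (hL : 1 ≤ L)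
    {𝓜 : RMMDP 2 S A R} {D : List (Trajectory S A R H)}
    (hc : ∀ k ≤ D.length, Consistent L 𝓜 (D.take k))
    (hM : pathSum (fun D τ => (bonusMean L 𝓜 D - bonus L D (saTraj τ)) / (3 * (H : ℝ) ^ 2)) D ≤
      √(8 * D.length * L)) :
    D.length * optVal 𝓜.nextProb (bonus L D) H [] ≤
      1617 * (H : ℝ) ^ 8 * (Fintype.card S * Fintype.card A) * √(L * D.length) := by
  have hH' : (1 : ℝ) ≤ H := by exact_mod_cast hH
  have hS : (1 : ℝ) ≤ Fintype.card S := by exact_mod_cast Fintype.card_pos (α := S)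
  have hA : (1 : ℝ) ≤ Fintype.card A := by exact_mod_cast Fintype.card_pos (α := A)
  have h1 : D.length * optVal 𝓜.nextProb (bonus L D) H [] ≤
      pathSum (fun D' _ => (7 * (H : ℝ) ^ 3) ^ 2 * bonusMean L 𝓜 D') D := by
    rw [← pathSum_const_eq]
    refine pathSum_mono_of_prefix fun D' x hpre => ?_
    have hpre' : D' <+: D := (List.prefix_append _ _).trans hpre
    obtain ⟨E, rfl⟩ := hpre'
    refine (optVal_mono 𝓜.isTransition_nextProb.nonneg (bonus_append_le L D' E) H []).trans ?_
    refine optVal_bonus_le_bonusMean hH hL ?_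
    have := hc D'.length (by simp)
    rwa [List.take_left'] at this
    rfl
  rw [pathSum_mul_left] at h1
  have h2 : pathSum (fun D' (_ : Trajectory S A R H) => bonusMean L 𝓜 D') D =
      pathSum (fun D τ => bonus L D (saTraj τ)) D + 3 * (H : ℝ) ^ 2 *
      pathSum (fun D τ => (bonusMean L 𝓜 D - bonus L D (saTraj τ)) / (3 * (H : ℝ) ^ 2)) D := by
    rw [← pathSum_mul_left, ← pathSum_add]
    congr 1
    funext D' τ
    field_simp
    ring
  have h3 := (pathSum_bonus_le L D).trans (sum_sqrt_count_le hH (by linarith) D)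
  have h4 : √(8 * D.length * L) ≤ 3 * √(L * D.length) := by
    rw [show 8 * (D.length : ℝ) * L = 8 * (L * D.length) by ring, Real.sqrt_mul (by norm_num)]
    refine mul_le_mul_of_nonneg_right ?_ (Real.sqrt_nonneg _)
    exact Real.sqrt_le_iff.2 ⟨by norm_num, by norm_num⟩
  set s : ℝ := (Fintype.card S : ℝ)
  set a : ℝ := (Fintype.card A : ℝ)
  set q := √(L * D.length)
  have hsa : 1 ≤ s * a := one_le_mul_of_one_le_of_one_le hS hA
  have hq : 0 ≤ q := Real.sqrt_nonneg _
  have h5 : pathSum (fun D' (_ : Trajectory S A R H) => bonusMean L 𝓜 D') D ≤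
      33 * (H : ℝ) ^ 2 * (s * a) * q := by
    rw [h2]
    have h6 := mul_le_mul_of_nonneg_left (hM.trans h4) (show 0 ≤ 3 * (H : ℝ) ^ 2 by positivity)
    have h7 : (H : ℝ) ^ 2 * q * 1 ≤ (H : ℝ) ^ 2 * q * (s * a) := by gcongr
    nlinarith
  calc _ ≤ _ := h1
    _ ≤ (7 * (H : ℝ) ^ 3) ^ 2 * (33 * (H : ℝ) ^ 2 * (s * a) * q) := by gcongr
    _ = _ := by ring

/-- The true model and the model used for the output are both consistent, so their values agree
within ε/2 for every policy; the comparison is used for the competitor and for the output. -/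
theorem isEpsOptimal_outputPolicy [Nonempty S] (hR : ∀ z ∈ R, |z| ≤ 1)
    (hHR : 1 ≤ (H : ℝ) * R.card) (hH : 1 ≤ H) {L : ℝ} (hL : 1 ≤ L)
    {𝓜 : RMMDP 2 S A R} {D : List (Trajectory S A R H)} (hD : 0 < D.length)
    (hc : ∀ k ≤ D.length, Consistent L 𝓜 (D.take k))
    (hM : pathSum (fun D τ => (bonusMean L 𝓜 D - bonus L D (saTraj τ)) / (3 * (H : ℝ) ^ 2)) D ≤
      √(8 * D.length * L)) {ε : ℝ}
    (hε : 1300068 * (H : ℝ) ^ 10 * (H * R.card : ℝ) ^ 6 * (Fintype.card S * Fintype.card A) *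
      √L ≤ ε * √D.length) :
    𝓜.IsEpsOptimal H ε (outputPolicy L D) := by
  have hcD : Consistent L 𝓜 D := by simpa using hc D.length le_rfl
  have hex : ∃ 𝓜 : RMMDP 2 S A R, Consistent L 𝓜 D := ⟨𝓜, hcD⟩
  set 𝓝 := hex.choose with h𝓝
  have hc' : Consistent L 𝓝 D := hex.choose_spec
  have hopt : ∀ π', 𝓝.value H π' ≤ 𝓝.value H (outputPolicy L D) := by
    have := (exists_optimal_policy 𝓝 H).choose_spec
    simp only [outputPolicy, dif_pos hex]
    exact this
  have hV := optVal_bonus_le hH hL hc hM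
  set V := optVal 𝓜.nextProb (bonus L D) H [] with hVdef
  have hclose := fun π => abs_value_sub_le hcD.weight hc'.weight hR
    (fun l => mul_nonneg zero_le_two (bonus_nonneg L D l))
    (fun l x => mul_le_mul_of_nonneg_left (prefixMono_bonus L D l x) zero_le_two)
    (hcD.modelClose hL hc') hHR π
  rw [optVal_const_mul zero_le_two, ← hVdef] at hclose
  have hK : (0 : ℝ) < D.length := by exact_mod_cast hD
  set K : ℝ := (D.length : ℝ)
  set N : ℝ := H * R.card
  have hsK : 0 < √K := Real.sqrt_pos.2 hK
  -- The models are close with bound twice the bonus, hence 2V; the constant in the hypothesis is 2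
  -- · 402 · 1617.
  have hhalf : 201 * (H : ℝ) ^ 2 * N ^ 6 * (2 * V) ≤ ε / 2 := by
    have e1 : K * (201 * (H : ℝ) ^ 2 * N ^ 6 * (2 * V)) ≤ K * (ε / 2) := by
      calc K * (201 * (H : ℝ) ^ 2 * N ^ 6 * (2 * V)) =
            402 * (H : ℝ) ^ 2 * N ^ 6 * (K * V) := by ring
        _ ≤ 402 * (H : ℝ) ^ 2 * N ^ 6 * (1617 * (H : ℝ) ^ 8 *
            (Fintype.card S * Fintype.card A) * √(L * K)) := by gcongr
        _ = (1300068 * (H : ℝ) ^ 10 * N ^ 6 * (Fintype.card S * Fintype.card A) * √L) *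
            √K / 2 := by rw [Real.sqrt_mul (by linarith)]; ring
        _ ≤ ε * √K * √K / 2 := by gcongr
        _ = K * (ε / 2) := by rw [mul_assoc, Real.mul_self_sqrt hK.le]; ring
    exact le_of_mul_le_mul_left e1 hK
  intro π'
  have a1 := (abs_le.1 ((hclose π').trans hhalf)).2
  have a2 := (abs_le.1 ((hclose (outputPolicy L D)).trans hhalf)).1
  have a3 := hopt π'
  linarith

end Learner

/-! ### Failure probability -/

section Probability

variable {S A : Type*} {R : Finset ℝ} {H : ℕ} [Fintype S] [Fintype A] [Nonempty A]

/-- Law of the next trajectory that is observed by the confidence learner. -/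
noncomputable def dataKernel (L : ℝ) (𝓜 : RMMDP 2 S A R) (D : List (Trajectory S A R H))
    (τ : Trajectory S A R H) : ℝ :=
  𝓜.trajProb (fun h => explorePolicy L D (saList h)) τ

theorem isKernel_dataKernel (L : ℝ) {𝓜 : RMMDP 2 S A R} (hw : ∀ m, 𝓜.weight m = 1 / 2) :
    IsKernel (dataKernel (H := H) L 𝓜) where
  nonneg _ _ := trajProb_nonneg hw _ _
  sum_eq _ := sum_trajProb hw _

open Classical in
theorem successProb_confidenceLearner (L : ℝ) (K : ℕ) (𝓜 : RMMDP 2 S A R) (ε : ℝ) :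
    (confidenceLearner S A R H L K).successProb 𝓜 ε =
      listSum K (fun D : List (Trajectory S A R H) => pathProd (dataKernel L 𝓜) D *
        if 𝓜.IsEpsOptimal H ε (outputPolicy L D) then 1 else 0) := by
  unfold listSum Learner.successProb
  refine Finset.sum_congr rfl fun (D : Fin K → Trajectory S A R H) _ => ?_
  beta_reduce
  rw [mul_ite, mul_one, mul_zero, pathProd_ofFn]
  rfl

open Classical in
-- A test on the first k episodes is unaffected by the later ones, so they are integrated out before
-- the tail bound is applied.
theorem listSum_test_fail_le [Nonempty S] {L : ℝ} (hL : 0 ≤ L) {𝓜 : RMMDP 2 S A R}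
    (hw : ∀ m, 𝓜.weight m = 1 / 2) (j : Test S A R H) {k K : ℕ} (hk : k ≤ K) :
    listSum K (fun D => pathProd (dataKernel L 𝓜) D *
      if √(8 * count (D.take k) (testIndex j) * exponent L (testIndex j)) <
        testDev (D.take k) j (testMean 𝓜 j) then 1 else 0) ≤
      K * Real.exp (-exponent L (testIndex j)) := by
  have hκ := isKernel_dataKernel (H := H) L hw
  rw [hκ.listSum_take (fun D => if √(8 * count D (testIndex j) * exponent L (testIndex j)) <
        testDev D j (testMean 𝓜 j) then 1 else 0) hk]
  simp only [count_eq_pathSum, testDev_eq_pathSum]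
  refine (hκ.listSum_tail_le (φ := fun _ τ => eventInd (testIndex j) (saTraj τ))
    (y := fun _ τ => testObs j τ - testMean 𝓜 j) (fun _ τ => eventInd_eq_zero_or_one _ _)
    (fun _ τ => ?_) (fun D => sum_trajProb_test_eq_zero hw _ j)
    (hL.trans (le_exponent hL _)) k).trans ?_
  · have h1 := abs_le.1 (abs_testObs_le j τ)
    have h2 := abs_le.1 (abs_testMean_le 𝓜 j)
    rw [abs_le]
    constructor <;> linarith
  · gcongr

open Classical in
-- The differences between expected and collected bonus are centred given the past, and dividing by
-- 3H² bounds them by 1; the sure event serves as indicator.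
theorem listSum_bonus_fail_le {L : ℝ} (hL : 0 ≤ L) (hH : 1 ≤ H) {𝓜 : RMMDP 2 S A R}
    (hw : ∀ m, 𝓜.weight m = 1 / 2) (K : ℕ) :
    listSum K (fun D => pathProd (dataKernel L 𝓜) D *
      if √(8 * D.length * L) < pathSum (fun D (τ : Trajectory S A R H) =>
        (bonusMean L 𝓜 D - bonus L D (saTraj τ)) / (3 * (H : ℝ) ^ 2)) D then 1 else 0) ≤
      K * Real.exp (-L) := by
  have hκ := isKernel_dataKernel (H := H) L hw
  have hH' : (1 : ℝ) ≤ H := by exact_mod_cast hH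
  have hB : (0 : ℝ) < 3 * (H : ℝ) ^ 2 := by positivity
  have hmean0 : ∀ D : List (Trajectory S A R H), 0 ≤ bonusMean L 𝓜 D := fun D =>
    Finset.sum_nonneg fun τ _ => mul_nonneg (trajProb_nonneg hw _ _) (bonus_nonneg L D _)
  have hmean1 : ∀ D : List (Trajectory S A R H), bonusMean L 𝓜 D ≤ 3 * (H : ℝ) ^ 2 := by
    intro D
    calc bonusMean L 𝓜 D ≤ ∑ τ : Trajectory S A R H, dataKernel L 𝓜 D τ * (3 * (H : ℝ) ^ 2) :=
          Finset.sum_le_sum fun τ _ =>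
            mul_le_mul_of_nonneg_left (bonus_le hH L D _) (hκ.nonneg D τ)
      _ = _ := by rw [← Finset.sum_mul, hκ.sum_eq, one_mul]
  have := hκ.listSum_tail_le (φ := fun _ _ => 1)
    (y := fun D τ => (bonusMean L 𝓜 D - bonus L D (saTraj τ)) / (3 * (H : ℝ) ^ 2))
    (fun _ _ => Or.inr rfl) (fun D τ => ?_) (fun D => ?_) hL K
  · simpa only [one_mul, pathSum_const_eq, mul_one] using this
  · rw [abs_div, abs_of_pos hB, div_le_iff₀ hB, abs_le]
    have h1 := hmean0 D
    have h2 := hmean1 D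
    have h3 := bonus_nonneg L D (saTraj τ)
    have h4 := bonus_le hH L D (saTraj τ)
    constructor <;> linarith
  · have e : ∀ τ : Trajectory S A R H, dataKernel L 𝓜 D τ *
        (1 * ((bonusMean L 𝓜 D - bonus L D (saTraj τ)) / (3 * (H : ℝ) ^ 2))) =
        (dataKernel L 𝓜 D τ * bonusMean L 𝓜 D - dataKernel L 𝓜 D τ * bonus L D (saTraj τ)) /
          (3 * (H : ℝ) ^ 2) := fun τ => by ring
    simp only [e]
    rw [← Finset.sum_div, Finset.sum_sub_distrib, ← Finset.sum_mul, hκ.sum_eq, one_mul]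
    simp [bonusMean, dataKernel]

open Classical in
-- There are 2^S sign patterns per site, and the exponent SL pays for them: 2^S exp(−SL) ≤ exp(S(1 −
-- L)) ≤ exp(1 − L). For rewards and pairs of rewards the number of tests is polynomial.
theorem sum_exp_neg_exponent_le [Nonempty S] (hHR : 1 ≤ (H : ℝ) * R.card) (hH : 1 ≤ H) {L : ℝ}
    (hL : 1 ≤ L) :
    ∑ j : Test S A R H, Real.exp (-exponent L (testIndex j)) ≤
      6 * (Fintype.card S * Fintype.card A * (H * R.card) : ℝ) ^ 2 * Real.exp (1 - L) := by
  have hS : (1 : ℝ) ≤ Fintype.card S := by exact_mod_cast Fintype.card_pos (α := S)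
  have hA : (1 : ℝ) ≤ Fintype.card A := by exact_mod_cast Fintype.card_pos (α := A)
  have hH' : (1 : ℝ) ≤ H := by exact_mod_cast hH
  have hZ : (1 : ℝ) ≤ R.card := by
    have : 0 < R.card := by
      by_contra h
      simp only [not_lt, nonpos_iff_eq_zero] at h
      simp only [h, Nat.cast_zero, mul_zero] at hHR
      linarith
    exact_mod_cast this
  rw [Fintype.sum_sum_type, Fintype.sum_sum_type]
  simp only [testIndex, exponent, Finset.sum_const, Finset.card_univ, nsmul_eq_mul,
    Fintype.card_prod, Fintype.card_option, Fintype.card_fin, Fintype.card_fun, Fintype.card_bool,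
    Fintype.card_coe]
  push_cast
  set s : ℝ := (Fintype.card S : ℝ)
  set a : ℝ := (Fintype.card A : ℝ)
  set h : ℝ := (H : ℝ)
  set z : ℝ := (R.card : ℝ)
  set E := Real.exp (1 - L)
  have hE : 0 < E := Real.exp_pos _
  have e1 : (2 : ℝ) ^ Fintype.card S * Real.exp (-(s * L)) ≤ E := by
    have h2 : (2 : ℝ) ≤ Real.exp 1 := by linarith [Real.add_one_le_exp (1 : ℝ)]
    calc (2 : ℝ) ^ Fintype.card S * Real.exp (-(s * L)) ≤
          Real.exp 1 ^ Fintype.card S * Real.exp (-(s * L)) := by gcongr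
      _ = Real.exp (s + -(s * L)) := by
          rw [← Real.exp_nat_mul, mul_one, Real.exp_add]
      _ ≤ E := Real.exp_le_exp.2 (by nlinarith)
  have e2 : Real.exp (-(s * L)) ≤ E := Real.exp_le_exp.2 (by nlinarith)
  have e3 : Real.exp (-L) ≤ E := Real.exp_le_exp.2 (by linarith)
  set G := s * a * (h * z) with hG
  have hsa : 1 ≤ s * a := one_le_mul_of_one_le_of_one_le hS hA
  have hG1 : 1 ≤ G := one_le_mul_of_one_le_of_one_le hsa hHR
  have hG2 : G ≤ G ^ 2 := by nlinarith
  have g1 : h * (s * a) ≤ G := by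
    rw [hG]
    have : h ≤ h * z := le_mul_of_one_le_right (by linarith) hZ
    nlinarith
  calc (h * (s * a) + 1) * 2 ^ Fintype.card S * Real.exp (-(s * L)) +
        (h * (s * a) * (z * 2) * Real.exp (-(s * L)) +
          h * (s * a) * (h * (s * a) * (z * (z * 2))) * Real.exp (-L)) =
        (h * (s * a) + 1) * (2 ^ Fintype.card S * Real.exp (-(s * L))) +
        (2 * G * Real.exp (-(s * L)) + 2 * G ^ 2 * Real.exp (-L)) := by rw [hG]; ring
    _ ≤ (G + G) * E + (2 * G * E + 2 * G ^ 2 * E) := by gcongr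
    _ ≤ _ := by nlinarith

open Classical in
-- Union bound over all tests on all prefixes of the data, since consistency is needed at every
-- episode, together with the single martingale event for the bonuses.
theorem le_successProb_confidenceLearner [Nonempty S] (hR : ∀ z ∈ R, |z| ≤ 1)
    (hHR : 1 ≤ (H : ℝ) * R.card) (hH : 1 ≤ H) {L : ℝ} (hL : 1 ≤ L) {𝓜 : RMMDP 2 S A R}
    (hw : ∀ m, 𝓜.weight m = 1 / 2) {K : ℕ} (hK : 0 < K) {ε : ℝ}
    (hε : 1300068 * (H : ℝ) ^ 10 * (H * R.card : ℝ) ^ 6 * (Fintype.card S * Fintype.card A) *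
      √L ≤ ε * √K) :
    1 - ((K + 1) * (K * (6 * (Fintype.card S * Fintype.card A * (H * R.card) : ℝ) ^ 2 *
      Real.exp (1 - L))) + K * Real.exp (-L)) ≤
      (confidenceLearner S A R H L K).successProb 𝓜 ε := by
  have hκ := isKernel_dataKernel (H := H) L hw
  have hL0 : 0 ≤ L := by linarith
  rw [successProb_confidenceLearner]
  let bad : ℕ → Test S A R H → List (Trajectory S A R H) → ℝ := fun k j D =>
    if √(8 * count (D.take k) (testIndex j) * exponent L (testIndex j)) <
        testDev (D.take k) j (testMean 𝓜 j) then 1 else 0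
  let bad' : List (Trajectory S A R H) → ℝ := fun D =>
    if √(8 * D.length * L) < pathSum (fun D (τ : Trajectory S A R H) =>
        (bonusMean L 𝓜 D - bonus L D (saTraj τ)) / (3 * (H : ℝ) ^ 2)) D then 1 else 0
  let good : List (Trajectory S A R H) → ℝ := fun D =>
    if 𝓜.IsEpsOptimal H ε (outputPolicy L D) then 1 else 0
  have hbad0 : ∀ k j D, 0 ≤ bad k j D := fun k j D => by
    simp only [bad]; split_ifs <;> norm_num
  have hbad0' : ∀ D, 0 ≤ bad' D := fun D => by
    simp only [bad']; split_ifs <;> norm_num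
  have hgood0 : ∀ D, 0 ≤ good D := fun D => by
    simp only [good]; split_ifs <;> norm_num
  have hpt : ∀ D : List (Trajectory S A R H), D.length = K →
      1 ≤ good D + ((∑ k ∈ Finset.range (K + 1), ∑ j, bad k j D) + bad' D) := by
    intro D hD
    have hs0 : 0 ≤ ∑ k ∈ Finset.range (K + 1), ∑ j, bad k j D :=
      Finset.sum_nonneg fun k _ => Finset.sum_nonneg fun j _ => hbad0 k j D
    by_cases h1 : ∀ k ≤ K, ∀ j : Test S A R H, testDev (D.take k) j (testMean 𝓜 j) ≤
        √(8 * count (D.take k) (testIndex j) * exponent L (testIndex j))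
    · by_cases h2 : pathSum (fun D (τ : Trajectory S A R H) =>
          (bonusMean L 𝓜 D - bonus L D (saTraj τ)) / (3 * (H : ℝ) ^ 2)) D ≤ √(8 * D.length * L)
      · have : 𝓜.IsEpsOptimal H ε (outputPolicy L D) :=
          isEpsOptimal_outputPolicy hR hHR hH hL (by omega)
            (fun k hk => ⟨hw, h1 k (by omega)⟩) h2 (by rw [hD]; exact hε)
        have hg : good D = 1 := if_pos this
        linarith [hbad0' D]
      · have hb : bad' D = 1 := if_pos (not_le.1 h2)
        linarith [hgood0 D]
    · push Not at h1
      obtain ⟨k, hk, j, hj⟩ := h1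
      have hb : bad k j D = 1 := if_pos hj
      have s1 := Finset.single_le_sum (f := fun k => ∑ j, bad k j D)
        (fun k _ => Finset.sum_nonneg fun j _ => hbad0 k j D)
        (Finset.mem_range.2 (Nat.lt_succ_of_le hk))
      have s2 := Finset.single_le_sum (f := fun j => bad k j D) (fun j _ => hbad0 k j D)
        (Finset.mem_univ j)
      linarith [hbad0' D, hgood0 D]
  have htot : 1 ≤ listSum K (fun D => pathProd (dataKernel L 𝓜) D * good D) +
      ((∑ k ∈ Finset.range (K + 1), ∑ j, listSum K (fun D => pathProd (dataKernel L 𝓜) D *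
        bad k j D)) + listSum K (fun D => pathProd (dataKernel L 𝓜) D * bad' D)) := by
    rw [← hκ.listSum_eq_one K]
    simp only [← listSum_finset_sum, ← listSum_add]
    refine listSum_mono fun D hD => ?_
    simp only [← Finset.mul_sum, ← mul_add]
    exact le_mul_of_one_le_right (pathProd_nonneg hκ.nonneg D) (hpt D hD)
  have hb' : listSum K (fun D => pathProd (dataKernel L 𝓜) D * bad' D) ≤ K * Real.exp (-L) :=
    listSum_bonus_fail_le hL0 hH hw K
  have hb : ∑ k ∈ Finset.range (K + 1), ∑ j, listSum K (fun D => pathProd (dataKernel L 𝓜) D *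
      bad k j D) ≤ (K + 1) * (K * (6 * (Fintype.card S * Fintype.card A *
        (H * R.card) : ℝ) ^ 2 * Real.exp (1 - L))) := by
    calc _ ≤ ∑ k ∈ Finset.range (K + 1), ∑ j : Test S A R H,
          (K : ℝ) * Real.exp (-exponent L (testIndex j)) :=
          Finset.sum_le_sum fun k hk => Finset.sum_le_sum fun j _ =>
            listSum_test_fail_le hL0 hw j (Nat.lt_succ_iff.1 (Finset.mem_range.1 hk))
      _ = (K + 1) * (K * ∑ j : Test S A R H, Real.exp (-exponent L (testIndex j))) := by
          rw [Finset.sum_const, Finset.card_range, nsmul_eq_mul, ← Finset.mul_sum]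
          push_cast
          rfl
      _ ≤ _ := by
          gcongr
          exact sum_exp_neg_exponent_le hHR hH hL
  change _ ≤ listSum K (fun D => pathProd (dataKernel L 𝓜) D * good D)
  linarith

/-- If the horizon is short compared with `ε`, every policy is `ε`-optimal. -/
theorem successProb_eq_one_of_two_mul_le (hR : ∀ z ∈ R, |z| ≤ 1) {ε : ℝ} (hε : 2 * (H : ℝ) ≤ ε)
    {𝓜 : RMMDP 2 S A R} (hw : ∀ m, 𝓜.weight m = 1 / 2) (L : ℝ) :
    (confidenceLearner S A R H L 0).successProb 𝓜 ε = 1 := by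
  have hopt : ∀ π, 𝓜.IsEpsOptimal H ε π := by
    intro π π'
    have h1 := abs_le.1 (abs_value_le (H := H) hw hR π)
    have h2 := abs_le.1 (abs_value_le (H := H) hw hR π')
    linarith
  rw [successProb_confidenceLearner]
  simp only [hopt, if_true, mul_one]
  exact (isKernel_dataKernel L hw).listSum_eq_one 0

end Probability

end RMMDP

/-! ### Choice of the constants -/

theorem mainTheorem4 :
    ∃ (C : ℝ) (p q : ℕ), 0 < C ∧
      ∀ (S A : Type*) [Fintype S] [Fintype A] [Nonempty A]
        (R : Finset ℝ) (_ : ∀ z ∈ R, |z| ≤ 1) (H : ℕ) (ε η : ℝ) (K : ℕ),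
        0 < ε → 0 < η → η < 1 →
        C * ((Fintype.card S : ℝ) * Fintype.card A) ^ 2 / ε ^ 2 * ((H : ℝ) * R.card) ^ p
            * (1 + Real.log (K / η)) ^ q ≤ K →
        ∃ 𝓛 : RMMDP.Learner S A R H, 𝓛.episodes ≤ K ∧
          ∀ 𝓜 : RMMDP 2 S A R, (∀ m, 𝓜.weight m = 1 / 2) →
            1 - η ≤ 𝓛.successProb 𝓜 ε := by
  -- With N = H · `R.card`, squaring the requirement gives (H¹⁰N⁶)² ≤ N³² and the constant 4 ·
  -- 1300068² < 10¹³, where 4 is the factor in L = 4ℓ.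
  refine ⟨10 ^ 13, 32, 1, by norm_num, ?_⟩
  intro S A _ _ _ R hR H ε η K hε hη hη1 hK
  rw [pow_one] at hK
  -- Values lie in [−H, H], so for large ε no episode is needed; afterwards ε < 2H is available.
  rcases le_or_gt (2 * (H : ℝ)) ε with hHε | hHε
  · refine ⟨RMMDP.confidenceLearner S A R H 1 0, Nat.zero_le _, fun 𝓜 hw => ?_⟩
    rw [RMMDP.successProb_eq_one_of_two_mul_le hR hHε hw]
    linarith
  by_cases hne : Nonempty S ∧ R.Nonempty
  swap
  · refine ⟨RMMDP.confidenceLearner S A R H 1 0, Nat.zero_le _, fun 𝓜 _ => (hne ?_).elim⟩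
    have hS : Nonempty S := by
      by_contra hS
      rw [not_nonempty_iff] at hS
      simpa using 𝓜.init_mem.2
    refine ⟨hS, ?_⟩
    rw [Finset.nonempty_iff_ne_empty]
    rintro rfl
    simpa using (𝓜.reward_mem 0 hS.some (Classical.arbitrary A)).2
  obtain ⟨hSne, hRne⟩ := hne
  have hS : (1 : ℝ) ≤ Fintype.card S := by exact_mod_cast Fintype.card_pos (α := S)
  have hA : (1 : ℝ) ≤ Fintype.card A := by exact_mod_cast Fintype.card_pos (α := A)
  have hZ : (1 : ℝ) ≤ R.card := by exact_mod_cast Finset.card_pos.2 hRne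
  have hH : 1 ≤ H := by
    by_contra h
    have : H = 0 := by omega
    subst this
    norm_num at hHε
    linarith
  have hH' : (1 : ℝ) ≤ H := by exact_mod_cast hH
  have hHR : 1 ≤ (H : ℝ) * R.card := one_le_mul_of_one_le_of_one_le hH' hZ
  have hsa : 1 ≤ (Fintype.card S : ℝ) * Fintype.card A := one_le_mul_of_one_le_of_one_le hS hA
  have hHN : (H : ℝ) ≤ H * R.card := le_mul_of_one_le_right (by linarith) hZ
  have hK0 : 0 < K := by
    by_contra h
    have : K = 0 := by omega
    subst this
    -- For K = 0 the convention log 0 = 0 makes the logarithmic factor 1, so the hypothesis would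
    -- bound a positive number by 0.
    simp only [Nat.cast_zero, zero_div, Real.log_zero, add_zero, mul_one] at hK
    have : (0 : ℝ) < 10 ^ 13 * ((Fintype.card S : ℝ) * Fintype.card A) ^ 2 / ε ^ 2 *
      ((H : ℝ) * R.card) ^ 32 := by positivity
    linarith
  have hK1 : (1 : ℝ) ≤ K := by exact_mod_cast hK0
  set ℓ := 1 + Real.log (K / η) with hℓ
  have hℓ1 : 1 ≤ ℓ := by
    have : 0 ≤ Real.log (K / η) := Real.log_nonneg (by rw [le_div_iff₀ hη]; linarith)
    linarith
  set s : ℝ := (Fintype.card S : ℝ)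
  set a : ℝ := (Fintype.card A : ℝ)
  set N : ℝ := (H : ℝ) * R.card
  have hKε : 10 ^ 13 * (s * a) ^ 2 * N ^ 32 * ℓ ≤ ε ^ 2 * K := by
    have h1 : 10 ^ 13 * (s * a) ^ 2 / ε ^ 2 * N ^ 32 * ℓ =
        10 ^ 13 * (s * a) ^ 2 * N ^ 32 * ℓ / ε ^ 2 := by ring
    rw [h1, div_le_iff₀ (by positivity)] at hK
    linarith
  -- Since ε ≤ 2N, the hypothesis forces K to dominate SAN, so log(K/η) also covers the logarithm of
  -- the number of tests.
  have hG : s * a * N ≤ K := by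
    have h1 : ε ^ 2 ≤ 4 * N ^ 2 := by nlinarith
    have h2 : 4 * N ^ 2 * (s * a * N) ≤ 4 * N ^ 2 * K := by
      calc 4 * N ^ 2 * (s * a * N) = 4 * (s * a) * N ^ 3 * 1 := by ring
        _ ≤ 10 ^ 13 * (s * a) ^ 2 * N ^ 32 * ℓ := by
          gcongr
          · norm_num
          · nlinarith
          · norm_num
        _ ≤ ε ^ 2 * K := hKε
        _ ≤ 4 * N ^ 2 * K := by gcongr
    exact le_of_mul_le_mul_left h2 (by positivity)
  -- The union bound has size about K²(SAN)² ≤ K⁴, and exp(−4ℓ) supplies the fourth power of η/K.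
  refine ⟨RMMDP.confidenceLearner S A R H (4 * ℓ) K, le_rfl, fun 𝓜 hw => ?_⟩
  have hmain : 1300068 * (H : ℝ) ^ 10 * N ^ 6 * (s * a) * √(4 * ℓ) ≤ ε * √K := by
    refine abs_le_of_sq_le_sq' ?_ (by positivity) |>.2
    rw [mul_pow, mul_pow ε, Real.sq_sqrt (by linarith), Real.sq_sqrt (by linarith)]
    refine le_trans ?_ hKε
    calc (1300068 * (H : ℝ) ^ 10 * N ^ 6 * (s * a)) ^ 2 * (4 * ℓ) ≤
          (1300068 * N ^ 10 * N ^ 6 * (s * a)) ^ 2 * (4 * ℓ) := by gcongr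
      _ = (1300068 ^ 2 * 4) * ((s * a) ^ 2 * N ^ 32 * ℓ) := by ring
      _ ≤ 10 ^ 13 * ((s * a) ^ 2 * N ^ 32 * ℓ) := by
          gcongr
          norm_num
      _ = _ := by ring
  refine le_trans ?_ (RMMDP.le_successProb_confidenceLearner hR hHR hH
    (by linarith : 1 ≤ 4 * ℓ) hw hK0 hmain)
  have hexp : Real.exp (1 - 4 * ℓ) = Real.exp (-3) * (η / K) ^ 4 := by
    have h1 : (η / K) ^ 4 = Real.exp (-(4 * Real.log (K / η))) := by
      rw [show -(4 * Real.log (K / η)) = ((4 : ℕ) : ℝ) * Real.log (η / K) by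
        rw [← inv_div (K : ℝ) η, Real.log_inv]; push_cast; ring, Real.exp_nat_mul,
        Real.exp_log (by positivity)]
    rw [h1, ← Real.exp_add]
    congr 1
    rw [hℓ]
    ring
  have hexp' : Real.exp (-(4 * ℓ)) ≤ Real.exp (1 - 4 * ℓ) := Real.exp_le_exp.2 (by linarith)
  have hK4 : (K : ℝ) ^ 4 * Real.exp (1 - 4 * ℓ) ≤ η / 13 := by
    -- The tests contribute 12 units K⁴ exp(1 − 4ℓ) and the bonus event one, so each unit must be at
    -- most η/13.
    have h3 : Real.exp (-3) ≤ 1 / 13 := by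
      rw [Real.exp_neg, ← one_div]
      refine one_div_le_one_div_of_le (by norm_num) ?_
      have : Real.exp 3 = Real.exp 1 ^ 3 := by rw [← Real.exp_nat_mul]; norm_num
      rw [this]
      have h27 : (2.7 : ℝ) ≤ Real.exp 1 := by linarith [Real.exp_one_gt_d9]
      calc (13 : ℝ) ≤ 2.7 ^ 3 := by norm_num
        _ ≤ _ := by gcongr
    have h4 : η ^ 4 ≤ η := pow_le_of_le_one hη.le hη1.le (by norm_num)
    calc (K : ℝ) ^ 4 * Real.exp (1 - 4 * ℓ) = Real.exp (-3) * η ^ 4 := by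
          rw [hexp]; field_simp
      _ ≤ 1 / 13 * η := by gcongr
      _ = η / 13 := by ring
  set E := Real.exp (1 - 4 * ℓ)
  have hE : 0 < E := Real.exp_pos _
  have f1 : ((K : ℝ) + 1) * (K * (6 * (s * a * N) ^ 2 * E)) ≤ 12 * (K ^ 4 * E) := by
    calc ((K : ℝ) + 1) * (K * (6 * (s * a * N) ^ 2 * E)) ≤
          (K + K) * (K * (6 * (K : ℝ) ^ 2 * E)) := by gcongr
      _ = _ := by ring
  have f2 : (K : ℝ) * Real.exp (-(4 * ℓ)) ≤ K ^ 4 * E := by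
    have : (K : ℝ) ≤ K ^ 4 := le_self_pow₀ hK1 (by norm_num)
    gcongr
  linarith
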